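/- **Conventions.** Let $M\subset\mathbb C^2$ and $p\in M$, where $M$ is a real-analytic hypersurface near $p$. $M$ is *Levi-flat near $p$* if, for a real-analytic local defining function $\rho$ of $M$ at $p$ ($M=\{\rho=0\}$ near $p$, $d\rho(p)\neq0$), the Levi form $\sum_{k,j}\frac{\partial^2\rho}{\partial z_k\partial\bar z_j}\xi_k\bar\xi_j$ vanishes on $T^c_qM=T_qM\cap iT_qM$ for all $q\in M$ near $p$. Local holomorphic coordinates $(z,w)$ vanishing at $p$ are *normal* for $M$ at $p$ if in them $M$ is given near $p$ by $\operatorname{Im}w=\varphi(z,\bar z,\operatorname{Re}w)$, where $\varphi(z,\chi,s)$ is given by a convergent power series at $0$, is real-valued for $\chi=\bar z$ and $s$ real, and satisfies $\varphi(z,0,s)\equiv\varphi(0,\chi,s)\equiv0$. Let $J^m_{0,0}(\mathbb C^2)$ be the space of $m$-jets at $0$ of holomorphic maps $(\mathbb C^2,0)\to(\mathbb C^2,0)$, with coordinates $\partial^\alpha H_i(0)$, $i=1,2$, $1\le|\alpha|\le m$; identify $J^1_{0,0}(\mathbb C^2)$ with the $2\times2$ matrices, and let $\mathsf T(\mathbb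 C^2)\subset J^1_{0,0}(\mathbb C^2)$ be the set of invertible upper triangular ones. For $H=(F,G)$, $H'(0)$ is the Jacobian matrix with rows $(F_z,F_w)$ and $(G_z,G_w)$ at $0$. **Theorem.** Let $M,M'\subset\mathbb C^2$ be real-analytic hypersurfaces that are not Levi-flat near $p\in M$ and near $p'\in M'$, respectively, and let $(z,w)$ and $(z',w')$ be normal coordinates for $M$ at $p$ and for $M'$ at $p'$. Then for every integer $k\ge0$ there is a $\mathbb C^2$-valued function $\Phi^k(z,\Lambda_1,\tilde\Lambda_1,\Lambda_2,\tilde\Lambda_2)$, depending only on $k$, $(M,p)$ and $(M',p')$ (in the given coordinates), which is a polynomial in $(\Lambda_2,\tilde\Lambda_2)\in J^{k+1}_{0,0}(\mathbb C^2)\times\overline{J^{k+1}_{0,0}(\mathbb C^2)}$ with coefficients holomorphic in $(z,\Lambda_1,\tilde\Lambda_1)\in\mathbb C\times J^1_{0,0}(\mathbb C^2)\times\overline{J^1_{0,0}(\mathbb C^2)}$ in a neighborhood of $\{0\}\times\mathsf T(\mathbb C^2)\times\overline{\mathsf T(\mathbb C^2)}$, such that every local biholomorphism $H:(\mathbb C^2,0)\to(\mathbb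 C^2,0)$, written in these coordinates, that sends a neighborhood of $p$ in $M$ into $M'$ satisfies $$\frac{\partial^kH}{\partial w^k}(z,0)=\Phi^k\big(z,H'(0),\overline{H'(0)},j_0^{k+1}H,\overline{j_0^{k+1}H}\big)$$ for all $z$ in a neighborhood of $0$ in $\mathbb C$ (which may depend on $H$). -/

import Mathlib

open Filter Topology
open scoped ComplexConjugate

noncomputable section

/-! Points of `ℂ²` are pairs `(z, w) : ℂ × ℂ`. -/

/-! ### Local biholomorphisms -/

/-- A homeomorphism between open subsets of `ℂ²` that is biholomorphic. -/
def IsBiholomorphic (e : OpenPartialHomeomorph (ℂ × ℂ) (ℂ × ℂ)) : Prop :=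
  DifferentiableOn ℂ e e.source ∧ DifferentiableOn ℂ e.symm e.target

/-- `H : (ℂ², 0) → (ℂ², 0)` is (the germ at `0` of) a local biholomorphism. -/
def IsLocalBiholomorphism (H : ℂ × ℂ → ℂ × ℂ) : Prop :=
  H 0 = 0 ∧ ∃ e : OpenPartialHomeomorph (ℂ × ℂ) (ℂ × ℂ),
    (0 : ℂ × ℂ) ∈ e.source ∧ IsBiholomorphic e ∧ H =ᶠ[𝓝 0] e

/-! ### Real-analytic hypersurfaces, the Levi form and Levi-flatness -/

/-- `ρ` is a real-analytic defining function of `M` near `p`: near `p` the set `M` is `{ρ = 0}`,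
and `dρ ≠ 0` at `p`. -/
def IsDefiningFunctionAt (M : Set (ℂ × ℂ)) (p : ℂ × ℂ) (ρ : ℂ × ℂ → ℝ) : Prop :=
  AnalyticAt ℝ ρ p ∧ fderiv ℝ ρ p ≠ 0 ∧ ∀ᶠ q in 𝓝 p, q ∈ M ↔ ρ q = 0

/-- The standard basis of `ℂ²`. -/
def stdVec : Fin 2 → ℂ × ℂ := ![(1, 0), (0, 1)]

/-- The Wirtinger derivative `∂f/∂z_k = (∂f/∂x_k - i ∂f/∂y_k) / 2`. -/
def wirtinger (k : Fin 2) (f : ℂ × ℂ → ℂ) (q : ℂ × ℂ) : ℂ :=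
  (fderiv ℝ f q (stdVec k) - Complex.I * fderiv ℝ f q (Complex.I • stdVec k)) / 2

/-- The Wirtinger derivative `∂f/∂z̄_k = (∂f/∂x_k + i ∂f/∂y_k) / 2`. -/
def wirtingerBar (k : Fin 2) (f : ℂ × ℂ → ℂ) (q : ℂ × ℂ) : ℂ :=
  (fderiv ℝ f q (stdVec k) + Complex.I * fderiv ℝ f q (Complex.I • stdVec k)) / 2

/-- The Levi form `∑ ∂²ρ/∂z_k∂z̄_j ξ_k ξ̄_j` of `ρ` at `q`. -/
def leviForm (ρ : ℂ × ℂ → ℝ) (q ξ : ℂ × ℂ) : ℂ :=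
  ∑ k : Fin 2, ∑ j : Fin 2,
    wirtinger k (wirtingerBar j (fun x => (ρ x : ℂ))) q * ![ξ.1, ξ.2] k * conj (![ξ.1, ξ.2] j)

/-- The complex tangent space `T ∩ iT` at `q` of `{ρ = 0}`, where `T = ker dρ(q)`. -/
def complexTangent (ρ : ℂ × ℂ → ℝ) (q : ℂ × ℂ) : Set (ℂ × ℂ) :=
  {ξ | fderiv ℝ ρ q ξ = 0 ∧ fderiv ℝ ρ q (Complex.I • ξ) = 0}

/-- `M` is a Levi-flat real-analytic hypersurface near `p`. -/
def IsLeviFlatNear (M : Set (ℂ × ℂ)) (p : ℂ × ℂ) : Prop :=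
  ∃ ρ : ℂ × ℂ → ℝ, IsDefiningFunctionAt M p ρ ∧
    ∀ᶠ q in 𝓝 p, q ∈ M → ∀ ξ ∈ complexTangent ρ q, leviForm ρ q ξ = 0

/-! ### Normal coordinates -/

/-- `x = (z, w)` lies on the graph `Im w = φ(z, z̄, Re w)`. -/
def OnGraph (φ : ℂ × ℂ × ℂ → ℂ) (x : ℂ × ℂ) : Prop :=
  (x.2.im : ℂ) = φ (x.1, conj x.1, (x.2.re : ℂ))

/-- `φ(z, χ, s)` is a convergent power series at `0` (the complexification of the real-analytic
function `φ(z, z̄, s)`, `s` real), real-valued for `χ = z̄` and `s` real, with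
`φ(z, 0, s) ≡ φ(0, χ, s) ≡ 0`. -/
structure IsNormalGraphFunction (φ : ℂ × ℂ × ℂ → ℂ) : Prop where
  analytic : AnalyticAt ℂ φ 0
  real_valued : ∀ᶠ x : ℂ × ℝ in 𝓝 0, (φ (x.1, conj x.1, (x.2 : ℂ))).im = 0
  normal_left : ∀ᶠ x : ℂ × ℂ in 𝓝 0, φ (x.1, 0, x.2) = 0
  normal_right : ∀ᶠ x : ℂ × ℂ in 𝓝 0, φ (0, x.1, x.2) = 0

/-- The biholomorphic chart `Z = (z, w)` of `ℂ²` near `p` is a system of normal coordinates for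
`M` at `p`: it vanishes at `p`, and in it `M` is given near `p` by `Im w = φ(z, z̄, Re w)` with
`φ` as above. In particular `p ∈ M`, and `M` is a real-analytic hypersurface near `p`. -/
structure IsNormalCoordinates (M : Set (ℂ × ℂ)) (p : ℂ × ℂ)
    (Z : OpenPartialHomeomorph (ℂ × ℂ) (ℂ × ℂ)) : Prop where
  mem_source : p ∈ Z.source
  map_eq_zero : Z p = 0
  biholomorphic : IsBiholomorphic Z
  graph : ∃ φ : ℂ × ℂ × ℂ → ℂ, IsNormalGraphFunction φ ∧ ∀ᶠ q in 𝓝 p, q ∈ M ↔ OnGraph φ (Z q)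

/-- The map `H`, written in the coordinates `Z` and `Z'` (vanishing at the base points), sends a
neighbourhood of the base point in `M` into `M'`. -/
def SendsInto (M M' : Set (ℂ × ℂ)) (Z Z' : OpenPartialHomeomorph (ℂ × ℂ) (ℂ × ℂ))
    (H : ℂ × ℂ → ℂ × ℂ) : Prop :=
  ∀ᶠ x in 𝓝 (0 : ℂ × ℂ), Z.symm x ∈ M → Z'.symm (H x) ∈ M'

/-! ### Jets -/

/-- The partial derivative `H_{z^i w^j}` of a map `H` at a point. -/
def partialDeriv (i j : ℕ) (H : ℂ × ℂ → ℂ × ℂ) (x : ℂ × ℂ) : ℂ × ℂ :=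
  iteratedDeriv i (fun z => iteratedDeriv j (fun w => H (z, w)) x.2) x.1

/-- The two components of a point of `ℂ²`. -/
def coord (i : Fin 2) (x : ℂ × ℂ) : ℂ := ![x.1, x.2] i

/-- The index set of the coordinates `Λ_i^α`, `1 ≤ |α| ≤ k`, on the jet space
`J^k_{0,0}(ℂ²)`. -/
abbrev JetIndex (k : ℕ) : Type :=
  Fin 2 × {α : ℕ × ℕ // 1 ≤ α.1 + α.2 ∧ α.1 + α.2 ≤ k}

/-- The space `J^k_{0,0}(ℂ²)` of `k`-jets at `0` of maps `(ℂ², 0) → (ℂ², 0)`, in coordinates. -/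
abbrev JetSpace (k : ℕ) : Type := JetIndex k → ℂ

/-- The jet `j^k_0 H`. -/
def jet (k : ℕ) (H : ℂ × ℂ → ℂ × ℂ) : JetSpace k :=
  fun a => coord a.1 (partialDeriv a.2.1.1 a.2.1.2 H 0)

/-- The space `J^1_{0,0}(ℂ²)` of `1`-jets, as the space of `2 × 2` matrices. -/
abbrev OneJet : Type := Fin 2 → Fin 2 → ℂ

/-- The Jacobian matrix `H'(0)`: for `H = (F, G)` it has rows `(F_z, F_w)` and `(G_z, G_w)`. -/
def jacobian (H : ℂ × ℂ → ℂ × ℂ) : OneJet :=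
  fun i => ![coord i (partialDeriv 1 0 H 0), coord i (partialDeriv 0 1 H 0)]

/-- The invertible upper triangular matrices `T(ℂ²)`; this set is stable under complex
conjugation. -/
def invUpperTriangular : Set OneJet :=
  {A | A 1 0 = 0 ∧ A 0 0 ≠ 0 ∧ A 1 1 ≠ 0}

/-! ### Polynomials in jets with holomorphic coefficients -/

/-- The points `(z, Λ₁, Λ̃₁)` on which the coefficients depend. -/
abbrev CoeffPoint : Type := ℂ × OneJet × OneJet

/-- Polynomials in `(Λ₂, Λ̃₂) ∈ J^m × J^m` whose coefficients are functions of
`(z, Λ₁, Λ̃₁)`. -/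
abbrev JetPolynomial (m : ℕ) : Type :=
  MvPolynomial (JetIndex m ⊕ JetIndex m) (CoeffPoint → ℂ)

/-- The value at `(z, Λ₁, Λ̃₁, Λ₂, Λ̃₂)`. -/
def JetPolynomial.value {m : ℕ} (P : JetPolynomial m) (x : CoeffPoint)
    (L L' : JetSpace m) : ℂ :=
  MvPolynomial.eval₂ (Pi.evalRingHom (fun _ : CoeffPoint => ℂ) x) (Sum.elim L L') P

/-- All coefficients of `P` are holomorphic in one neighbourhood of
`{0} × T(ℂ²) × conj T(ℂ²)`. -/
def JetPolynomial.HasHolomorphicCoeffs {m : ℕ} (P : JetPolynomial m) : Prop :=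
  ∃ U : Set CoeffPoint, IsOpen U ∧
    (∀ A ∈ invUpperTriangular, ∀ B ∈ invUpperTriangular, ((0 : ℂ), A, B) ∈ U) ∧
    ∀ d, DifferentiableOn ℂ (MvPolynomial.coeff d P) U

end

set_option linter.unusedSectionVars false

section RadialAverage

variable {E : Type*} [NormedAddCommGroup E] [NormedSpace ℂ E]

/-- The contraction `(e, w) ↦ (e, t w)`. -/
noncomputable def scaleSnd (t : ℝ) : E × ℂ →L[ℂ] E × ℂ :=
  (ContinuousLinearMap.fst ℂ E ℂ).prod ((t : ℂ) • ContinuousLinearMap.snd ℂ E ℂ)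

theorem scaleSnd_apply (t : ℝ) (x : E × ℂ) : scaleSnd t x = (x.1, (t : ℂ) * x.2) := rfl

theorem norm_scaleSnd_apply_le {t : ℝ} (h : |t| ≤ 1) (x : E × ℂ) : ‖scaleSnd t x‖ ≤ ‖x‖ := by
  rw [scaleSnd_apply, Prod.norm_def, Prod.norm_def]
  refine max_le_max le_rfl ?_
  rw [norm_mul, Complex.norm_real, Real.norm_eq_abs]
  exact mul_le_of_le_one_left (norm_nonneg _) h

theorem continuous_scaleSnd : Continuous (scaleSnd (E := E)) := by
  have h : scaleSnd (E := E) = fun t : ℝ =>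
      (ContinuousLinearMap.inl ℂ E ℂ).comp (ContinuousLinearMap.fst ℂ E ℂ) +
        (t : ℂ) • (ContinuousLinearMap.inr ℂ E ℂ).comp (ContinuousLinearMap.snd ℂ E ℂ) := by
    funext t
    ext x <;> simp [scaleSnd_apply]
  rw [h]
  fun_prop

/-- The power series of the radial average. -/
noncomputable def averageSeries (p : FormalMultilinearSeries ℂ (E × ℂ) ℂ) :
    FormalMultilinearSeries ℂ (E × ℂ) ℂ := fun n =>
  ∫ t in (0 : ℝ)..1, (p n).compContinuousLinearMap (fun _ => scaleSnd t)

theorem continuous_comp_scaleSnd (p : FormalMultilinearSeries ℂ (E × ℂ) ℂ) (n : ℕ) :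
    Continuous fun t : ℝ => (p n).compContinuousLinearMap (fun _ => scaleSnd t) := by
  have h := (ContinuousMultilinearMap.compContinuousLinearMapContinuousMultilinear ℂ
    (fun _ : Fin n => E × ℂ) (fun _ : Fin n => E × ℂ) ℂ).cont
  have h2 : Continuous fun t : ℝ => (fun _ : Fin n => scaleSnd (E := E) t) :=
    continuous_pi fun _ => continuous_scaleSnd
  have h3 := h.comp h2
  exact (ContinuousLinearMap.apply ℂ _ (p n)).continuous.comp h3

theorem norm_averageSeries_le (p : FormalMultilinearSeries ℂ (E × ℂ) ℂ) (n : ℕ) :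
    ‖averageSeries p n‖ ≤ ‖p n‖ := by
  have h := intervalIntegral.norm_integral_le_of_norm_le_const (a := 0) (b := 1) (C := ‖p n‖)
    (f := fun t : ℝ => (p n).compContinuousLinearMap (fun _ => scaleSnd t)) ?_
  · simpa [averageSeries] using h
  · intro t ht
    rw [Set.uIoc_of_le zero_le_one] at ht
    refine (ContinuousMultilinearMap.norm_compContinuousLinearMap_le _ _).trans ?_
    refine mul_le_of_le_one_right (norm_nonneg _) (Finset.prod_le_one (fun _ _ => norm_nonneg _) ?_)
    intro _ _
    refine ContinuousLinearMap.opNorm_le_bound _ zero_le_one fun x => ?_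
    rw [one_mul]
    exact norm_scaleSnd_apply_le (abs_le.2 ⟨by linarith [ht.1], ht.2⟩) x

theorem AnalyticAt.radialAverage {g : E × ℂ → ℂ} {e : E} (hg : AnalyticAt ℂ g (e, 0)) :
    AnalyticAt ℂ (fun x : E × ℂ => ∫ t in (0 : ℝ)..1, g (x.1, (t : ℂ) * x.2)) (e, 0) := by
  obtain ⟨p, r, hp⟩ := hg
  obtain ⟨s, hs0, hsr⟩ := ENNReal.lt_iff_exists_nnreal_btwn.1 hp.r_pos
  have hsp : (s : ENNReal) < p.radius := hsr.trans_le hp.r_le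
  refine ⟨averageSeries p, s, ⟨?_, hs0, ?_⟩⟩
  · obtain ⟨C, _, hC⟩ := p.norm_mul_pow_le_of_lt_radius hsp
    refine FormalMultilinearSeries.le_radius_of_bound _ C fun n => ?_
    exact (mul_le_mul_of_nonneg_right (norm_averageSeries_le p n) (by positivity)).trans (hC n)
  · intro y hy
    have hy' : ‖y‖ < s := by simpa [← ofReal_norm, edist_eq_enorm_sub] using hy
    have hterm : ∀ n, averageSeries p n (fun _ => y) =
        ∫ t in (0 : ℝ)..1, p n (fun _ => scaleSnd t y) := by
      intro n
      have h := ContinuousLinearMap.intervalIntegral_comp_comm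
        (ContinuousMultilinearMap.apply ℂ (fun _ : Fin n => E × ℂ) ℂ (fun _ => y))
        ((continuous_comp_scaleSnd p n).intervalIntegrable (μ := MeasureTheory.volume) 0 1)
      exact h.symm
    simp_rw [hterm]
    have hval : ∀ t : ℝ, g (((e, 0) + y : E × ℂ).1, (t : ℂ) * ((e, 0) + y : E × ℂ).2) =
        g ((e, 0) + scaleSnd t y) := by
      intro t; simp [scaleSnd_apply]
    simp_rw [hval]
    have hsum : Summable fun n => ‖p n‖ * ‖y‖ ^ n := by
      refine Summable.of_nonneg_of_le (fun n => by positivity) (fun n => ?_)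
        (p.summable_norm_mul_pow hsp)
      gcongr
    refine intervalIntegral.hasSum_integral_of_dominated_convergence
      (fun n _ => ‖p n‖ * ‖y‖ ^ n) ?_ ?_ ?_ ?_ ?_
    · intro n
      refine Continuous.aestronglyMeasurable ?_
      exact (p n).cont.comp (continuous_pi fun _ =>
        (continuous_scaleSnd (E := E)).clm_apply continuous_const)
    · intro n
      refine Eventually.of_forall fun t ht => ?_
      rw [Set.uIoc_of_le zero_le_one] at ht
      refine ((p n).le_opNorm _).trans ?_
      rw [Finset.prod_const, Finset.card_univ, Fintype.card_fin]
      gcongr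
      exact norm_scaleSnd_apply_le (abs_le.2 ⟨by linarith [ht.1], ht.2⟩) y
    · exact Eventually.of_forall fun _ _ => hsum
    · exact intervalIntegrable_const
    · refine Eventually.of_forall fun t ht => ?_
      rw [Set.uIoc_of_le zero_le_one] at ht
      refine hp.hasSum ?_
      refine Metric.eball_subset_eball hsr.le ?_
      have h2 := norm_scaleSnd_apply_le (abs_le.2 ⟨by linarith [ht.1], ht.2⟩) y
      have h3 := h2.trans_lt hy'
      simpa [← ofReal_norm, edist_eq_enorm_sub] using h3

end RadialAverage

section Osgood

open BoundedContinuousFunction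

/-- Integration of bounded continuous functions over the square `[0, 2π]²`. -/
noncomputable def torusIntegralCLM : ((ℝ × ℝ) →ᵇ ℂ) →L[ℂ] ℂ :=
  LinearMap.mkContinuous
    { toFun := fun u => ∫ s in (0 : ℝ)..2 * Real.pi, ∫ t in (0 : ℝ)..2 * Real.pi, u (s, t)
      map_add' := by
        intro u v
        have hi : ∀ (u : (ℝ × ℝ) →ᵇ ℂ) (s : ℝ), IntervalIntegrable (fun t => u (s, t))
            MeasureTheory.volume 0 (2 * Real.pi) := fun u s =>
          (u.continuous.comp (by fun_prop)).intervalIntegrable _ _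
        have ho : ∀ (u : (ℝ × ℝ) →ᵇ ℂ), IntervalIntegrable
            (fun s => ∫ t in (0 : ℝ)..2 * Real.pi, u (s, t))
            MeasureTheory.volume 0 (2 * Real.pi) := fun u =>
          (intervalIntegral.continuous_parametric_intervalIntegral_of_continuous'
            (f := fun s t => u (s, t)) (by exact u.continuous) _ _).intervalIntegrable _ _
        simp only [BoundedContinuousFunction.coe_add, Pi.add_apply]
        rw [← intervalIntegral.integral_add (ho u) (ho v)]
        refine intervalIntegral.integral_congr fun s _ => ?_
        exact intervalIntegral.integral_add (hi u s) (hi v s)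
      map_smul' := by
        intro c u
        simp [intervalIntegral.integral_const_mul] } ((2 * Real.pi) * (2 * Real.pi)) (by
    intro u
    have h2 : (0 : ℝ) ≤ 2 * Real.pi := by positivity
    have h1 : ∀ s : ℝ, ‖∫ t in (0 : ℝ)..2 * Real.pi, u (s, t)‖ ≤ ‖u‖ * (2 * Real.pi) := by
      intro s
      have := intervalIntegral.norm_integral_le_of_norm_le_const (a := 0) (b := 2 * Real.pi)
        (f := fun t => u (s, t)) (C := ‖u‖) (fun t _ => u.norm_coe_le_norm _)
      simpa [abs_of_nonneg h2, abs_of_nonneg Real.pi_pos.le] using this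
    have := intervalIntegral.norm_integral_le_of_norm_le_const (a := 0) (b := 2 * Real.pi)
      (f := fun s => ∫ t in (0 : ℝ)..2 * Real.pi, u (s, t)) (C := ‖u‖ * (2 * Real.pi))
      (fun s _ => h1 s)
    simp only [sub_zero, abs_of_nonneg h2] at this
    refine this.trans (le_of_eq ?_)
    ring)

theorem torusIntegralCLM_apply (u : (ℝ × ℝ) →ᵇ ℂ) : torusIntegralCLM u =
    ∫ s in (0 : ℝ)..2 * Real.pi, ∫ t in (0 : ℝ)..2 * Real.pi, u (s, t) := rfl

theorem ring_inverse_apply {X : Type*} [TopologicalSpace X] {u : X →ᵇ ℂ} (hu : IsUnit u) (x : X) :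
    (Ring.inverse u) x = (u x)⁻¹ := by
  have h := congrArg (fun v : X →ᵇ ℂ => v x) (Ring.inverse_mul_cancel u hu)
  exact eq_inv_of_mul_eq_one_left h

theorem analyticAt_of_differentiable_prod {f : ℂ × ℂ → ℂ} {a b : ℂ}
    (hf : ∀ᶠ x in 𝓝 (a, b), DifferentiableAt ℂ f x) : AnalyticAt ℂ f (a, b) := by
  obtain ⟨R', hR', hball⟩ := Metric.eventually_nhds_iff_ball.1 hf
  obtain ⟨R, hR, hRR'⟩ := exists_between hR'
  have hd : ∀ x ∈ Metric.closedBall a R, ∀ y ∈ Metric.closedBall b R,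
      DifferentiableAt ℂ f (x, y) := by
    intro x hx y hy
    refine hball _ ?_
    rw [Metric.mem_ball, Prod.dist_eq]
    exact max_lt (lt_of_le_of_lt hx hRR') (lt_of_le_of_lt hy hRR')
  -- bounded continuous functions of the two angles
  let mk (v : ℝ × ℝ → ℂ) (hv : Continuous v) (hb : ∃ C, ∀ x, ‖v x‖ ≤ C) : (ℝ × ℝ) →ᵇ ℂ :=
    BoundedContinuousFunction.ofNormedAddCommGroup v hv hb.choose hb.choose_spec
  have hcm : ∀ (c : ℂ) (t : ℝ), circleMap c R t ∈ Metric.closedBall c R := fun c t =>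
    circleMap_mem_closedBall c hR.le t
  have hbd : ∀ c : ℂ, ∃ C, ∀ t : ℝ, ‖circleMap c R t‖ ≤ C := fun c => by
    refine ⟨‖c‖ + R, fun t => ?_⟩
    have := hcm c t
    rw [Metric.mem_closedBall, dist_eq_norm] at this
    calc ‖circleMap c R t‖ = ‖c + (circleMap c R t - c)‖ := by ring_nf
      _ ≤ _ := (norm_add_le _ _).trans (by linarith)
  have hfc : ContinuousOn f (Metric.closedBall a R ×ˢ Metric.closedBall b R) := fun x hx =>
    (hd x.1 hx.1 x.2 hx.2).continuousAt.continuousWithinAt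
  obtain ⟨C0, hC0⟩ := ((isCompact_closedBall a R).prod (isCompact_closedBall b R)).exists_bound_of_continuousOn hfc
  let u1 : (ℝ × ℝ) →ᵇ ℂ := mk (fun x => circleMap a R x.1) (by fun_prop)
    (by obtain ⟨C, hC⟩ := hbd a; exact ⟨C, fun x => hC x.1⟩)
  let u2 : (ℝ × ℝ) →ᵇ ℂ := mk (fun x => circleMap b R x.2) (by fun_prop)
    (by obtain ⟨C, hC⟩ := hbd b; exact ⟨C, fun x => hC x.2⟩)
  let v1 : (ℝ × ℝ) →ᵇ ℂ := mk (fun x => circleMap 0 R x.1) (by fun_prop)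
    (by obtain ⟨C, hC⟩ := hbd 0; exact ⟨C, fun x => hC x.1⟩)
  let v2 : (ℝ × ℝ) →ᵇ ℂ := mk (fun x => circleMap 0 R x.2) (by fun_prop)
    (by obtain ⟨C, hC⟩ := hbd 0; exact ⟨C, fun x => hC x.2⟩)
  let w1 : (ℝ × ℝ) →ᵇ ℂ := mk (fun x => (circleMap 0 R x.1)⁻¹)
    ((by fun_prop : Continuous fun x : ℝ × ℝ => circleMap 0 R x.1).inv₀
      fun x => circleMap_ne_center hR.ne') ⟨R⁻¹, fun x => by simp [abs_of_pos hR]⟩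
  let w2 : (ℝ × ℝ) →ᵇ ℂ := mk (fun x => (circleMap 0 R x.2)⁻¹)
    ((by fun_prop : Continuous fun x : ℝ × ℝ => circleMap 0 R x.2).inv₀
      fun x => circleMap_ne_center hR.ne') ⟨R⁻¹, fun x => by simp [abs_of_pos hR]⟩
  let g : (ℝ × ℝ) →ᵇ ℂ := mk (fun x => f (circleMap a R x.1, circleMap b R x.2))
    (hfc.comp_continuous (by fun_prop) fun x => ⟨hcm _ _, hcm _ _⟩)
    ⟨C0, fun x => hC0 _ ⟨hcm _ _, hcm _ _⟩⟩
  have hun1 : IsUnit (u1 - algebraMap ℂ _ a) := by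
    refine IsUnit.of_mul_eq_one w1 ?_
    ext x
    have h0 : circleMap 0 R x.1 ≠ 0 := circleMap_ne_center hR.ne'
    have : circleMap a R x.1 - a = circleMap 0 R x.1 := by simp [circleMap]
    rw [BoundedContinuousFunction.mul_apply, BoundedContinuousFunction.sub_apply,
      BoundedContinuousFunction.algebraMap_apply, smul_eq_mul, mul_one]
    change (circleMap a R x.1 - a) * (circleMap 0 R x.1)⁻¹ = 1
    rw [this, mul_inv_cancel₀ h0]
  have hun2 : IsUnit (u2 - algebraMap ℂ _ b) := by
    refine IsUnit.of_mul_eq_one w2 ?_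
    ext x
    have h0 : circleMap 0 R x.2 ≠ 0 := circleMap_ne_center hR.ne'
    have : circleMap b R x.2 - b = circleMap 0 R x.2 := by simp [circleMap]
    rw [BoundedContinuousFunction.mul_apply, BoundedContinuousFunction.sub_apply,
      BoundedContinuousFunction.algebraMap_apply, smul_eq_mul, mul_one]
    change (circleMap b R x.2 - b) * (circleMap 0 R x.2)⁻¹ = 1
    rw [this, mul_inv_cancel₀ h0]
  have hI1 : AnalyticAt ℂ (fun x : ℂ × ℂ => Ring.inverse (u1 - algebraMap ℂ _ x.1)) (a, b) := by
    obtain ⟨U, hU⟩ := hun1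
    have h1 := analyticAt_inverse (𝕜 := ℂ) U
    rw [hU] at h1
    have h2 : AnalyticAt ℂ (fun x : ℂ × ℂ => u1 - algebraMap ℂ ((ℝ × ℝ) →ᵇ ℂ) x.1) (a, b) :=
      analyticAt_const.sub (((Algebra.linearMap ℂ ((ℝ × ℝ) →ᵇ ℂ)).toContinuousLinearMap.analyticAt
        _).comp analyticAt_fst)
    exact AnalyticAt.comp (f := fun x : ℂ × ℂ => u1 - algebraMap ℂ ((ℝ × ℝ) →ᵇ ℂ) x.1) h1 h2
  have hI2 : AnalyticAt ℂ (fun x : ℂ × ℂ => Ring.inverse (u2 - algebraMap ℂ _ x.2)) (a, b) := by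
    obtain ⟨U, hU⟩ := hun2
    have h1 := analyticAt_inverse (𝕜 := ℂ) U
    rw [hU] at h1
    have h2 : AnalyticAt ℂ (fun x : ℂ × ℂ => u2 - algebraMap ℂ ((ℝ × ℝ) →ᵇ ℂ) x.2) (a, b) :=
      analyticAt_const.sub (((Algebra.linearMap ℂ ((ℝ × ℝ) →ᵇ ℂ)).toContinuousLinearMap.analyticAt
        _).comp analyticAt_snd)
    exact AnalyticAt.comp (f := fun x : ℂ × ℂ => u2 - algebraMap ℂ ((ℝ × ℝ) →ᵇ ℂ) x.2) h1 h2
  have hU1 : ∀ᶠ x : ℂ × ℂ in 𝓝 (a, b), IsUnit (u1 - algebraMap ℂ _ x.1) := by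
    have hc : ContinuousAt (fun x : ℂ × ℂ => u1 - algebraMap ℂ ((ℝ × ℝ) →ᵇ ℂ) x.1) (a, b) := by
      exact (continuous_const.sub ((algebraMapCLM ℂ ((ℝ × ℝ) →ᵇ ℂ)).continuous.comp
        continuous_fst)).continuousAt
    exact hc (Units.isOpen.mem_nhds hun1)
  have hU2 : ∀ᶠ x : ℂ × ℂ in 𝓝 (a, b), IsUnit (u2 - algebraMap ℂ _ x.2) := by
    have hc : ContinuousAt (fun x : ℂ × ℂ => u2 - algebraMap ℂ ((ℝ × ℝ) →ᵇ ℂ) x.2) (a, b) := by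
      exact (continuous_const.sub ((algebraMapCLM ℂ ((ℝ × ℝ) →ᵇ ℂ)).continuous.comp
        continuous_snd)).continuousAt
    exact hc (Units.isOpen.mem_nhds hun2)
  have hmain : AnalyticAt ℂ (fun x : ℂ × ℂ => (2 * Real.pi : ℂ)⁻¹ * (2 * Real.pi : ℂ)⁻¹ *
      torusIntegralCLM (g * (v1 * Ring.inverse (u1 - algebraMap ℂ _ x.1)) *
        (v2 * Ring.inverse (u2 - algebraMap ℂ _ x.2)))) (a, b) := by
    have h3 : AnalyticAt ℂ (fun x : ℂ × ℂ => g * (v1 * Ring.inverse (u1 - algebraMap ℂ _ x.1)) *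
        (v2 * Ring.inverse (u2 - algebraMap ℂ _ x.2))) (a, b) :=
      (analyticAt_const.mul (analyticAt_const.mul hI1)).mul (analyticAt_const.mul hI2)
    exact analyticAt_const.mul ((torusIntegralCLM.analyticAt _).comp h3)
  refine hmain.congr ?_
  filter_upwards [hU1, hU2, (continuous_fst.tendsto (a, b)).eventually
    (Metric.ball_mem_nhds a hR), (continuous_snd.tendsto (a, b)).eventually
    (Metric.ball_mem_nhds b hR)] with x hx1 hx2 hxa hxb
  obtain ⟨z, w⟩ := x
  simp only at hx1 hx2 hxa hxb
  have hin : ∀ ξ ∈ Metric.closedBall a R, (∮ ζ in C(b, R), (ζ - w)⁻¹ • f (ξ, ζ)) =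
      (2 * Real.pi * Complex.I : ℂ) • f (ξ, w) := by
    intro ξ hξ
    refine DifferentiableOn.circleIntegral_sub_inv_smul (f := fun ζ => f (ξ, ζ)) ?_ hxb
    intro ζ hζ
    refine DifferentiableAt.differentiableWithinAt ?_
    exact (hd ξ hξ ζ hζ).comp ζ (by fun_prop : DifferentiableAt ℂ (fun ζ => (ξ, ζ)) ζ)
  have hout : (∮ ξ in C(a, R), (ξ - z)⁻¹ • f (ξ, w)) =
      (2 * Real.pi * Complex.I : ℂ) • f (z, w) := by
    refine DifferentiableOn.circleIntegral_sub_inv_smul (f := fun ξ => f (ξ, w)) ?_ hxa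
    intro ξ hξ
    refine DifferentiableAt.differentiableWithinAt ?_
    exact (hd ξ hξ w (Metric.ball_subset_closedBall hxb)).comp ξ
      (by fun_prop : DifferentiableAt ℂ (fun ξ => (ξ, w)) ξ)
  have hpi : (2 * Real.pi : ℂ) ≠ 0 := by
    have := Real.pi_ne_zero
    norm_cast
    positivity
  have hval : torusIntegralCLM (g * (v1 * Ring.inverse (u1 - algebraMap ℂ _ z)) *
        (v2 * Ring.inverse (u2 - algebraMap ℂ _ w))) = (2 * Real.pi : ℂ) * (2 * Real.pi : ℂ) * f (z, w) := by
    rw [torusIntegralCLM_apply]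
    have hpt : ∀ s t : ℝ, (g * (v1 * Ring.inverse (u1 - algebraMap ℂ _ z)) *
        (v2 * Ring.inverse (u2 - algebraMap ℂ _ w))) (s, t) =
        (circleMap 0 R s * (circleMap a R s - z)⁻¹) *
          (circleMap 0 R t * ((circleMap b R t - w)⁻¹ * f (circleMap a R s, circleMap b R t))) := by
      intro s t
      have e1 : (Ring.inverse (u1 - algebraMap ℂ ((ℝ × ℝ) →ᵇ ℂ) z)) (s, t) = (circleMap a R s - z)⁻¹ := by
        rw [ring_inverse_apply hx1, BoundedContinuousFunction.sub_apply,
          BoundedContinuousFunction.algebraMap_apply, smul_eq_mul, mul_one]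
        rfl
      have e2 : (Ring.inverse (u2 - algebraMap ℂ ((ℝ × ℝ) →ᵇ ℂ) w)) (s, t) = (circleMap b R t - w)⁻¹ := by
        rw [ring_inverse_apply hx2, BoundedContinuousFunction.sub_apply,
          BoundedContinuousFunction.algebraMap_apply, smul_eq_mul, mul_one]
        rfl
      simp only [BoundedContinuousFunction.coe_mul, Pi.mul_apply, e1, e2]
      change f (circleMap a R s, circleMap b R t) * (circleMap 0 R s * _) * (circleMap 0 R t * _) = _
      ring
    simp_rw [hpt, intervalIntegral.integral_const_mul]
    have hin' : ∀ s : ℝ, (∫ t in (0 : ℝ)..2 * Real.pi, circleMap 0 R t *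
        ((circleMap b R t - w)⁻¹ * f (circleMap a R s, circleMap b R t))) =
        (2 * Real.pi : ℂ) * f (circleMap a R s, w) := by
      intro s
      have := hin _ (hcm a s)
      simp only [circleIntegral, deriv_circleMap, smul_eq_mul] at this
      have h5 : (∫ t in (0 : ℝ)..2 * Real.pi, circleMap 0 R t * Complex.I *
        ((circleMap b R t - w)⁻¹ * f (circleMap a R s, circleMap b R t))) =
        Complex.I * ∫ t in (0 : ℝ)..2 * Real.pi, circleMap 0 R t *
        ((circleMap b R t - w)⁻¹ * f (circleMap a R s, circleMap b R t)) := by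
        rw [← intervalIntegral.integral_const_mul]
        congr 1; funext t; ring
      rw [h5] at this
      exact mul_left_cancel₀ Complex.I_ne_zero (this.trans (by ring))
    simp_rw [hin']
    simp only [circleIntegral, deriv_circleMap, smul_eq_mul] at hout
    refine mul_left_cancel₀ Complex.I_ne_zero ?_
    rw [← intervalIntegral.integral_const_mul]
    calc _ = (2 * Real.pi : ℂ) * ∫ s in (0 : ℝ)..2 * Real.pi, circleMap 0 R s * Complex.I *
        ((circleMap a R s - z)⁻¹ * f (circleMap a R s, w)) := by
          rw [← intervalIntegral.integral_const_mul]
          congr 1; funext s; ring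
      _ = _ := by rw [hout]; ring
  rw [hval]
  field_simp

end Osgood

section DividedDifferences

/-- The divided difference `(g w - g 0) / w`. -/
noncomputable def slopeZero (g : ℂ → ℂ) : ℂ → ℂ := dslope g 0

theorem eq_add_mul_slopeZero (g : ℂ → ℂ) (w : ℂ) : g w = g 0 + w * slopeZero g w := by
  have h := sub_smul_dslope g 0 w
  rw [sub_zero, smul_eq_mul] at h
  rw [slopeZero, h]
  ring

theorem analyticAt_slopeZero {g : ℂ → ℂ} (hg : AnalyticAt ℂ g 0) :
    AnalyticAt ℂ (slopeZero g) 0 := by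
  obtain ⟨p, hp⟩ := hg
  exact ⟨_, hp.has_fpower_series_dslope_fslope⟩

theorem slopeZero_congr {g h : ℂ → ℂ} (H : g =ᶠ[𝓝 0] h) : slopeZero g =ᶠ[𝓝 0] slopeZero h := by
  filter_upwards [H] with w hw
  unfold slopeZero
  by_cases h0 : w = 0
  · rw [h0, dslope_same, dslope_same, H.deriv_eq]
  · rw [dslope_of_ne _ h0, dslope_of_ne _ h0, slope_def_field, slope_def_field, hw, H.eq_of_nhds]

/-- The `j`-th Taylor coefficient at `0`. -/
noncomputable def ncoef (j : ℕ) (g : ℂ → ℂ) : ℂ := (slopeZero^[j] g) 0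

theorem ncoef_zero (g : ℂ → ℂ) : ncoef 0 g = g 0 := rfl

theorem ncoef_succ (j : ℕ) (g : ℂ → ℂ) : ncoef (j + 1) g = ncoef j (slopeZero g) := rfl

theorem eq_sum_ncoef (g : ℂ → ℂ) (N : ℕ) (w : ℂ) :
    g w = ∑ j ∈ Finset.range N, ncoef j g * w ^ j + w ^ N * (slopeZero^[N] g) w := by
  induction N with
  | zero => simp
  | succ N ih =>
    rw [Finset.sum_range_succ, Function.iterate_succ_apply']
    have h := eq_add_mul_slopeZero (slopeZero^[N] g) w
    have h2 : (slopeZero^[N] g) 0 = ncoef N g := rfl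
    rw [h2] at h
    linear_combination ih + w ^ N * h

theorem analyticAt_slopeZero_iterate {g : ℂ → ℂ} (hg : AnalyticAt ℂ g 0) (N : ℕ) :
    AnalyticAt ℂ (slopeZero^[N] g) 0 := by
  induction N with
  | zero => exact hg
  | succ N ih => rw [Function.iterate_succ_apply']; exact analyticAt_slopeZero ih

theorem slopeZero_iterate_congr {g h : ℂ → ℂ} (H : g =ᶠ[𝓝 0] h) (N : ℕ) :
    slopeZero^[N] g =ᶠ[𝓝 0] slopeZero^[N] h := by
  induction N with
  | zero => exact H
  | succ N ih => rw [Function.iterate_succ_apply', Function.iterate_succ_apply']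
                 exact slopeZero_congr ih

theorem ncoef_congr {g h : ℂ → ℂ} (H : g =ᶠ[𝓝 0] h) (j : ℕ) : ncoef j g = ncoef j h :=
  (slopeZero_iterate_congr H j).eq_of_nhds

theorem iteratedDeriv_eq_factorial_mul_ncoef {g : ℂ → ℂ} (hg : AnalyticAt ℂ g 0) (j : ℕ) :
    iteratedDeriv j g 0 = j.factorial * ncoef j g := by
  obtain ⟨p, r, hp⟩ := hg
  have h1 := (hp.hasFPowerSeriesAt.has_fpower_series_iterate_dslope_fslope j).coeff_zero 1
  have h2 : ncoef j g = p.coeff j := by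
    have h3 := p.coeff_iterate_fslope j 0
    rw [zero_add] at h3
    rw [← h3]
    exact h1.symm
  have h4 := hp.factorial_smul 1 j
  rw [iteratedDeriv, ← h4, h2]
  rw [nsmul_eq_mul]
  rfl

theorem eq_zero_of_sum_add_pow_mul_eq_zero {N : ℕ} {a : ℕ → ℂ} {r : ℂ → ℂ}
    (hr : ContinuousAt r 0)
    (h : ∀ᶠ w in 𝓝 0, ∑ j ∈ Finset.range N, a j * w ^ j + w ^ N * r w = 0) :
    ∀ j < N, a j = 0 := by
  induction N generalizing a with
  | zero => intro j hj; omega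
  | succ N ih =>
    have h0 : a 0 = 0 := by
      have := h.self_of_nhds
      rw [Finset.sum_range_succ'] at this
      simpa using this
    have hne : ∀ᶠ w in 𝓝[≠] (0 : ℂ),
        ∑ j ∈ Finset.range N, a (j + 1) * w ^ j + w ^ N * r w = 0 := by
      filter_upwards [h.filter_mono nhdsWithin_le_nhds, self_mem_nhdsWithin] with w hw hw0
      rw [Finset.sum_range_succ', h0] at hw
      refine mul_left_cancel₀ (show w ≠ 0 from hw0) ?_
      rw [mul_zero, mul_add, Finset.mul_sum, ← hw]
      have : ∀ j, w * (a (j + 1) * w ^ j) = a (j + 1) * w ^ (j + 1) := fun j => by ring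
      simp_rw [this]
      ring
    have hcont : ContinuousAt (fun w => ∑ j ∈ Finset.range N, a (j + 1) * w ^ j + w ^ N * r w) 0 := by
      refine ContinuousAt.add (by fun_prop) (ContinuousAt.mul (by fun_prop) hr)
    have hz : ∑ j ∈ Finset.range N, a (j + 1) * (0 : ℂ) ^ j + 0 ^ N * r 0 = 0 :=
      tendsto_nhds_unique_of_eventuallyEq (hcont.tendsto.mono_left nhdsWithin_le_nhds)
        tendsto_const_nhds hne
    have hall : ∀ᶠ w in 𝓝 (0 : ℂ),
        ∑ j ∈ Finset.range N, a (j + 1) * w ^ j + w ^ N * r w = 0 := by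
      rw [eventually_nhdsWithin_iff] at hne
      filter_upwards [hne] with w hw
      by_cases hw0 : w = 0
      · rw [hw0]; exact hz
      · exact hw hw0
    intro j hj
    cases j with
    | zero => exact h0
    | succ j => exact ih hall j (by omega)

theorem ncoef_eq_of_eventually {N : ℕ} {a : ℕ → ℂ} {g r : ℂ → ℂ} (hg : AnalyticAt ℂ g 0)
    (hr : ContinuousAt r 0)
    (h : ∀ᶠ w in 𝓝 0, g w = ∑ j ∈ Finset.range N, a j * w ^ j + w ^ N * r w) :
    ∀ j < N, ncoef j g = a j := by
  intro j hj
  refine sub_eq_zero.1 (eq_zero_of_sum_add_pow_mul_eq_zero (a := fun j => ncoef j g - a j)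
    (r := fun w => (slopeZero^[N] g) w - r w) ((analyticAt_slopeZero_iterate hg N).continuousAt.sub hr) ?_ j hj)
  filter_upwards [h] with w hw
  have h1 := eq_sum_ncoef g N w
  simp only [sub_mul, Finset.sum_sub_distrib]
  linear_combination hw - h1

theorem eventually_zero_of_ncoef {g : ℂ → ℂ} (hg : AnalyticAt ℂ g 0) (h : ∀ j, ncoef j g = 0) :
    ∀ᶠ w in 𝓝 0, g w = 0 := by
  rw [← analyticOrderAt_eq_top]
  refine ENat.eq_top_iff_forall_ge.2 fun n => ?_
  rw [natCast_le_analyticOrderAt_iff_iteratedDeriv_eq_zero hg]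
  intro i _
  rw [iteratedDeriv_eq_factorial_mul_ncoef hg, h, mul_zero]

end DividedDifferences

section Parametric

variable {E : Type*} [NormedAddCommGroup E] [NormedSpace ℂ E]

/-- The `N`-fold divided difference at `0` in the last variable. -/
noncomputable def dquot (N : ℕ) (f : E × ℂ → ℂ) : E × ℂ → ℂ :=
  fun x => (slopeZero^[N] (fun w => f (x.1, w))) x.2

theorem dquot_succ (N : ℕ) (f : E × ℂ → ℂ) : dquot (N + 1) f = dquot 1 (dquot N f) := by
  funext x
  simp only [dquot, Function.iterate_succ_apply', Function.iterate_zero_apply]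

theorem analyticAt_dquot_one {f : E × ℂ → ℂ} {e : E} (hf : AnalyticAt ℂ f (e, 0)) :
    AnalyticAt ℂ (dquot 1 f) (e, 0) := by
  have hg : AnalyticAt ℂ (fun x => fderiv ℂ f x ((0 : E), (1 : ℂ))) (e, 0) :=
    (ContinuousLinearMap.apply ℂ ℂ ((0 : E), (1 : ℂ))).analyticAt _ |>.comp hf.fderiv
  refine hg.radialAverage.congr ?_
  obtain ⟨R, hR, hball⟩ := Metric.eventually_nhds_iff_ball.1 (hf.eventually_analyticAt.and
    hg.eventually_analyticAt)
  filter_upwards [Metric.ball_mem_nhds _ hR] with x hx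
  obtain ⟨a, w⟩ := x
  have hxt : ∀ t : ℝ, t ∈ Set.Icc (0 : ℝ) 1 → (a, (t : ℂ) * w) ∈ Metric.ball (e, (0 : ℂ)) R := by
    intro t ht
    rw [Metric.mem_ball, Prod.dist_eq, max_lt_iff] at hx ⊢
    refine ⟨hx.1, ?_⟩
    have h2 := hx.2
    simp only [dist_zero_right, norm_mul, Complex.norm_real, Real.norm_eq_abs] at h2 ⊢
    rw [abs_of_nonneg ht.1]
    exact (mul_le_of_le_one_left (norm_nonneg _) ht.2).trans_lt h2
  have hline : ∀ u : ℂ, (a, u) ∈ Metric.ball (e, (0 : ℂ)) R →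
      HasDerivAt (fun u => f (a, u)) (fderiv ℂ f (a, u) (0, 1)) u := by
    intro u hu
    have h1 := (hball _ hu).1.differentiableAt.hasFDerivAt
    have h2 : HasDerivAt (fun u : ℂ => (a, u)) ((0 : E), (1 : ℂ)) u :=
      (hasDerivAt_const u a).prodMk (hasDerivAt_id u)
    exact h1.comp_hasDerivAt u h2
  simp only [dquot, Function.iterate_one, slopeZero]
  by_cases hw : w = 0
  · subst hw
    rw [dslope_same, (hline 0 hx).deriv]
    simp
  · rw [dslope_of_ne _ hw, slope_def_field, sub_zero, eq_div_iff hw,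
      ← intervalIntegral.integral_mul_const]
    have hd : ∀ t ∈ Set.uIcc (0 : ℝ) 1, HasDerivAt (fun t : ℝ => f (a, (t : ℂ) * w))
        (fderiv ℂ f (a, (t : ℂ) * w) (0, 1) * w) t := by
      intro t ht
      rw [Set.uIcc_of_le zero_le_one] at ht
      have h1 := hline _ (hxt t ht)
      have h2 : HasDerivAt (fun t : ℝ => (t : ℂ) * w) (1 * w) t :=
        (HasDerivAt.ofReal_comp (hasDerivAt_id t)).mul_const w
      rw [one_mul] at h2
      exact HasDerivAt.comp t h1 h2
    have hint : IntervalIntegrable (fun t : ℝ => fderiv ℂ f (a, (t : ℂ) * w) (0, 1) * w)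
        MeasureTheory.volume 0 1 := by
      refine ContinuousOn.intervalIntegrable fun t ht => ?_
      rw [Set.uIcc_of_le zero_le_one] at ht
      have h1 := (hball _ (hxt t ht)).2.continuousAt
      have h2 : ContinuousAt (fun t : ℝ => (a, (t : ℂ) * w)) t := by fun_prop
      exact ((ContinuousAt.comp (f := fun t : ℝ => (a, (t : ℂ) * w)) h1 h2).mul
        continuousAt_const).continuousWithinAt
    have := intervalIntegral.integral_eq_sub_of_hasDerivAt hd hint
    simpa using this

theorem analyticAt_dquot {f : E × ℂ → ℂ} {e : E} (hf : AnalyticAt ℂ f (e, 0)) (N : ℕ) :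
    AnalyticAt ℂ (dquot N f) (e, 0) := by
  induction N with
  | zero => exact hf
  | succ N ih => rw [dquot_succ]; exact analyticAt_dquot_one ih

/-- The `j`-th Taylor coefficient at `0` in the last variable. -/
noncomputable def tcoef (j : ℕ) (f : E × ℂ → ℂ) : E → ℂ := fun e => ncoef j (fun w => f (e, w))

theorem analyticAt_tcoef {f : E × ℂ → ℂ} {e : E} (hf : AnalyticAt ℂ f (e, 0)) (j : ℕ) :
    AnalyticAt ℂ (tcoef j f) e :=
  AnalyticAt.comp (f := fun e : E => (e, (0 : ℂ))) (analyticAt_dquot hf j) (by fun_prop)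

theorem eq_sum_tcoef (f : E × ℂ → ℂ) (N : ℕ) (e : E) (w : ℂ) :
    f (e, w) = ∑ j ∈ Finset.range N, tcoef j f e * w ^ j + w ^ N * dquot N f (e, w) :=
  eq_sum_ncoef (fun w => f (e, w)) N w

theorem eventually_curry_last {p : E × ℂ → Prop} {e : E} (h : ∀ᶠ x in 𝓝 (e, 0), p x) :
    ∀ᶠ e' in 𝓝 e, ∀ᶠ w in 𝓝 0, p (e', w) := by
  rw [nhds_prod_eq] at h
  exact h.curry

theorem eventually_analyticAt_slice {f : E × ℂ → ℂ} {e : E} (hf : AnalyticAt ℂ f (e, 0)) :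
    ∀ᶠ e' in 𝓝 e, AnalyticAt ℂ (fun w => f (e', w)) 0 := by
  have h1 : ContinuousAt (fun e' : E => (e', (0 : ℂ))) e := by fun_prop
  filter_upwards [h1.eventually (p := fun x => AnalyticAt ℂ f x) hf.eventually_analyticAt] with e' h
  exact AnalyticAt.comp (f := fun w : ℂ => (e', w)) h (by fun_prop)

theorem tcoef_eq_of_eventually {N : ℕ} {a : ℕ → E → ℂ} {f r : E × ℂ → ℂ} {e : E}
    (hf : AnalyticAt ℂ f (e, 0)) (hr : AnalyticAt ℂ r (e, 0))
    (h : ∀ᶠ x in 𝓝 (e, 0), f x = ∑ j ∈ Finset.range N, a j x.1 * x.2 ^ j + x.2 ^ N * r x) :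
    ∀ j < N, tcoef j f =ᶠ[𝓝 e] a j := by
  intro j hj
  filter_upwards [eventually_curry_last h, eventually_analyticAt_slice hf,
    eventually_analyticAt_slice hr] with e' he' hf' hr'
  exact ncoef_eq_of_eventually hf' hr'.continuousAt he' j hj

/-- An analytic function which is flat along every line through the origin vanishes. -/
theorem eventually_zero_of_pow_mul {f : E → ℂ} (hf : AnalyticAt ℂ f 0) {l : E →L[ℂ] ℂ}
    (h : ∀ N : ℕ, ∃ r : E → ℂ, ContinuousAt r 0 ∧ ∀ᶠ x in 𝓝 0, f x = l x ^ N * r x) :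
    ∀ᶠ x in 𝓝 0, f x = 0 := by
  obtain ⟨R, hR, hball⟩ := Metric.eventually_nhds_iff_ball.1 hf.eventually_analyticAt
  filter_upwards [Metric.ball_mem_nhds _ (half_pos hR)] with x hx
  have hmem : ∀ t ∈ Metric.ball (0 : ℂ) 2, t • x ∈ Metric.ball (0 : E) R := by
    intro t ht
    simp only [Metric.mem_ball, dist_zero_right] at hx ht ⊢
    rw [norm_smul]
    nlinarith [norm_nonneg x, norm_nonneg t]
  have hline : AnalyticOnNhd ℂ (fun t : ℂ => f (t • x)) (Metric.ball 0 2) := by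
    intro t ht
    exact AnalyticAt.comp (f := fun t : ℂ => t • x) (hball _ (hmem t ht)) (by fun_prop)
  have h0 := hline 0 (by simp)
  have hc : ContinuousAt (fun t : ℂ => t • x) 0 := by fun_prop
  have hzero : ∀ᶠ t in 𝓝 (0 : ℂ), f (t • x) = 0 := by
    refine eventually_zero_of_ncoef h0 fun j => ?_
    obtain ⟨r, hr, hfr⟩ := h (j + 1)
    have h0x : (0 : ℂ) • x = 0 := zero_smul _ _
    refine ncoef_eq_of_eventually (N := j + 1) (a := fun _ => 0)
      (r := fun t => l x ^ (j + 1) * r (t • x)) h0 ?_ ?_ j (by omega)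
    · refine continuousAt_const.mul ?_
      exact ContinuousAt.comp (f := fun t : ℂ => t • x) (by rw [h0x]; exact hr) hc
    · rw [← h0x] at hfr
      filter_upwards [hc.eventually hfr] with t ht
      rw [ht]
      simp [mul_pow]
      ring
  have := hline.eqOn_zero_of_preconnected_of_eventuallyEq_zero
    (convex_ball (0 : ℂ) 2).isPreconnected (z₀ := 0) (by simp) hzero
    (x := 1) (by simp)
  simpa using this

theorem exists_tcoef_ne_zero {f : E × ℂ → ℂ} (hf : AnalyticAt ℂ f 0)
    (h : ¬ ∀ᶠ x in 𝓝 0, f x = 0) : ∃ j, ¬ ∀ᶠ e in 𝓝 0, tcoef j f e = 0 := by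
  by_contra hcon
  push Not at hcon
  refine h (eventually_zero_of_pow_mul hf (l := ContinuousLinearMap.snd ℂ E ℂ) fun N => ?_)
  refine ⟨dquot N f, (analyticAt_dquot (e := (0 : E)) hf N).continuousAt, ?_⟩
  have hall : ∀ᶠ e in 𝓝 (0 : E), ∀ j ∈ Finset.range N, tcoef j f e = 0 :=
    (Finset.eventually_all _).2 fun j _ => hcon j
  filter_upwards [(continuous_fst.tendsto' (0 : E × ℂ) 0 rfl).eventually hall] with x hx
  have := eq_sum_tcoef f N x.1 x.2
  rw [Finset.sum_eq_zero fun j hj => by rw [hx j hj, zero_mul], zero_add] at this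
  exact this

end Parametric

section AnalyticFamilies

variable {ι : Type} {E E' E₁ E₂ : Type} [NormedAddCommGroup E] [NormedSpace ℂ E]
  [NormedAddCommGroup E'] [NormedSpace ℂ E'] [NormedAddCommGroup E₁] [NormedSpace ℂ E₁]
  [NormedAddCommGroup E₂] [NormedSpace ℂ E₂]

/-- Families of functions which are analytic at the origin. -/
noncomputable def AnFam (ι E : Type) [NormedAddCommGroup E] [NormedSpace ℂ E] : Subring (ι → E → ℂ) where
  carrier := {f | ∀ i, AnalyticAt ℂ (f i) 0}
  mul_mem' hf hg i := (hf i).mul (hg i)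
  one_mem' _ := analyticAt_const
  add_mem' hf hg i := (hf i).add (hg i)
  zero_mem' _ := analyticAt_const
  neg_mem' hf i := (hf i).neg

/-- Families of maps which are analytic at the origin and preserve it. -/
structure VanFam (ι E' E : Type) [NormedAddCommGroup E] [NormedSpace ℂ E] [NormedAddCommGroup E']
    [NormedSpace ℂ E'] where
  toFun : ι → E' → E
  analytic : ∀ i, AnalyticAt ℂ (toFun i) 0
  map_zero : ∀ i, toFun i 0 = 0

namespace VanFam

def pair (X : VanFam ι E' E₁) (Y : VanFam ι E' E₂) : VanFam ι E' (E₁ × E₂) where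
  toFun i x := (X.toFun i x, Y.toFun i x)
  analytic i := (X.analytic i).prod (Y.analytic i)
  map_zero i := Prod.ext (X.map_zero i) (Y.map_zero i)

def toFam (X : VanFam ι E' ℂ) : AnFam ι E' := ⟨X.toFun, X.analytic⟩

/-- The map `X + Y v`. -/
def shift (X : VanFam ι E' E) (v : E) (Y : VanFam ι E' ℂ) : VanFam ι E' E where
  toFun i x := X.toFun i x + Y.toFun i x • v
  analytic i := (X.analytic i).add ((Y.analytic i).smul analyticAt_const)
  map_zero i := by rw [X.map_zero, Y.map_zero, zero_smul, add_zero]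

def ofCLM (ι : Type) (L : E' →L[ℂ] E) : VanFam ι E' E where
  toFun _ := L
  analytic _ := L.analyticAt _
  map_zero _ := L.map_zero

theorem analyticAt_comp {F : Type} [NormedAddCommGroup F] [NormedSpace ℂ F] {f : E → F}
    (hf : AnalyticAt ℂ f 0) (Y : VanFam ι E' E) (i : ι) :
    AnalyticAt ℂ (fun x => f (Y.toFun i x)) 0 := by
  rw [← Y.map_zero i] at hf
  exact hf.comp (Y.analytic i)

def comp (X : VanFam ι E' E) (Y : VanFam ι E₁ E') : VanFam ι E₁ E where
  toFun i x := X.toFun i (Y.toFun i x)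
  analytic i := analyticAt_comp (X.analytic i) Y i
  map_zero i := by rw [Y.map_zero, X.map_zero]

end VanFam

namespace AnFam

def comp (X : VanFam ι E' E) : AnFam ι E →+* AnFam ι E' where
  toFun f := ⟨fun i x => f.1 i (X.toFun i x), fun i => VanFam.analyticAt_comp (f.2 i) X i⟩
  map_one' := rfl
  map_mul' _ _ := rfl
  map_zero' := rfl
  map_add' _ _ := rfl

/-- The family of Taylor coefficients in the last variable. -/
noncomputable def tc (j : ℕ) (f : AnFam ι (E × ℂ)) : AnFam ι E :=
  ⟨fun i => tcoef j (f.1 i), fun i => analyticAt_tcoef (f.2 i) j⟩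

noncomputable def dq (N : ℕ) (f : AnFam ι (E × ℂ)) : AnFam ι (E × ℂ) :=
  ⟨fun i => dquot N (f.1 i), fun i => analyticAt_dquot (e := (0 : E)) (f.2 i) N⟩

/-- The constant family. -/
def known (ι : Type) (d : E → ℂ) (hd : AnalyticAt ℂ d 0) : AnFam ι E := ⟨fun _ => d, fun _ => hd⟩

theorem comp_expand (f : AnFam ι (E × ℂ)) (X : VanFam ι E' E) (Y : VanFam ι E' ℂ) (N : ℕ) :
    comp (X.pair Y) f = ∑ j ∈ Finset.range N, comp X (tc j f) * Y.toFam ^ j +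
      Y.toFam ^ N * comp (X.pair Y) (dq N f) := by
  refine Subtype.ext ?_
  funext i x
  have h := eq_sum_tcoef (f.1 i) N (X.toFun i x) (Y.toFun i x)
  simp only [Subring.coe_add, Subring.coe_mul, AddSubmonoidClass.coe_finsetSum, Pi.add_apply,
    Finset.sum_apply, Pi.mul_apply, SubmonoidClass.coe_pow, Pi.pow_apply]
  exact h

/-- `(e, η) ↦ f (e + η v)`. -/
noncomputable def dir (v : E) (f : AnFam ι E) : AnFam ι (E × ℂ) :=
  comp (VanFam.ofCLM ι (ContinuousLinearMap.fst ℂ E ℂ + (ContinuousLinearMap.snd ℂ E ℂ).smulRight v)) f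

theorem comp_shift (f : AnFam ι E) (X : VanFam ι E' E) (v : E) (Y : VanFam ι E' ℂ) :
    comp (X.shift v Y) f = comp (X.pair Y) (dir v f) := rfl

theorem tc_zero_dir (v : E) (f : AnFam ι E) : tc 0 (dir v f) = f := by
  refine Subtype.ext ?_
  funext i x
  change f.1 i (x + (0 : ℂ) • v) = f.1 i x
  rw [zero_smul, add_zero]

theorem exists_comp_shift_eq (f : AnFam ι E) (X : VanFam ι E' E) (v : E) (Y : VanFam ι E' ℂ) :
    ∃ h, comp (X.shift v Y) f = comp X f + Y.toFam * h := by
  refine ⟨comp (X.pair Y) (dq 1 (dir v f)), ?_⟩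
  rw [comp_shift, comp_expand _ _ _ 1, Finset.sum_range_one, tc_zero_dir]
  simp

theorem exists_comp_shift_eq_two (f : AnFam ι E) (X : VanFam ι E' E) (v : E)
    (Y : VanFam ι E' ℂ) :
    ∃ h, comp (X.shift v Y) f =
      comp X f + Y.toFam * comp X (tc 1 (dir v f)) + Y.toFam ^ 2 * h := by
  refine ⟨comp (X.pair Y) (dq 2 (dir v f)), ?_⟩
  rw [comp_shift, comp_expand _ _ _ 2, Finset.sum_range_succ, Finset.sum_range_one, tc_zero_dir]
  ring

end AnFam

end AnalyticFamilies

section TruncatedForm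

variable {C R : Type*} [CommRing C] [CommRing R]

theorem exists_truncated_form_mul (S : Subring C) (c : C →+* R) {x y : R} {A B : ℕ}
    (hx : x ^ A = 0) {g : ℕ → ℕ → C} (hg : ∀ a b, g a b ∈ S) :
    ∃ g' : ℕ → ℕ → C, (∀ a b, g' a b ∈ S) ∧
      (∑ a ∈ Finset.range A, ∑ b ∈ Finset.range B, c (g a b) * x ^ a * y ^ b) * x =
        ∑ a ∈ Finset.range A, ∑ b ∈ Finset.range B, c (g' a b) * x ^ a * y ^ b := by
  refine ⟨fun a b => if a = 0 then 0 else g (a - 1) b, fun a b => ?_, ?_⟩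
  · dsimp only
    split_ifs
    · exact S.zero_mem
    · exact hg _ _
  · rcases A with _ | A
    · simp
    · rw [Finset.sum_range_succ, Finset.sum_range_succ', add_mul]
      have e1 : (∑ b ∈ Finset.range B, c (g A b) * x ^ A * y ^ b) * x = 0 := by
        rw [Finset.sum_mul]
        refine Finset.sum_eq_zero fun b _ => ?_
        rw [pow_succ] at hx
        linear_combination (c (g A b) * y ^ b) * hx
      rw [e1, add_zero, Finset.sum_mul]
      simp only [Nat.add_eq_zero_iff, one_ne_zero, and_false, if_false, if_true, map_zero,
        zero_mul, Finset.sum_const_zero, add_zero, Nat.add_sub_cancel]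
      refine Finset.sum_congr rfl fun a _ => ?_
      rw [Finset.sum_mul]
      refine Finset.sum_congr rfl fun b _ => ?_
      ring

theorem exists_truncated_form (S : Subring C) (c : C →+* R) {x y : R} {A B : ℕ}
    (hx : x ^ A = 0) (hy : y ^ B = 0) (P : MvPolynomial (Fin 2) S) :
    ∃ g : ℕ → ℕ → C, (∀ a b, g a b ∈ S) ∧
      MvPolynomial.eval₂Hom (c.comp S.subtype) ![x, y] P =
        ∑ a ∈ Finset.range A, ∑ b ∈ Finset.range B, c (g a b) * x ^ a * y ^ b := by
  induction P using MvPolynomial.induction_on with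
  | C s =>
    refine ⟨fun a b => if a = 0 ∧ b = 0 then s else 0, fun a b => ?_, ?_⟩
    · dsimp only
      split_ifs
      · exact s.2
      · exact S.zero_mem
    · rcases Nat.eq_zero_or_pos A with hA | hA
      · subst hA
        rw [pow_zero] at hx
        exact eq_of_zero_eq_one hx.symm _ _
      rcases Nat.eq_zero_or_pos B with hB | hB
      · subst hB
        rw [pow_zero] at hy
        exact eq_of_zero_eq_one hy.symm _ _
      rw [Finset.sum_eq_single_of_mem 0 (Finset.mem_range.2 hA),
        Finset.sum_eq_single_of_mem 0 (Finset.mem_range.2 hB)]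
      · simp
      · intro b _ hb; simp [hb]
      · intro a _ ha; simp [ha]
  | add P Q hP hQ =>
    obtain ⟨g, hg, h1⟩ := hP
    obtain ⟨g', hg', h2⟩ := hQ
    refine ⟨fun a b => g a b + g' a b, fun a b => S.add_mem (hg a b) (hg' a b), ?_⟩
    rw [map_add, h1, h2]
    simp only [map_add, add_mul, Finset.sum_add_distrib]
  | mul_X P n hP =>
    obtain ⟨g, hg, h1⟩ := hP
    rw [map_mul, h1]
    fin_cases n
    · obtain ⟨g', hg', h2⟩ := exists_truncated_form_mul S c (y := y) (B := B) hx hg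
      exact ⟨g', hg', by rw [← h2]; simp⟩
    · obtain ⟨g', hg', h2⟩ := exists_truncated_form_mul S c (y := x) (B := A) hy
        (g := fun b a => g a b) (fun b a => hg a b)
      refine ⟨fun a b => g' b a, fun a b => hg' b a, ?_⟩
      rw [Finset.sum_comm] at h2
      rw [Finset.sum_comm (s := Finset.range A)]
      simp only [Fin.mk_one, Fin.isValue, MvPolynomial.coe_eval₂Hom, MvPolynomial.eval₂_X,
        Matrix.cons_val_one, Matrix.cons_val_zero]
      simp only [mul_right_comm _ (y ^ _) (x ^ _)] at h2
      rw [Finset.sum_comm (s := Finset.range B)]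
      rw [h2, Finset.sum_comm]
      

end TruncatedForm

section TruncatedRing

/-- Points `((z, χ), w)`. -/
abbrev Triple : Type := (ℂ × ℂ) × ℂ

variable {ι : Type}

noncomputable def coordZ (ι : Type) : VanFam ι Triple ℂ :=
  VanFam.ofCLM ι ((ContinuousLinearMap.fst ℂ ℂ ℂ).comp (ContinuousLinearMap.fst ℂ (ℂ × ℂ) ℂ))

noncomputable def coordX (ι : Type) : VanFam ι Triple ℂ :=
  VanFam.ofCLM ι ((ContinuousLinearMap.snd ℂ ℂ ℂ).comp (ContinuousLinearMap.fst ℂ (ℂ × ℂ) ℂ))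

noncomputable def coordW (ι : Type) : VanFam ι Triple ℂ :=
  VanFam.ofCLM ι (ContinuousLinearMap.snd ℂ (ℂ × ℂ) ℂ)

/-- The ideal generated by `χ ^ A` and `w ^ B` in the ring of germs. -/
noncomputable def truncIdeal (ι : Type) (A B : ℕ) : Ideal (AnFam ι Triple) where
  carrier := {f | ∀ i, ∃ r s : Triple → ℂ, AnalyticAt ℂ r 0 ∧ AnalyticAt ℂ s 0 ∧
    ∀ᶠ x in 𝓝 0, f.1 i x = x.1.2 ^ A * r x + x.2 ^ B * s x}
  add_mem' := by
    intro f g hf hg i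
    obtain ⟨r, s, hr, hs, h⟩ := hf i
    obtain ⟨r', s', hr', hs', h'⟩ := hg i
    refine ⟨r + r', s + s', hr.add hr', hs.add hs', ?_⟩
    filter_upwards [h, h'] with x hx hx'
    simp only [Subring.coe_add, Pi.add_apply, hx, hx']
    ring
  zero_mem' := fun i => ⟨0, 0, analyticAt_const, analyticAt_const, Eventually.of_forall fun x => by
    simp⟩
  smul_mem' := by
    intro c f hf i
    obtain ⟨r, s, hr, hs, h⟩ := hf i
    refine ⟨c.1 i * r, c.1 i * s, (c.2 i).mul hr, (c.2 i).mul hs, ?_⟩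
    filter_upwards [h] with x hx
    simp only [smul_eq_mul, Subring.coe_mul, Pi.mul_apply, hx]
    ring

def TruncRing (ι : Type) (A B : ℕ) : Type := AnFam ι Triple ⧸ truncIdeal ι A B

noncomputable instance (ι : Type) (A B : ℕ) : CommRing (TruncRing ι A B) :=
  inferInstanceAs (CommRing (AnFam ι Triple ⧸ truncIdeal ι A B))

variable {A B : ℕ}

noncomputable def proj (A B : ℕ) : AnFam ι Triple →+* TruncRing ι A B := Ideal.Quotient.mk _

theorem proj_congr {f g : AnFam ι Triple} (h : ∀ i, ∀ᶠ x in 𝓝 0, f.1 i x = g.1 i x) :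
    proj A B f = proj A B g := by
  refine Ideal.Quotient.eq.2 fun i => ⟨0, 0, analyticAt_const, analyticAt_const, ?_⟩
  filter_upwards [h i] with x hx
  have : (f - g).1 i x = f.1 i x - g.1 i x := rfl
  rw [this, hx]
  simp

noncomputable def clX (ι : Type) (A B : ℕ) : TruncRing ι A B := proj A B (coordX ι).toFam

noncomputable def clW (ι : Type) (A B : ℕ) : TruncRing ι A B := proj A B (coordW ι).toFam

/-- The class of a family of functions of `z`. -/
noncomputable def clZ (A B : ℕ) : AnFam ι ℂ →+* TruncRing ι A B := (proj A B).comp (AnFam.comp (coordZ ι))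

theorem clX_pow : clX ι A B ^ A = 0 := by
  rw [clX, ← map_pow]
  refine Ideal.Quotient.eq_zero_iff_mem.2 fun i => ⟨1, 0, analyticAt_const, analyticAt_const, ?_⟩
  refine Eventually.of_forall fun x => ?_
  simp only [Pi.one_apply, mul_one, Pi.zero_apply, mul_zero, add_zero]
  rfl

theorem clW_pow : clW ι A B ^ B = 0 := by
  rw [clW, ← map_pow]
  refine Ideal.Quotient.eq_zero_iff_mem.2 fun i => ⟨0, 1, analyticAt_const, analyticAt_const, ?_⟩
  refine Eventually.of_forall fun x => ?_
  simp only [Pi.one_apply, mul_one, Pi.zero_apply, mul_zero, zero_add]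
  rfl

theorem eventually_zero_of_sum_eq_zero {g : ℕ → ℕ → AnFam ι ℂ}
    (h : ∑ a ∈ Finset.range A, ∑ b ∈ Finset.range B,
      clZ A B (g a b) * clX ι A B ^ a * clW ι A B ^ b = 0) {a b : ℕ} (ha : a < A) (hb : b < B)
    (i : ι) : ∀ᶠ z in 𝓝 0, (g a b).1 i z = 0 := by
  have h1 : proj A B (∑ a ∈ Finset.range A, ∑ b ∈ Finset.range B,
      AnFam.comp (coordZ ι) (g a b) * (coordX ι).toFam ^ a * (coordW ι).toFam ^ b) = 0 := by
    simp only [map_sum, map_mul, map_pow]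
    exact h
  obtain ⟨r, s, hr, hs, he⟩ := Ideal.Quotient.eq_zero_iff_mem.1 h1 i
  have he' : ∀ᶠ x : Triple in 𝓝 0, ∑ b ∈ Finset.range B,
      (∑ a ∈ Finset.range A, (g a b).1 i x.1.1 * x.1.2 ^ a) * x.2 ^ b =
        x.1.2 ^ A * r x + x.2 ^ B * s x := by
    filter_upwards [he] with x hx
    rw [← hx]
    simp only [Subring.coe_mul, AddSubmonoidClass.coe_finsetSum,
      Finset.sum_apply, Pi.mul_apply, SubmonoidClass.coe_pow, Pi.pow_apply]
    rw [Finset.sum_comm]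
    refine Finset.sum_congr rfl fun a _ => ?_
    rw [Finset.sum_mul]
    rfl
  have hgan : ∀ (b : ℕ), AnalyticAt ℂ
      (fun e : ℂ × ℂ => ∑ a ∈ Finset.range A, (g a b).1 i e.1 * e.2 ^ a) 0 := by
    intro b
    refine Finset.analyticAt_fun_sum _ fun a _ => ?_
    refine AnalyticAt.mul ?_ (analyticAt_snd.pow a)
    exact VanFam.analyticAt_comp ((g a b).2 i) (VanFam.ofCLM ι (ContinuousLinearMap.fst ℂ ℂ ℂ)) i
  have hfan : AnalyticAt ℂ (fun x : Triple => ∑ b ∈ Finset.range B,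
      (∑ a ∈ Finset.range A, (g a b).1 i x.1.1 * x.1.2 ^ a) * x.2 ^ b) ((0 : ℂ × ℂ), (0 : ℂ)) := by
    refine Finset.analyticAt_fun_sum _ fun b _ => ?_
    refine AnalyticAt.mul ?_ (analyticAt_snd.pow b)
    exact VanFam.analyticAt_comp (hgan b) (VanFam.ofCLM ι (ContinuousLinearMap.fst ℂ (ℂ × ℂ) ℂ)) i
  have t1 := tcoef_eq_of_eventually (N := B) (r := 0)
    (a := fun b e => ∑ a ∈ Finset.range A, (g a b).1 i e.1 * e.2 ^ a) hfan analyticAt_const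
    (Eventually.of_forall fun x => by simp) b hb
  have t2 := tcoef_eq_of_eventually (N := B)
    (r := fun x => x.1.2 ^ A * dquot B r x + s x)
    (a := fun b e => e.2 ^ A * tcoef b r e) hfan
    ((((VanFam.analyticAt_comp (analyticAt_id) (coordX ι) i).pow A).mul
      (analyticAt_dquot (e := (0 : ℂ × ℂ)) hr B)).add hs) (by
    filter_upwards [he'] with x hx
    rw [hx]
    have h3 := eq_sum_tcoef r B x.1 x.2
    simp only [mul_assoc, ← Finset.mul_sum]
    linear_combination x.1.2 ^ A * h3) b hb
  have t3 : (fun e : ℂ × ℂ => ∑ a ∈ Finset.range A, (g a b).1 i e.1 * e.2 ^ a) =ᶠ[𝓝 0]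
      fun e => e.2 ^ A * tcoef b r e := t1.symm.trans t2
  have s1 := tcoef_eq_of_eventually (N := A) (e := (0 : ℂ)) (r := 0)
    (a := fun a z => (g a b).1 i z) (hgan b) analyticAt_const
    (Eventually.of_forall fun x => by simp) a ha
  have s2 := tcoef_eq_of_eventually (N := A) (e := (0 : ℂ)) (r := tcoef b r)
    (a := fun _ _ => 0) (hgan b) (analyticAt_tcoef (e := (0 : ℂ × ℂ)) hr b) (by
      filter_upwards [t3] with x hx
      rw [hx]
      simp) a ha
  exact s1.symm.trans s2

/-- Polynomials in `χ` and `w` with coefficients in `S`. -/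
noncomputable def adm (S : Subring (AnFam ι ℂ)) (A B : ℕ) : Subring (TruncRing ι A B) :=
  (MvPolynomial.eval₂Hom ((clZ A B).comp S.subtype) ![clX ι A B, clW ι A B]).range

variable {S : Subring (AnFam ι ℂ)}

theorem clZ_mem_adm {f : AnFam ι ℂ} (hf : f ∈ S) : clZ A B f ∈ adm S A B :=
  ⟨MvPolynomial.C ⟨f, hf⟩, by simp⟩

theorem clX_mem_adm : clX ι A B ∈ adm S A B := ⟨MvPolynomial.X 0, by simp⟩

theorem clW_mem_adm : clW ι A B ∈ adm S A B := ⟨MvPolynomial.X 1, by simp⟩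

theorem exists_normal_form {r : TruncRing ι A B} (hr : r ∈ adm S A B) :
    ∃ g : ℕ → ℕ → AnFam ι ℂ, (∀ a b, g a b ∈ S) ∧
      r = ∑ a ∈ Finset.range A, ∑ b ∈ Finset.range B,
        clZ A B (g a b) * clX ι A B ^ a * clW ι A B ^ b := by
  obtain ⟨P, rfl⟩ := hr
  exact exists_truncated_form S (clZ A B) clX_pow clW_pow P

/-- Membership in `S` does not depend on the representative of the germs. -/
def GermClosed (S : Subring (AnFam ι ℂ)) : Prop :=
  ∀ ⦃f g : AnFam ι ℂ⦄, f ∈ S → (∀ i, ∀ᶠ z in 𝓝 0, f.1 i z = g.1 i z) → g ∈ S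

theorem coeff_mem_of_eq (hS : GermClosed S) {r : TruncRing ι A B} (hr : r ∈ adm S A B)
    {c : ℕ → AnFam ι ℂ} {f : AnFam ι ℂ} {a₀ b₀ : ℕ} (ha : a₀ < A) (hb : b₀ < B) (ha0 : a₀ ≠ 0)
    (h : ∑ b ∈ Finset.range B, clZ A B (c b) * clW ι A B ^ b =
      r + clX ι A B ^ a₀ * clW ι A B ^ b₀ * clZ A B f) : f ∈ S := by
  obtain ⟨g, hg, rfl⟩ := exists_normal_form hr
  have key : ∑ a ∈ Finset.range A, ∑ b ∈ Finset.range B,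
      clZ A B (g a b + (if a = a₀ ∧ b = b₀ then f else 0) - (if a = 0 then c b else 0)) *
        clX ι A B ^ a * clW ι A B ^ b = 0 := by
    simp only [map_add, map_sub, add_mul, sub_mul, Finset.sum_add_distrib, Finset.sum_sub_distrib]
    rw [Finset.sum_eq_single_of_mem (f := fun a => ∑ b ∈ Finset.range B,
      clZ A B (if a = a₀ ∧ b = b₀ then f else 0) * clX ι A B ^ a * clW ι A B ^ b) a₀
        (Finset.mem_range.2 ha), Finset.sum_eq_single_of_mem b₀ (Finset.mem_range.2 hb),
      Finset.sum_eq_single_of_mem (f := fun a => ∑ b ∈ Finset.range B,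
      clZ A B (if a = 0 then c b else 0) * clX ι A B ^ a * clW ι A B ^ b) 0
        (Finset.mem_range.2 (by omega))]
    · simp only [and_self, if_true, pow_zero, mul_one]
      linear_combination -h
    · intro a _ ha'; simp [ha']
    · intro b _ hb'; simp [hb']
    · intro a _ ha'; simp [ha']
  refine hS (S.neg_mem (hg a₀ b₀)) fun i => ?_
  filter_upwards [eventually_zero_of_sum_eq_zero key ha hb i] with z hz
  have hz' : (g a₀ b₀).1 i z + f.1 i z = 0 := by
    simpa [ha0] using hz
  have : (-(g a₀ b₀)).1 i z = -((g a₀ b₀).1 i z) := rfl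
  rw [this]
  linear_combination -hz'

theorem adm_comp_pair {E : Type} [NormedAddCommGroup E] [NormedSpace ℂ E] {f : AnFam ι (E × ℂ)}
    {X : VanFam ι Triple E} {Y : VanFam ι Triple ℂ} {N : ℕ} (hN : proj A B Y.toFam ^ N = 0)
    (hY : proj A B Y.toFam ∈ adm S A B)
    (hX : ∀ j < N, proj A B (AnFam.comp X (AnFam.tc j f)) ∈ adm S A B) :
    proj A B (AnFam.comp (X.pair Y) f) ∈ adm S A B := by
  rw [AnFam.comp_expand f X Y N, map_add, map_mul, map_pow, hN, zero_mul, add_zero, map_sum]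
  refine Subring.sum_mem _ fun j hj => ?_
  rw [map_mul, map_pow]
  exact Subring.mul_mem _ (hX j (Finset.mem_range.1 hj)) (Subring.pow_mem _ hY _)

theorem proj_comp_coordZ (f : AnFam ι ℂ) : proj A B (AnFam.comp (coordZ ι) f) = clZ A B f := rfl

theorem proj_mem_adm_of_tc {f : AnFam ι Triple}
    (h : ∀ a < A, ∀ b < B, AnFam.tc a (AnFam.tc b f) ∈ S) : proj A B f ∈ adm S A B := by
  refine adm_comp_pair (X := (coordZ ι).pair (coordX ι)) (Y := coordW ι) (f := f) clW_pow
    clW_mem_adm fun b hb => ?_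
  exact adm_comp_pair (X := coordZ ι) (Y := coordX ι) clX_pow clX_mem_adm fun a ha =>
    clZ_mem_adm (h a ha b hb)

/-- The restriction of a family to `χ = w = 0`. -/
noncomputable def restrictZ (f : AnFam ι Triple) : AnFam ι ℂ := AnFam.tc 0 (AnFam.tc 0 f)

theorem restrictZ_apply (f : AnFam ι Triple) (i : ι) (z : ℂ) :
    (restrictZ f).1 i z = f.1 i ((z, 0), 0) := rfl

theorem exists_proj_eq_restrictZ (f : AnFam ι Triple) :
    ∃ r s : AnFam ι Triple, proj A B f = clZ A B (restrictZ f) + clX ι A B * proj A B r + clW ι A B * proj A B s := by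
  have h1 := AnFam.comp_expand f ((coordZ ι).pair (coordX ι)) (coordW ι) 1
  have h2 := AnFam.comp_expand (AnFam.tc 0 f) (coordZ ι) (coordX ι) 1
  have h0 : AnFam.comp (((coordZ ι).pair (coordX ι)).pair (coordW ι)) f = f := rfl
  rw [h0, Finset.sum_range_one, pow_zero, mul_one, pow_one] at h1
  rw [Finset.sum_range_one, pow_zero, mul_one, pow_one] at h2
  rw [h2] at h1
  refine ⟨AnFam.comp ((coordZ ι).pair (coordX ι)) (AnFam.dq 1 (AnFam.tc 0 f)),
    AnFam.comp (((coordZ ι).pair (coordX ι)).pair (coordW ι)) (AnFam.dq 1 f),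
    (congrArg (proj A B) h1).trans ?_⟩
  rw [map_add, map_add, map_mul, map_mul]
  rfl

end TruncatedRing

section Conjugation

variable {E E' : Type*} [NormedAddCommGroup E] [NormedSpace ℂ E] [NormedAddCommGroup E']
  [NormedSpace ℂ E']

/-- The conjugate `v ↦ conj (p (c v))` of a multilinear form by an antilinear contraction. -/
noncomputable def conjMultilinear {n : ℕ} (p : ContinuousMultilinearMap ℂ (fun _ : Fin n => E) ℂ)
    (c : E' → E) (hadd : ∀ x y, c (x + y) = c x + c y)
    (hsmul : ∀ (a : ℂ) x, c (a • x) = conj a • c x) (hnorm : ∀ x, ‖c x‖ ≤ ‖x‖) :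
    ContinuousMultilinearMap ℂ (fun _ : Fin n => E') ℂ :=
  MultilinearMap.mkContinuous
    { toFun := fun v => conj (p fun j => c (v j))
      map_update_add' := by
        intro _ v j x y
        have h : ∀ x, (fun k => c (Function.update v j x k)) =
            Function.update (fun k => c (v k)) j (c x) := fun x => by
          funext k
          exact Function.apply_update (fun _ => c) v j x k
        rw [h, h, h, hadd, p.map_update_add, map_add]
      map_update_smul' := by
        intro _ v j a x
        have h : ∀ x, (fun k => c (Function.update v j x k)) =
            Function.update (fun k => c (v k)) j (c x) := fun x => by
          funext k
          exact Function.apply_update (fun _ => c) v j x k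
        rw [h, h, hsmul, p.map_update_smul, smul_eq_mul, smul_eq_mul, map_mul,
          Complex.conj_conj] } ‖p‖ (by
    intro v
    change ‖conj (p fun j => c (v j))‖ ≤ _
    rw [RCLike.norm_conj]
    refine (p.le_opNorm _).trans ?_
    gcongr
    exact hnorm _)

theorem analyticAt_conj_comp {f : E → ℂ} {c : E' → E} {x : E'} (hf : AnalyticAt ℂ f (c x))
    (hadd : ∀ x y, c (x + y) = c x + c y)
    (hsmul : ∀ (a : ℂ) x, c (a • x) = conj a • c x) (hnorm : ∀ x, ‖c x‖ ≤ ‖x‖) :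
    AnalyticAt ℂ (fun y => conj (f (c y))) x := by
  obtain ⟨p, r, hp⟩ := hf
  obtain ⟨s, hs0, hsr⟩ := ENNReal.lt_iff_exists_nnreal_btwn.1 hp.r_pos
  have hsp : (s : ENNReal) < p.radius := hsr.trans_le hp.r_le
  refine ⟨fun n => conjMultilinear (p n) c hadd hsmul hnorm, s, ⟨?_, hs0, ?_⟩⟩
  · obtain ⟨C, _, hC⟩ := p.norm_mul_pow_le_of_lt_radius hsp
    refine FormalMultilinearSeries.le_radius_of_bound _ C fun n => ?_
    refine (mul_le_mul_of_nonneg_right ?_ (by positivity)).trans (hC n)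
    exact MultilinearMap.mkContinuous_norm_le _ (norm_nonneg _) _
  · intro y hy
    have hcy : c y ∈ Metric.eball (0 : E) r := by
      refine Metric.eball_subset_eball hsr.le ?_
      have hy' : ‖y‖ < s := by simpa [← ofReal_norm, edist_eq_enorm_sub] using hy
      have h3 := (hnorm y).trans_lt hy'
      simpa [← ofReal_norm, edist_eq_enorm_sub] using h3
    have h := (hp.hasSum hcy).map (starRingEnd ℂ) Complex.continuous_conj
    rw [hadd]
    exact h

/-- The function `(χ, τ) ↦ conj (f (conj χ, conj τ))`. -/
noncomputable def conjFun (f : ℂ × ℂ → ℂ) : ℂ × ℂ → ℂ := fun x => conj (f (conj x.1, conj x.2))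

theorem analyticAt_conjFun {f : ℂ × ℂ → ℂ} (hf : AnalyticAt ℂ f 0) :
    AnalyticAt ℂ (conjFun f) 0 := by
  refine analyticAt_conj_comp (c := fun x : ℂ × ℂ => (conj x.1, conj x.2)) ?_ ?_ ?_ ?_
  · change AnalyticAt ℂ f (conj (0 : ℂ), conj (0 : ℂ))
    rw [map_zero]
    exact hf
  · intro x y; simp
  · intro a x; simp
  · intro x; simp [Prod.norm_def]

theorem slopeZero_conj {g : ℂ → ℂ} (hg : AnalyticAt ℂ g 0) :
    slopeZero (fun z => conj (g (conj z))) =ᶠ[𝓝 0] fun z => conj (slopeZero g (conj z)) := by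
  have h1 : AnalyticAt ℂ (fun z => conj (slopeZero g (conj z))) 0 := by
    refine analyticAt_conj_comp (c := fun x : ℂ => conj x) ?_ ?_ ?_ ?_
    · simpa using analyticAt_slopeZero hg
    · intro x y; simp
    · intro a x; simp
    · intro x; simp
  have h2 : AnalyticAt ℂ (fun z => conj (g (conj z))) 0 := by
    refine analyticAt_conj_comp (c := fun x : ℂ => conj x) ?_ ?_ ?_ ?_
    · simpa using hg
    · intro x y; simp
    · intro a x; simp
    · intro x; simp
  have h3 := (analyticAt_slopeZero h2).eventually_eq_or_eventually_ne h1
  refine h3.resolve_right fun h4 => ?_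
  have h5 : ∀ᶠ z in 𝓝[≠] (0 : ℂ), slopeZero (fun z => conj (g (conj z))) z =
      conj (slopeZero g (conj z)) := by
    filter_upwards [self_mem_nhdsWithin] with z hz
    refine mul_left_cancel₀ (show z ≠ 0 from hz) ?_
    have e1 := eq_add_mul_slopeZero (fun z => conj (g (conj z))) z
    have e2 := congrArg conj (eq_add_mul_slopeZero g (conj z))
    simp only [map_add, map_mul, Complex.conj_conj, map_zero] at e1 e2
    linear_combination e2 - e1
  obtain ⟨z, hz⟩ := (h4.and h5).exists
  exact hz.1 hz.2

theorem ncoef_conj {g : ℂ → ℂ} (hg : AnalyticAt ℂ g 0) (j : ℕ) :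
    ncoef j (fun z => conj (g (conj z))) = conj (ncoef j g) := by
  induction j generalizing g with
  | zero => simp [ncoef_zero]
  | succ j ih =>
    rw [ncoef_succ, ncoef_succ, ← ih (analyticAt_slopeZero hg)]
    exact ncoef_congr (slopeZero_conj hg) j

theorem tcoef_conjFun {f : ℂ × ℂ → ℂ} (hf : AnalyticAt ℂ f 0) (j : ℕ) :
    tcoef j (conjFun f) =ᶠ[𝓝 0] fun χ => conj (tcoef j f (conj χ)) := by
  have hc : Tendsto (fun χ : ℂ => conj χ) (𝓝 0) (𝓝 0) := by
    have := Complex.continuous_conj.tendsto 0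
    simpa using this
  filter_upwards [hc.eventually (eventually_analyticAt_slice (e := (0 : ℂ)) hf)] with χ hχ
  exact ncoef_conj hχ j

theorem ncoef_tcoef_conjFun {f : ℂ × ℂ → ℂ} (hf : AnalyticAt ℂ f 0) (u v : ℕ) :
    ncoef u (tcoef v (conjFun f)) = conj (ncoef u (tcoef v f)) := by
  rw [ncoef_congr (tcoef_conjFun hf v), ncoef_conj (analyticAt_tcoef (e := (0 : ℂ)) hf v)]

theorem eventually_eq_of_mul_eq {f g : ℂ → ℂ} (hf : AnalyticAt ℂ f 0) (hg : AnalyticAt ℂ g 0)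
    (h : ∀ᶠ z in 𝓝 0, z * f z = z * g z) : ∀ᶠ z in 𝓝 0, f z = g z := by
  refine (hf.eventually_eq_or_eventually_ne hg).resolve_right fun h4 => ?_
  have h5 : ∀ᶠ z in 𝓝[≠] (0 : ℂ), z * f z = z * g z := h.filter_mono nhdsWithin_le_nhds
  obtain ⟨z, h1, h2, h3⟩ := (h4.and (h5.and self_mem_nhdsWithin)).exists
  exact h1 (mul_left_cancel₀ (show z ≠ 0 from h3) h2)

end Conjugation

section JetDerivatives

theorem iteratedDeriv_fst_snd {g : ℂ → ℂ × ℂ} {x : ℂ} (hg : AnalyticAt ℂ g x) (n : ℕ) :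
    (iteratedDeriv n g x).1 = iteratedDeriv n (fun w => (g w).1) x ∧
      (iteratedDeriv n g x).2 = iteratedDeriv n (fun w => (g w).2) x := by
  have h1 := (ContinuousLinearMap.fst ℂ ℂ ℂ).iteratedFDeriv_comp_left
    (hg.contDiffAt (n := n)) (i := n) le_rfl
  have h2 := (ContinuousLinearMap.snd ℂ ℂ ℂ).iteratedFDeriv_comp_left
    (hg.contDiffAt (n := n)) (i := n) le_rfl
  constructor
  · exact (congrArg (fun m => m fun _ => (1 : ℂ)) h1).symm
  · exact (congrArg (fun m => m fun _ => (1 : ℂ)) h2).symm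

/-- The components of a map into `ℂ²`. -/
def component (c : Fin 2) (H : ℂ × ℂ → ℂ × ℂ) : ℂ × ℂ → ℂ := fun x => coord c (H x)

theorem analyticAt_component {H : ℂ × ℂ → ℂ × ℂ} {x : ℂ × ℂ} (hH : AnalyticAt ℂ H x) (c : Fin 2) :
    AnalyticAt ℂ (component c H) x := by
  fin_cases c
  · exact AnalyticAt.comp (g := fun y : ℂ × ℂ => y.1) analyticAt_fst hH
  · exact AnalyticAt.comp (g := fun y : ℂ × ℂ => y.2) analyticAt_snd hH

theorem coord_iteratedDeriv {g : ℂ → ℂ × ℂ} {x : ℂ} (hg : AnalyticAt ℂ g x) (n : ℕ) (c : Fin 2) :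
    coord c (iteratedDeriv n g x) = iteratedDeriv n (fun w => coord c (g w)) x := by
  fin_cases c
  · exact (iteratedDeriv_fst_snd hg n).1
  · exact (iteratedDeriv_fst_snd hg n).2

theorem eventually_coord_iteratedDeriv {H : ℂ × ℂ → ℂ × ℂ} (hH : AnalyticAt ℂ H 0) (v : ℕ)
    (c : Fin 2) : ∀ᶠ z in 𝓝 (0 : ℂ), coord c (iteratedDeriv v (fun w => H (z, w)) 0) =
      v.factorial * tcoef v (component c H) z := by
  have h1 : ContinuousAt (fun z : ℂ => (z, (0 : ℂ))) 0 := by fun_prop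
  have h0 := hH.eventually_analyticAt
  filter_upwards [h1.eventually (p := fun x => AnalyticAt ℂ H x) h0] with z hz
  have h2 : AnalyticAt ℂ (fun w => H (z, w)) 0 :=
    AnalyticAt.comp (f := fun w : ℂ => (z, w)) hz (by fun_prop)
  have h3 : AnalyticAt ℂ (fun w => component c H (z, w)) 0 :=
    AnalyticAt.comp (f := fun w : ℂ => (z, w)) (analyticAt_component hz c) (by fun_prop)
  rw [coord_iteratedDeriv h2]
  exact iteratedDeriv_eq_factorial_mul_ncoef h3 v

theorem analyticAt_iteratedDeriv_slice {H : ℂ × ℂ → ℂ × ℂ} (hH : AnalyticAt ℂ H 0) (v : ℕ) :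
    AnalyticAt ℂ (fun z => iteratedDeriv v (fun w => H (z, w)) 0) 0 := by
  have h : ∀ c, AnalyticAt ℂ (fun z : ℂ => coord c (iteratedDeriv v (fun w => H (z, w)) 0)) 0 := by
    intro c
    refine AnalyticAt.congr ?_ (EventuallyEq.symm (eventually_coord_iteratedDeriv hH v c))
    exact analyticAt_const.mul (analyticAt_tcoef (e := (0 : ℂ)) (analyticAt_component hH c) v)
  exact (h 0).prod (h 1)

theorem coord_partialDeriv_zero {H : ℂ × ℂ → ℂ × ℂ} (hH : AnalyticAt ℂ H 0) (u v : ℕ) (c : Fin 2) :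
    coord c (partialDeriv u v H 0) =
      u.factorial * v.factorial * ncoef u (tcoef v (component c H)) := by
  have h1 := coord_iteratedDeriv (analyticAt_iteratedDeriv_slice hH v) u c
  have h2 := (eventually_coord_iteratedDeriv hH v c)
  have h3 : AnalyticAt ℂ (fun z => coord c (iteratedDeriv v (fun w => H (z, w)) 0)) 0 := by
    refine AnalyticAt.congr ?_ (EventuallyEq.symm h2)
    exact analyticAt_const.mul (analyticAt_tcoef (e := (0 : ℂ)) (analyticAt_component hH c) v)
  have h4 : iteratedDeriv u (fun z => coord c (iteratedDeriv v (fun w => H (z, w)) 0)) 0 =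
      iteratedDeriv u (fun z => v.factorial * tcoef v (component c H) z) 0 :=
    Filter.EventuallyEq.iteratedDeriv_eq u h2
  have h5 := analyticAt_tcoef (e := (0 : ℂ)) (analyticAt_component hH c) v
  change coord c (iteratedDeriv u (fun z => iteratedDeriv v (fun w => H (z, w)) 0) 0) = _
  rw [h1, h4, iteratedDeriv_const_mul_field, iteratedDeriv_eq_factorial_mul_ncoef h5]
  ring

end JetDerivatives

section HolomorphicCoefficients

/-- Functions on `CoeffPoint` which are analytic at all points `(0, A, B)`, `A`, `B` invertible
upper triangular. -/
def holCoeff : Subring (CoeffPoint → ℂ) where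
  carrier := {f | ∀ A ∈ invUpperTriangular, ∀ B ∈ invUpperTriangular, AnalyticAt ℂ f (0, A, B)}
  mul_mem' hf hg A hA B hB := (hf A hA B hB).mul (hg A hA B hB)
  one_mem' _ _ _ _ := analyticAt_const
  add_mem' hf hg A hA B hB := (hf A hA B hB).add (hg A hA B hB)
  zero_mem' _ _ _ _ := analyticAt_const
  neg_mem' hf A hA B hB := (hf A hA B hB).neg

theorem holCoeff_inv {f : CoeffPoint → ℂ} (hf : f ∈ holCoeff)
    (h0 : ∀ A ∈ invUpperTriangular, ∀ B ∈ invUpperTriangular, f (0, A, B) ≠ 0) :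
    (fun x => (f x)⁻¹) ∈ holCoeff := fun A hA B hB => (hf A hA B hB).inv (h0 A hA B hB)

theorem holCoeff_comp {f : CoeffPoint → ℂ} (hf : f ∈ holCoeff) {d : ℂ → ℂ} {c : ℂ}
    (hd : AnalyticAt ℂ d c)
    (h0 : ∀ A ∈ invUpperTriangular, ∀ B ∈ invUpperTriangular, f (0, A, B) = c) :
    (fun x => d (f x)) ∈ holCoeff := fun A hA B hB => by
  rw [← h0 A hA B hB] at hd
  exact hd.comp (hf A hA B hB)

theorem holCoeff_ofZ {q : ℂ → ℂ} (hq : AnalyticAt ℂ q 0) : (fun x : CoeffPoint => q x.1) ∈ holCoeff :=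
  fun A _ B _ => AnalyticAt.comp (f := fun x : CoeffPoint => x.1) (x := (0, A, B)) hq analyticAt_fst

theorem holCoeff_entry (a b : Fin 2) : (fun x : CoeffPoint => x.2.1 a b) ∈ holCoeff :=
  fun _ _ _ _ => ((ContinuousLinearMap.proj (R := ℂ) (φ := fun _ : Fin 2 => ℂ) b).comp
    ((ContinuousLinearMap.proj (R := ℂ) (φ := fun _ : Fin 2 => Fin 2 → ℂ) a).comp
      ((ContinuousLinearMap.fst ℂ OneJet OneJet).comp
        (ContinuousLinearMap.snd ℂ ℂ (OneJet × OneJet))))).analyticAt _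

theorem holCoeff_conjEntry (a b : Fin 2) : (fun x : CoeffPoint => x.2.2 a b) ∈ holCoeff :=
  fun _ _ _ _ => ((ContinuousLinearMap.proj (R := ℂ) (φ := fun _ : Fin 2 => ℂ) b).comp
    ((ContinuousLinearMap.proj (R := ℂ) (φ := fun _ : Fin 2 => Fin 2 → ℂ) a).comp
      ((ContinuousLinearMap.snd ℂ OneJet OneJet).comp
        (ContinuousLinearMap.snd ℂ ℂ (OneJet × OneJet))))).analyticAt _

theorem conj_mem_invUpperTriangular {A : OneJet} (hA : A ∈ invUpperTriangular) :
    (fun a b => conj (A a b)) ∈ invUpperTriangular := by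
  obtain ⟨h1, h2, h3⟩ := hA
  refine ⟨?_, ?_, ?_⟩
  · change conj (A 1 0) = 0
    rw [h1, map_zero]
  · change conj (A 0 0) ≠ 0
    exact (map_ne_zero _).2 h2
  · change conj (A 1 1) ≠ 0
    exact (map_ne_zero _).2 h3

/-- `f ↦ conj (f (conj z, conj B, conj A))`. -/
noncomputable def conjCoeff : holCoeff →+* holCoeff where
  toFun f := ⟨fun x => conj (f.1 (conj x.1, fun a b => conj (x.2.2 a b), fun a b => conj (x.2.1 a b))),
    fun A hA B hB => by
      have h := f.2 _ (conj_mem_invUpperTriangular hB) _ (conj_mem_invUpperTriangular hA)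
      refine analyticAt_conj_comp (f := f.1) (c := fun x : CoeffPoint =>
        ((conj x.1, fun a b => conj (x.2.2 a b), fun a b => conj (x.2.1 a b)) : CoeffPoint)) ?_ ?_ ?_ ?_
      · change AnalyticAt ℂ f.1 (conj (0 : ℂ), _, _)
        rw [map_zero]
        exact h
      · intro x y
        refine Prod.ext (map_add _ _ _) (Prod.ext ?_ ?_)
        · funext a b; exact map_add _ _ _
        · funext a b; exact map_add _ _ _
      · intro k x
        refine Prod.ext (map_mul _ _ _) (Prod.ext ?_ ?_)
        · funext a b; exact map_mul _ _ _
        · funext a b; exact map_mul _ _ _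
      · intro x
        have hpi : ∀ M : OneJet, ‖(fun a b => conj (M a b) : OneJet)‖ ≤ ‖M‖ := by
          intro M
          refine (pi_norm_le_iff_of_nonneg (norm_nonneg _)).2 fun a => ?_
          refine (pi_norm_le_iff_of_nonneg (norm_nonneg _)).2 fun b => ?_
          rw [RCLike.norm_conj]
          exact (norm_le_pi_norm (M a) b).trans (norm_le_pi_norm M a)
        simp only [Prod.norm_def]
        refine max_le_max (by rw [RCLike.norm_conj]) ?_
        rw [max_comm]
        exact max_le_max (hpi _) (hpi _)⟩
  map_one' := Subtype.ext (funext fun _ => map_one _)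
  map_mul' _ _ := Subtype.ext (funext fun _ => map_mul _ _ _)
  map_zero' := Subtype.ext (funext fun _ => map_zero _)
  map_add' _ _ := Subtype.ext (funext fun _ => map_add _ _ _)

/-- The value at `z = 0`. -/
def coeffAtZero : holCoeff →+* holCoeff where
  toFun f := ⟨fun x => f.1 (0, x.2), fun A hA B hB =>
    AnalyticAt.comp (f := fun x : CoeffPoint => ((0, x.2) : CoeffPoint)) (f.2 A hA B hB)
      (analyticAt_const.prod analyticAt_snd)⟩
  map_one' := rfl
  map_mul' _ _ := rfl
  map_zero' := rfl
  map_add' _ _ := rfl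

/-- The divided difference in `z`. -/
noncomputable def coeffSlope (f : holCoeff) : holCoeff :=
  ⟨fun x => slopeZero (fun z => f.1 (z, x.2)) x.1, fun A hA B hB => by
    have hsw : ∀ y : OneJet × OneJet, AnalyticAt ℂ
        (fun y : (OneJet × OneJet) × ℂ => ((y.2, y.1) : CoeffPoint)) (y, 0) := fun y =>
      analyticAt_snd.prod analyticAt_fst
    have h1 : AnalyticAt ℂ (fun y : (OneJet × OneJet) × ℂ => f.1 (y.2, y.1)) ((A, B), 0) :=
      AnalyticAt.comp (f := fun y : (OneJet × OneJet) × ℂ => ((y.2, y.1) : CoeffPoint))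
        (f.2 A hA B hB) (hsw _)
    exact AnalyticAt.comp (f := fun x : CoeffPoint => (x.2, x.1)) (x := (0, A, B))
      (analyticAt_dquot h1 1) (analyticAt_snd.prod analyticAt_fst)⟩

end HolomorphicCoefficients

section JetRing

variable {ι : Type} (H : ι → ℂ × ℂ → ℂ × ℂ)

/-- The point `(z, H'(0), conj H'(0))`. -/
noncomputable def coeffPoint (i : ι) (z : ℂ) : CoeffPoint :=
  (z, jacobian (H i), fun a b => conj (jacobian (H i) a b))

/-- Evaluation of a jet polynomial along the family `H`. -/
noncomputable def jetEval (k : ℕ) (i : ι) (z : ℂ) :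
    MvPolynomial (JetIndex (k + 1) ⊕ JetIndex (k + 1)) holCoeff →+* ℂ :=
  MvPolynomial.eval₂Hom ((Pi.evalRingHom (fun _ : CoeffPoint => ℂ) (coeffPoint H i z)).comp
    holCoeff.subtype) (Sum.elim (jet (k + 1) (H i)) (fun a => conj (jet (k + 1) (H i) a)))

theorem jetEval_C (k : ℕ) (i : ι) (z : ℂ) (f : holCoeff) :
    jetEval H k i z (MvPolynomial.C f) = f.1 (coeffPoint H i z) := by
  simp [jetEval]

theorem jetEval_X (k : ℕ) (i : ι) (z : ℂ) (n : JetIndex (k + 1) ⊕ JetIndex (k + 1)) :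
    jetEval H k i z (MvPolynomial.X n) =
      Sum.elim (jet (k + 1) (H i)) (fun a => conj (jet (k + 1) (H i) a)) n := by
  simp [jetEval]

/-- All Jacobian matrices are upper triangular and invertible. -/
def TriangularFamily : Prop := ∀ i, jacobian (H i) ∈ invUpperTriangular

variable {H}

theorem analyticAt_coeffPoint (hT : TriangularFamily H) (f : holCoeff) (i : ι) :
    AnalyticAt ℂ (fun z => f.1 (coeffPoint H i z)) 0 :=
  AnalyticAt.comp (f := fun z => coeffPoint H i z)
    (f.2 _ (hT i) _ (conj_mem_invUpperTriangular (hT i))) (analyticAt_id.prod analyticAt_const)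

theorem analyticAt_jetEval (hT : TriangularFamily H) {k : ℕ}
    (P : MvPolynomial (JetIndex (k + 1) ⊕ JetIndex (k + 1)) holCoeff) (i : ι) :
    AnalyticAt ℂ (fun z => jetEval H k i z P) 0 := by
  induction P using MvPolynomial.induction_on with
  | C f =>
    simp only [jetEval_C]
    exact analyticAt_coeffPoint hT f i
  | add P Q hP hQ =>
    simp only [map_add]
    exact hP.add hQ
  | mul_X P n hP =>
    simp only [map_mul, jetEval_X]
    exact hP.mul analyticAt_const

theorem exists_jetEval_slope {k : ℕ}
    (P : MvPolynomial (JetIndex (k + 1) ⊕ JetIndex (k + 1)) holCoeff) :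
    ∃ Q, ∀ (i : ι) (z : ℂ), jetEval H k i z P = jetEval H k i 0 P + z * jetEval H k i z Q := by
  induction P using MvPolynomial.induction_on with
  | C f =>
    refine ⟨MvPolynomial.C (coeffSlope f), fun i z => ?_⟩
    rw [jetEval_C, jetEval_C, jetEval_C]
    exact eq_add_mul_slopeZero (fun z => f.1 (coeffPoint H i z)) z
  | add P Q hP hQ =>
    obtain ⟨P', hP⟩ := hP
    obtain ⟨Q', hQ⟩ := hQ
    refine ⟨P' + Q', fun i z => ?_⟩
    rw [map_add, map_add, map_add, hP, hQ]
    ring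
  | mul_X P n hP =>
    obtain ⟨P', hP⟩ := hP
    refine ⟨P' * MvPolynomial.X n, fun i z => ?_⟩
    rw [map_mul, map_mul, map_mul, jetEval_X, jetEval_X, hP]
    ring

theorem exists_jetEval_zero {k : ℕ}
    (P : MvPolynomial (JetIndex (k + 1) ⊕ JetIndex (k + 1)) holCoeff) :
    ∃ Q, ∀ (i : ι) (z : ℂ), jetEval H k i z Q = jetEval H k i 0 P := by
  refine ⟨MvPolynomial.map coeffAtZero P, fun i z => ?_⟩
  have : (jetEval H k i z).comp (MvPolynomial.map coeffAtZero) = jetEval H k i 0 := by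
    refine MvPolynomial.ringHom_ext (fun f => ?_) fun n => ?_
    · rw [RingHom.comp_apply, MvPolynomial.map_C, jetEval_C, jetEval_C]
      rfl
    · rw [RingHom.comp_apply, MvPolynomial.map_X, jetEval_X, jetEval_X]
  exact congrArg (fun φ => φ P) this

theorem exists_jetEval_conj {k : ℕ}
    (P : MvPolynomial (JetIndex (k + 1) ⊕ JetIndex (k + 1)) holCoeff) :
    ∃ Q, ∀ i : ι, jetEval H k i 0 Q = conj (jetEval H k i 0 P) := by
  refine ⟨MvPolynomial.eval₂Hom (MvPolynomial.C.comp conjCoeff) (fun n => MvPolynomial.X n.swap) P,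
    fun i => ?_⟩
  have : (jetEval H k i 0).comp (MvPolynomial.eval₂Hom (MvPolynomial.C.comp conjCoeff)
      (fun n => MvPolynomial.X n.swap)) = (starRingEnd ℂ).comp (jetEval H k i 0) := by
    refine MvPolynomial.ringHom_ext (fun f => ?_) fun n => ?_
    · rw [RingHom.comp_apply, MvPolynomial.coe_eval₂Hom, MvPolynomial.eval₂_C, RingHom.comp_apply,
        RingHom.comp_apply, jetEval_C, jetEval_C]
      change conj (f.1 (conj (0 : ℂ), fun a b => conj (conj (jacobian (H i) a b)), _)) = _
      simp only [map_zero, Complex.conj_conj]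
      rfl
    · rw [RingHom.comp_apply, MvPolynomial.coe_eval₂Hom, MvPolynomial.eval₂_X,
        RingHom.comp_apply, jetEval_X, jetEval_X]
      rcases n with n | n
      · rfl
      · simp
  exact congrArg (fun φ => φ P) this

theorem exists_jetEval_mono {j k : ℕ} (hjk : j ≤ k)
    (P : MvPolynomial (JetIndex (j + 1) ⊕ JetIndex (j + 1)) holCoeff) :
    ∃ Q, ∀ (i : ι) (z : ℂ), jetEval H k i z Q = jetEval H j i z P := by
  let inc : JetIndex (j + 1) → JetIndex (k + 1) := fun a =>
    (a.1, ⟨a.2.1, a.2.2.1, a.2.2.2.trans (by omega)⟩)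
  refine ⟨MvPolynomial.rename (Sum.map inc inc) P, fun i z => ?_⟩
  have : (jetEval H k i z).comp (MvPolynomial.rename (R := holCoeff) (Sum.map inc inc)).toRingHom =
      jetEval H j i z := by
    refine MvPolynomial.ringHom_ext (fun f => ?_) fun n => ?_
    · rw [RingHom.comp_apply]
      change jetEval H k i z (MvPolynomial.rename _ _) = _
      rw [MvPolynomial.rename_C, jetEval_C, jetEval_C]
    · rw [RingHom.comp_apply]
      change jetEval H k i z (MvPolynomial.rename _ _) = _
      rw [MvPolynomial.rename_X, jetEval_X, jetEval_X]
      rcases n with n | n <;> rfl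
  exact congrArg (fun φ => φ P) this

variable (H) in
/-- Families of germs which are values of jet polynomials of order `k + 1`. -/
noncomputable def jetRing (k : ℕ) : Subring (AnFam ι ℂ) where
  carrier := {g | ∃ P, ∀ i, ∀ᶠ z in 𝓝 0, g.1 i z = jetEval H k i z P}
  mul_mem' := by
    rintro f g ⟨P, hP⟩ ⟨Q, hQ⟩
    refine ⟨P * Q, fun i => ?_⟩
    filter_upwards [hP i, hQ i] with z h1 h2
    rw [map_mul, ← h1, ← h2]
    rfl
  one_mem' := ⟨1, fun i => Eventually.of_forall fun z => by rw [map_one]; rfl⟩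
  add_mem' := by
    rintro f g ⟨P, hP⟩ ⟨Q, hQ⟩
    refine ⟨P + Q, fun i => ?_⟩
    filter_upwards [hP i, hQ i] with z h1 h2
    rw [map_add, ← h1, ← h2]
    rfl
  zero_mem' := ⟨0, fun i => Eventually.of_forall fun z => by rw [map_zero]; rfl⟩
  neg_mem' := by
    rintro f ⟨P, hP⟩
    refine ⟨-P, fun i => ?_⟩
    filter_upwards [hP i] with z h1
    rw [map_neg, ← h1]
    rfl

theorem jetRing_germClosed (k : ℕ) : GermClosed (jetRing H k) := by
  rintro f g ⟨P, hP⟩ h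
  refine ⟨P, fun i => ?_⟩
  filter_upwards [hP i, h i] with z h1 h2
  rw [← h2, h1]

theorem jetRing_mono {j k : ℕ} (hjk : j ≤ k) : jetRing H j ≤ jetRing H k := by
  rintro f ⟨P, hP⟩
  obtain ⟨Q, hQ⟩ := exists_jetEval_mono (H := H) hjk P
  exact ⟨Q, fun i => (hP i).mono fun z hz => by rw [hQ, hz]⟩

/-- A family of constant functions. -/
def numFam (c : ι → ℂ) : AnFam ι ℂ := ⟨fun i _ => c i, fun _ => analyticAt_const⟩

/-- The family `z ↦ f (z, H'(0), conj H'(0))`. -/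
noncomputable def holFam (hT : TriangularFamily H) (f : holCoeff) : AnFam ι ℂ :=
  ⟨fun i z => f.1 (coeffPoint H i z), analyticAt_coeffPoint hT f⟩

theorem holFam_mem (hT : TriangularFamily H) (f : holCoeff) (k : ℕ) :
    holFam hT f ∈ jetRing H k :=
  ⟨MvPolynomial.C f, fun i => Eventually.of_forall fun z => by rw [jetEval_C]; rfl⟩

theorem known_mem_jetRing {q : ℂ → ℂ} (hq : AnalyticAt ℂ q 0) (k : ℕ) :
    AnFam.known ι q hq ∈ jetRing H k :=
  ⟨MvPolynomial.C ⟨_, holCoeff_ofZ hq⟩, fun i => Eventually.of_forall fun z => by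
    rw [jetEval_C]; rfl⟩

theorem jet_mem (k : ℕ) (a : JetIndex (k + 1)) :
    numFam (fun i => jet (k + 1) (H i) a) ∈ jetRing H k :=
  ⟨MvPolynomial.X (Sum.inl a), fun i => Eventually.of_forall fun z => by rw [jetEval_X]; rfl⟩

theorem numFam_conj_mem {k : ℕ} {c : ι → ℂ} (h : numFam c ∈ jetRing H k) :
    numFam (fun i => conj (c i)) ∈ jetRing H k := by
  obtain ⟨P, hP⟩ := h
  obtain ⟨Q, hQ⟩ := exists_jetEval_conj (H := H) P
  obtain ⟨R, hR⟩ := exists_jetEval_zero (H := H) Q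
  refine ⟨R, fun i => Eventually.of_forall fun z => ?_⟩
  rw [hR, hQ]
  exact congrArg conj (hP i).self_of_nhds

theorem slope_mem_jetRing (hT : TriangularFamily H) {k : ℕ} {f g : AnFam ι ℂ}
    (hf : f ∈ jetRing H k) (h : ∀ i, ∀ᶠ z in 𝓝 0, f.1 i z = f.1 i 0 + z * g.1 i z) :
    g ∈ jetRing H k := by
  obtain ⟨P, hP⟩ := hf
  obtain ⟨Q, hQ⟩ := exists_jetEval_slope (H := H) P
  refine ⟨Q, fun i => eventually_eq_of_mul_eq (g.2 i) (analyticAt_jetEval hT Q i) ?_⟩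
  filter_upwards [hP i, h i] with z h1 h2
  have h3 := (hP i).self_of_nhds
  have h4 := hQ i z
  linear_combination h1 - h2 + h4 - h3

theorem ncoef_mem_jetRing (hT : TriangularFamily H) {k : ℕ} {f : AnFam ι ℂ}
    (hf : f ∈ jetRing H k) (u : ℕ) : numFam (fun i => ncoef u (f.1 i)) ∈ jetRing H k := by
  induction u generalizing f with
  | zero =>
    obtain ⟨P, hP⟩ := hf
    obtain ⟨Q, hQ⟩ := exists_jetEval_zero (H := H) P
    refine ⟨Q, fun i => Eventually.of_forall fun z => ?_⟩
    rw [hQ]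
    exact (hP i).self_of_nhds
  | succ u ih =>
    let g : AnFam ι ℂ := ⟨fun i => slopeZero (f.1 i), fun i => analyticAt_slopeZero (f.2 i)⟩
    have hg : g ∈ jetRing H k := slope_mem_jetRing hT hf fun i => Eventually.of_forall fun z =>
      eq_add_mul_slopeZero (f.1 i) z
    exact ih hg

theorem mem_jetRing_of_mul_pow (hT : TriangularFamily H) {k n : ℕ} {f g : AnFam ι ℂ}
    (hf : f ∈ jetRing H k) (h : ∀ i, ∀ᶠ z in 𝓝 0, f.1 i z = z ^ n * g.1 i z) :
    g ∈ jetRing H k := by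
  induction n generalizing g with
  | zero => exact jetRing_germClosed k hf fun i => (h i).mono fun z hz => by simpa using hz
  | succ n ih =>
    let Z : AnFam ι ℂ := ⟨fun _ z => z, fun _ => analyticAt_id⟩
    have h1 : Z * g ∈ jetRing H k := ih fun i => (h i).mono fun z hz => by
      rw [hz, pow_succ, mul_assoc]
      rfl
    refine slope_mem_jetRing hT h1 fun i => Eventually.of_forall fun z => ?_
    change z * g.1 i z = 0 * g.1 i 0 + z * g.1 i z
    ring

theorem numFam_mul_mem_iff {k : ℕ} {c : ι → ℂ} {n : ℂ} (hn : n ≠ 0)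
    (h : numFam (fun i => n * c i) ∈ jetRing H k) : numFam c ∈ jetRing H k := by
  have h1 := (jetRing H k).mul_mem (known_mem_jetRing (H := H)
    (analyticAt_const (v := n⁻¹)) k) h
  refine jetRing_germClosed k h1 fun i => Eventually.of_forall fun z => ?_
  change n⁻¹ * (n * c i) = c i
  field_simp

/-- The Taylor coefficients of order at most `k + 1` belong to the jet ring. -/
theorem taylorCoeff_mem_jetRing {k : ℕ} (hH : ∀ i, AnalyticAt ℂ (H i) 0) (h0 : ∀ i, H i 0 = 0)
    (c : Fin 2) {u v : ℕ} (huv : u + v ≤ k + 1) :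
    numFam (fun i => ncoef u (tcoef v (component c (H i)))) ∈ jetRing H k := by
  rcases Nat.eq_zero_or_pos (u + v) with h | h
  · obtain ⟨rfl, rfl⟩ : u = 0 ∧ v = 0 := by omega
    refine jetRing_germClosed k (jetRing H k).zero_mem fun i => Eventually.of_forall fun z => ?_
    change 0 = coord c (H i (0, 0))
    have := h0 i
    rw [← Prod.mk_zero_zero] at this
    rw [this]
    fin_cases c <;> rfl
  · have h1 := jet_mem (H := H) k (c, ⟨(u, v), h, huv⟩)
    refine numFam_mul_mem_iff (n := u.factorial * v.factorial) ?_ ?_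
    · exact mul_ne_zero (by exact_mod_cast u.factorial_ne_zero) (by exact_mod_cast v.factorial_ne_zero)
    · refine jetRing_germClosed k h1 fun i => Eventually.of_forall fun z => ?_
      exact coord_partialDeriv_zero (hH i) u v c

theorem exists_jetPolynomial {k : ℕ} {g : AnFam ι ℂ} (hg : g ∈ jetRing H k) :
    ∃ P : JetPolynomial (k + 1), P.HasHolomorphicCoeffs ∧ ∀ i, ∀ᶠ z in 𝓝 0, g.1 i z =
      JetPolynomial.value P (coeffPoint H i z) (jet (k + 1) (H i))
        (fun a => conj (jet (k + 1) (H i) a)) := by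
  obtain ⟨P, hP⟩ := hg
  refine ⟨MvPolynomial.map holCoeff.subtype P, ?_, fun i => ?_⟩
  · refine ⟨{x | ∀ d ∈ P.support, AnalyticAt ℂ (P.coeff d).1 x}, ?_, ?_, ?_⟩
    · have : {x | ∀ d ∈ P.support, AnalyticAt ℂ (P.coeff d).1 x} =
          ⋂ d ∈ P.support, {x | AnalyticAt ℂ (P.coeff d).1 x} := by
        ext x; simp
      rw [this]
      exact isOpen_biInter_finset fun d _ => isOpen_analyticAt ℂ _
    · intro A hA B hB d _
      exact (P.coeff d).2 A hA B hB
    · intro d x hx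
      rw [MvPolynomial.coeff_map]
      by_cases hd : d ∈ P.support
      · exact (hx d hd).differentiableAt.differentiableWithinAt
      · rw [MvPolynomial.notMem_support_iff.1 hd, map_zero]
        exact (differentiableAt_const (0 : ℂ)).differentiableWithinAt
  · filter_upwards [hP i] with z hz
    rw [hz, JetPolynomial.value, MvPolynomial.eval₂_map]
    rfl

end JetRing

section ImplicitGraph

variable {E : Type*} [NormedAddCommGroup E] [NormedSpace ℂ E] [CompleteSpace E]

/-- The analytic solution `s = S (e, w)` of `s + φ (e, s) = w`. -/
theorem exists_graph_solution {φ : E × ℂ → ℂ} (hφ : AnalyticAt ℂ φ 0)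
    (h0 : ∀ᶠ s : ℂ in 𝓝 0, φ (0, s) = 0) :
    ∃ S : E × ℂ → ℂ, AnalyticAt ℂ S 0 ∧ S 0 = 0 ∧ (∀ᶠ x in 𝓝 0, S x + φ (x.1, S x) = x.2) ∧
      ∀ᶠ x in 𝓝 0, S (x.1, x.2 + φ x) = x.2 := by
  set L := fderiv ℂ φ 0 with hL
  have hL1 : ∀ c : ℂ, L (0, c) = 0 := by
    intro c
    have h1 : HasDerivAt (fun s : ℂ => φ (0, s)) (L (0, 1)) 0 := by
      have h2 : HasDerivAt (fun s : ℂ => ((0 : E), s)) ((0 : E), (1 : ℂ)) 0 :=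
        (hasDerivAt_const _ _).prodMk (hasDerivAt_id _)
      exact HasFDerivAt.comp_hasDerivAt (f := fun s : ℂ => ((0 : E), s)) (0 : ℂ)
        (hφ.differentiableAt.hasFDerivAt) h2
    have h3 : HasDerivAt (fun s : ℂ => φ (0, s)) 0 0 :=
      (hasDerivAt_const (0 : ℂ) (0 : ℂ)).congr_of_eventuallyEq h0
    have h4 : ((0 : E), c) = c • ((0 : E), (1 : ℂ)) := by simp
    rw [h4, map_smul, h1.unique h3, smul_zero]
  let Ψ : E × ℂ → E × ℂ := fun x => (x.1, x.2 + φ x)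
  let N : E × ℂ →L[ℂ] E × ℂ := (ContinuousLinearMap.inr ℂ E ℂ).comp L
  have hN : ∀ x, N x = (0, L x) := fun x => rfl
  let i : (E × ℂ) ≃L[ℂ] (E × ℂ) := ContinuousLinearEquiv.equivOfInverse
    (ContinuousLinearMap.id ℂ _ + N) (ContinuousLinearMap.id ℂ _ - N) (by
      intro x
      simp [hN, hL1]) (by
      intro x
      simp [hN, hL1])
  have hΨa : AnalyticAt ℂ Ψ 0 := analyticAt_fst.prod (analyticAt_snd.add hφ)
  have hΨd : HasStrictFDerivAt Ψ (i : E × ℂ →L[ℂ] E × ℂ) 0 := by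
    have h1 : HasStrictFDerivAt Ψ ((ContinuousLinearMap.fst ℂ E ℂ).prod
        (ContinuousLinearMap.snd ℂ E ℂ + L)) 0 :=
      hasStrictFDerivAt_fst.prodMk (hasStrictFDerivAt_snd.add hφ.hasStrictFDerivAt)
    convert! h1 using 1
    ext x <;> simp [i, hN]
  let e := hΨd.toOpenPartialHomeomorph Ψ
  have he0 : (0 : E × ℂ) ∈ e.source := hΨd.mem_toOpenPartialHomeomorph_source
  have hecoe : ∀ x, e x = Ψ x := fun x => rfl
  have hφ0 : φ 0 = 0 := h0.self_of_nhds
  have hΨ0 : Ψ 0 = 0 := by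
    change ((0 : E), (0 : ℂ) + φ 0) = 0
    rw [hφ0, add_zero]
    rfl
  have hsymm : AnalyticAt ℂ e.symm 0 := by
    have h1 := e.analyticAt_symm' (i := i) he0 (by exact hΨa) (by exact hΨd.hasFDerivAt.fderiv)
    rwa [hecoe, hΨ0] at h1
  have h0t : (0 : E × ℂ) ∈ e.target := by
    have := e.map_source he0
    rwa [hecoe, hΨ0] at this
  have hs0 : e.symm 0 = 0 := by
    have := e.left_inv he0
    rwa [hecoe, hΨ0] at this
  refine ⟨fun x => (e.symm x).2, ?_, ?_, ?_, ?_⟩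
  · exact AnalyticAt.comp (g := fun y : E × ℂ => y.2) analyticAt_snd hsymm
  · change (e.symm 0).2 = 0
    rw [hs0]
    rfl
  · filter_upwards [e.open_target.mem_nhds h0t] with x hx
    have h1 := e.right_inv hx
    rw [hecoe] at h1
    have h2 : (Ψ (e.symm x)).1 = x.1 := congrArg Prod.fst h1
    have h3 : (Ψ (e.symm x)).2 = x.2 := congrArg Prod.snd h1
    change (e.symm x).1 = x.1 at h2
    rw [← h2]
    exact h3
  · filter_upwards [e.open_source.mem_nhds he0] with x hx
    exact congrArg Prod.snd (e.left_inv hx)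

end ImplicitGraph

section TotallyReal

theorem eq_zero_of_real_zeros {g : ℂ → ℂ} {r : ℝ} (hg : AnalyticOnNhd ℂ g (Metric.ball 0 r))
    (h : ∀ t : ℝ, |t| < r → g t = 0) : ∀ z ∈ Metric.ball (0 : ℂ) r, g z = 0 := by
  intro z hz
  have hr : 0 < r := lt_of_le_of_lt dist_nonneg hz
  have h0 : (0 : ℂ) ∈ Metric.ball (0 : ℂ) r := Metric.mem_ball_self hr
  refine hg.eqOn_zero_of_preconnected_of_frequently_eq_zero
    (convex_ball (0 : ℂ) r).isPreconnected h0 ?_ hz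
  have h1 : Tendsto (fun t : ℝ => (t : ℂ)) (𝓝[≠] 0) (𝓝[≠] 0) := by
    refine tendsto_nhdsWithin_iff.2 ⟨?_, ?_⟩
    · have := Complex.continuous_ofReal.tendsto (0 : ℝ)
      rw [Complex.ofReal_zero] at this
      exact this.mono_left nhdsWithin_le_nhds
    · filter_upwards [self_mem_nhdsWithin] with t ht
      simpa using ht
  refine h1.frequently (Eventually.frequently ?_)
  have h2 : ∀ᶠ t : ℝ in 𝓝 0, |t| < r := by
    have := Metric.ball_mem_nhds (0 : ℝ) hr
    filter_upwards [this] with t ht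
    simpa using ht
  filter_upwards [h2.filter_mono nhdsWithin_le_nhds] with t ht
  exact h t ht

/-- A holomorphic function vanishing on `{((z, conj z), s) : s ∈ ℝ}` vanishes identically. -/
theorem eventually_zero_of_totallyReal {f : Triple → ℂ} (hf : AnalyticAt ℂ f 0)
    (h : ∀ᶠ p : ℂ × ℝ in 𝓝 0, f ((p.1, conj p.1), (p.2 : ℂ)) = 0) :
    ∀ᶠ x in 𝓝 0, f x = 0 := by
  let L : Triple → Triple := fun y =>
    ((y.1.1 + Complex.I * y.1.2, y.1.1 - Complex.I * y.1.2), y.2)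
  have hLc : Continuous L := by fun_prop
  have hL0 : L 0 = 0 := by simp [L]
  have hLa : ∀ y, AnalyticAt ℂ L y := by
    intro y
    have h1 : AnalyticAt ℂ (fun y : Triple => y.1.1) y :=
      AnalyticAt.comp (f := fun y : Triple => y.1) analyticAt_fst analyticAt_fst
    have h2 : AnalyticAt ℂ (fun y : Triple => y.1.2) y :=
      AnalyticAt.comp (f := fun y : Triple => y.1) analyticAt_snd analyticAt_fst
    exact ((h1.add (analyticAt_const.mul h2)).prod (h1.sub (analyticAt_const.mul h2))).prod
      analyticAt_snd
  have hLt : Tendsto L (𝓝 0) (𝓝 0) := by simpa [hL0] using hLc.tendsto 0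
  have hR : Tendsto (fun q : (ℝ × ℝ) × ℝ =>
      (((q.1.1 : ℂ) + Complex.I * (q.1.2 : ℂ), q.2) : ℂ × ℝ)) (𝓝 0) (𝓝 0) := by
    have : Continuous (fun q : (ℝ × ℝ) × ℝ =>
      (((q.1.1 : ℂ) + Complex.I * (q.1.2 : ℂ), q.2) : ℂ × ℝ)) := by fun_prop
    exact this.tendsto' 0 0 (by simp)
  obtain ⟨r₁, hr₁, hb₁⟩ := Metric.eventually_nhds_iff_ball.1
    (hLt.eventually hf.eventually_analyticAt)
  obtain ⟨r₂, hr₂, hb₂⟩ := Metric.eventually_nhds_iff_ball.1 (hR.eventually h)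
  set r := min r₁ r₂ with hrdef
  have hr : 0 < r := lt_min hr₁ hr₂
  have hmem : ∀ x y s : ℂ, x ∈ Metric.ball (0 : ℂ) r → y ∈ Metric.ball (0 : ℂ) r →
      s ∈ Metric.ball (0 : ℂ) r → ((x, y), s) ∈ Metric.ball (0 : Triple) r₁ := by
    intro x y s hx hy hs
    simp only [Metric.mem_ball, dist_zero_right, Prod.norm_def, max_lt_iff] at hx hy hs ⊢
    have := min_le_left r₁ r₂
    exact ⟨⟨by linarith, by linarith⟩, by linarith⟩
  have hofReal : ∀ t : ℝ, |t| < r → (t : ℂ) ∈ Metric.ball (0 : ℂ) r := by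
    intro t ht
    simpa using ht
  have han : ∀ x y s : ℂ, x ∈ Metric.ball (0 : ℂ) r → y ∈ Metric.ball (0 : ℂ) r →
      s ∈ Metric.ball (0 : ℂ) r → AnalyticAt ℂ (fun v => f (L v)) ((x, y), s) :=
    fun x y s hx hy hs => AnalyticAt.comp (hb₁ _ (hmem x y s hx hy hs)) (hLa _)
  have s0 : ∀ x y s : ℝ, |x| < r → |y| < r → |s| < r → f (L ((x, y), s)) = 0 := by
    intro x y s hx hy hs
    have := hb₂ ((x, y), s) (by
      simp only [Metric.mem_ball, dist_zero_right, Prod.norm_def, max_lt_iff, Real.norm_eq_abs]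
      have := min_le_right r₁ r₂
      exact ⟨⟨by linarith, by linarith⟩, by linarith⟩)
    simp only [map_add, map_mul, Complex.conj_ofReal, Complex.conj_I] at this
    simp only [L]
    rw [← this]
    ring_nf
  have s1 : ∀ x y : ℝ, |x| < r → |y| < r → ∀ s ∈ Metric.ball (0 : ℂ) r, f (L ((x, y), s)) = 0 :=
    fun x y hx hy => eq_zero_of_real_zeros (fun s hs => AnalyticAt.comp
      (f := fun s : ℂ => (((x : ℂ), (y : ℂ)), s)) (han x y s (hofReal x hx) (hofReal y hy) hs)
      (analyticAt_const.prod analyticAt_id)) fun s hs => s0 x y s hx hy hs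
  have s2 : ∀ x : ℝ, |x| < r → ∀ s ∈ Metric.ball (0 : ℂ) r, ∀ y ∈ Metric.ball (0 : ℂ) r,
      f (L ((x, y), s)) = 0 :=
    fun x hx s hs => eq_zero_of_real_zeros (fun y hy => AnalyticAt.comp
      (f := fun y : ℂ => (((x : ℂ), y), s)) (han x y s (hofReal x hx) hy hs)
      ((analyticAt_const.prod analyticAt_id).prod analyticAt_const)) fun y hy => s1 x y hx hy s hs
  have s3 : ∀ s ∈ Metric.ball (0 : ℂ) r, ∀ y ∈ Metric.ball (0 : ℂ) r,
      ∀ x ∈ Metric.ball (0 : ℂ) r, f (L ((x, y), s)) = 0 :=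
    fun s hs y hy => eq_zero_of_real_zeros (fun x hx => AnalyticAt.comp
      (f := fun x : ℂ => ((x, y), s)) (han x y s hx hy hs)
      ((analyticAt_id.prod analyticAt_const).prod analyticAt_const)) fun x hx => s2 x hx s hs y hy
  have hinv : Tendsto (fun x : Triple =>
      ((((x.1.1 + x.1.2) / 2, (x.1.1 - x.1.2) / (2 * Complex.I)), x.2) : Triple)) (𝓝 0) (𝓝 0) := by
    have : Continuous (fun x : Triple =>
      ((((x.1.1 + x.1.2) / 2, (x.1.1 - x.1.2) / (2 * Complex.I)), x.2) : Triple)) := by fun_prop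
    exact this.tendsto' 0 0 (by simp)
  filter_upwards [hinv.eventually (Metric.ball_mem_nhds _ hr)] with x hx
  rw [dist_zero_right, Prod.norm_def, max_lt_iff, Prod.norm_def, max_lt_iff] at hx
  have := s3 x.2 (mem_ball_zero_iff.2 hx.2) _ (mem_ball_zero_iff.2 hx.1.2) _
    (mem_ball_zero_iff.2 hx.1.1)
  have hLx : L (((x.1.1 + x.1.2) / 2, (x.1.1 - x.1.2) / (2 * Complex.I)), x.2) = x := by
    have hI := Complex.I_ne_zero
    refine Prod.ext (Prod.ext ?_ ?_) rfl
    · simp only [L]; field_simp; ring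
    · simp only [L]; field_simp; ring
  rwa [hLx] at this

end TotallyReal

section SegreIdentity

/-- `T` is the complex defining function of the graph `w = s + φ, τ = s - φ`: it expresses `τ`
in terms of `w`. -/
structure IsReflection (φ : Triple → ℂ) (T : Triple → ℂ) : Prop where
  analytic : AnalyticAt ℂ T 0
  exists_param : ∃ S : Triple → ℂ, AnalyticAt ℂ S 0 ∧ S 0 = 0 ∧
    (∀ᶠ x in 𝓝 0, S x + φ (x.1, S x) = x.2) ∧ ∀ᶠ x in 𝓝 0, T x = S x - φ (x.1, S x)
  param : ∀ᶠ x in 𝓝 0, T (x.1, x.2 + φ x) = x.2 - φ x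

theorem exists_isReflection {φ : Triple → ℂ} (hφ : AnalyticAt ℂ φ 0)
    (h0 : ∀ᶠ s : ℂ in 𝓝 0, φ (0, s) = 0) : ∃ T, IsReflection φ T := by
  obtain ⟨S, hS, hS0, h1, h2⟩ := exists_graph_solution hφ h0
  have h3 : AnalyticAt ℂ (fun x : Triple => (x.1, S x)) 0 := analyticAt_fst.prod hS
  have h30 : (((0 : Triple).1, S 0) : Triple) = 0 := by simp [hS0]
  refine ⟨fun x => S x - φ (x.1, S x), ?_, ⟨S, hS, hS0, h1, Eventually.of_forall fun _ => rfl⟩, ?_⟩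
  · refine hS.sub (AnalyticAt.comp (f := fun x : Triple => (x.1, S x)) ?_ h3)
    rw [h30]
    exact hφ
  · filter_upwards [h2] with x hx
    rw [hx]

theorem IsReflection.eq_self_of_zero {φ T : Triple → ℂ} (hT : IsReflection φ T)
    {E : Type*} [TopologicalSpace E] [Zero E] {j : E → Triple} (hj : Tendsto j (𝓝 0) (𝓝 0))
    (h : ∀ᶠ x in 𝓝 0, φ (j x) = 0) : ∀ᶠ x in 𝓝 0, T (j x) = (j x).2 := by
  filter_upwards [h, hj.eventually hT.param] with x h1 h2
  rw [h1, add_zero, sub_zero] at h2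
  exact h2

theorem segre_identity {φ φ' : ℂ × ℂ × ℂ → ℂ} (hφ : IsNormalGraphFunction φ)
    (hφ' : IsNormalGraphFunction φ') {T Q : Triple → ℂ}
    (hT : IsReflection (fun x => Complex.I * φ (x.1.1, x.1.2, x.2)) T)
    (hQ : IsReflection (fun x => -(Complex.I * φ' (x.1.1, x.1.2, x.2))) Q)
    {H : ℂ × ℂ → ℂ × ℂ} (hH : AnalyticAt ℂ H 0) (hH0 : H 0 = 0)
    (hs : ∀ᶠ x in 𝓝 0, OnGraph φ x → OnGraph φ' (H x)) :
    ∀ᶠ x : Triple in 𝓝 0, component 1 H (x.1.1, x.2) =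
      Q ((component 0 H (x.1.1, x.2), conjFun (component 0 H) (x.1.2, T x)),
        conjFun (component 1 H) (x.1.2, T x)) := by
  have hF := analyticAt_component hH 0
  have hG := analyticAt_component hH 1
  have hF0 : component 0 H 0 = 0 := by
    change coord 0 (H 0) = 0
    rw [hH0]; rfl
  have hG0 : component 1 H 0 = 0 := by
    change coord 1 (H 0) = 0
    rw [hH0]; rfl
  set F := component 0 H with hFdef
  set G := component 1 H with hGdef
  have hF'0 : conjFun F 0 = 0 := by
    change conj (F (conj 0, conj 0)) = 0
    rw [map_zero]
    exact (congrArg conj hF0).trans (map_zero _)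
  have hG'0 : conjFun G 0 = 0 := by
    change conj (G (conj 0, conj 0)) = 0
    rw [map_zero]
    exact (congrArg conj hG0).trans (map_zero _)
  have hF' := analyticAt_conjFun hF
  have hG' := analyticAt_conjFun hG
  have hφ0 : φ 0 = 0 := hφ.normal_left.self_of_nhds
  let A : AnFam Unit Triple := ⟨fun _ x => φ (x.1.1, x.1.2, x.2), fun _ =>
    AnalyticAt.comp (f := fun x : Triple => (x.1.1, x.1.2, x.2)) (x := 0) hφ.analytic
      ((analyticAt_fst.comp analyticAt_fst).prod
        ((analyticAt_snd.comp analyticAt_fst).prod analyticAt_snd))⟩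
  let W : VanFam Unit Triple ℂ := ⟨fun _ x => x.2 + Complex.I * φ (x.1.1, x.1.2, x.2),
    fun _ => analyticAt_snd.add (analyticAt_const.mul (A.2 ())), fun _ => by
      change (0 : ℂ) + Complex.I * φ 0 = 0
      rw [hφ0]; simp⟩
  let W' : VanFam Unit Triple ℂ := ⟨fun _ x => x.2 - Complex.I * φ (x.1.1, x.1.2, x.2),
    fun _ => analyticAt_snd.sub (analyticAt_const.mul (A.2 ())), fun _ => by
      change (0 : ℂ) - Complex.I * φ 0 = 0
      rw [hφ0]; simp⟩
  let Fh : Triple → ℂ := fun x => F (x.1.1, W.toFun () x)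
  let Gh : Triple → ℂ := fun x => G (x.1.1, W.toFun () x)
  let Fc : Triple → ℂ := fun x => conjFun F (x.1.2, W'.toFun () x)
  let Gc : Triple → ℂ := fun x => conjFun G (x.1.2, W'.toFun () x)
  have hFh : AnalyticAt ℂ Fh 0 := VanFam.analyticAt_comp hF ((coordZ Unit).pair W) ()
  have hGh : AnalyticAt ℂ Gh 0 := VanFam.analyticAt_comp hG ((coordZ Unit).pair W) ()
  have hFc : AnalyticAt ℂ Fc 0 := VanFam.analyticAt_comp hF' ((coordX Unit).pair W') ()
  have hGc : AnalyticAt ℂ Gc 0 := VanFam.analyticAt_comp hG' ((coordX Unit).pair W') ()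
  have hW0 : W.toFun () 0 = 0 := W.map_zero ()
  have hW'0 : W'.toFun () 0 = 0 := W'.map_zero ()
  have hFh0 : Fh 0 = 0 := by
    change F ((0 : ℂ), W.toFun () 0) = 0
    rw [hW0]; exact hF0
  have hGh0 : Gh 0 = 0 := by
    change G ((0 : ℂ), W.toFun () 0) = 0
    rw [hW0]; exact hG0
  have hFc0 : Fc 0 = 0 := by
    change conjFun F ((0 : ℂ), W'.toFun () 0) = 0
    rw [hW'0]; exact hF'0
  have hGc0 : Gc 0 = 0 := by
    change conjFun G ((0 : ℂ), W'.toFun () 0) = 0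
    rw [hW'0]; exact hG'0
  have harg : AnalyticAt ℂ (fun x => (Fh x, Fc x, (Gh x + Gc x) / 2)) 0 :=
    hFh.prod (hFc.prod ((hGh.add hGc).div_const))
  have harg0 : (Fh 0, Fc 0, (Gh 0 + Gc 0) / 2) = 0 := by
    simp [hFh0, hGh0, hFc0, hGc0]
  have hΞ : AnalyticAt ℂ (fun x => (Gh x - Gc x) / (2 * Complex.I) -
      φ' (Fh x, Fc x, (Gh x + Gc x) / 2)) 0 := by
    refine (hGh.sub hGc).div_const.sub ?_
    refine AnalyticAt.comp (f := fun x => (Fh x, Fc x, (Gh x + Gc x) / 2)) ?_ harg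
    rw [harg0]
    exact hφ'.analytic
  have hzero := eventually_zero_of_totallyReal hΞ (by
    have hc : Tendsto (fun p : ℂ × ℝ => ((p.1, W.toFun () ((p.1, conj p.1), (p.2 : ℂ))) : ℂ × ℂ))
        (𝓝 0) (𝓝 0) := by
      have h1 : Continuous (fun p : ℂ × ℝ => (((p.1, conj p.1), (p.2 : ℂ)) : Triple)) := by
        fun_prop
      have h2 : Tendsto (fun p : ℂ × ℝ => (((p.1, conj p.1), (p.2 : ℂ)) : Triple)) (𝓝 0) (𝓝 0) := by
        exact h1.tendsto' 0 0 (by simp)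
      have h3 : Tendsto (W.toFun ()) (𝓝 0) (𝓝 0) := by
        have := (W.analytic ()).continuousAt.tendsto
        rwa [hW0] at this
      exact (continuous_fst.tendsto' 0 0 rfl).prodMk_nhds (h3.comp h2)
    filter_upwards [hφ.real_valued, hc.eventually hs] with p hp hsp
    obtain ⟨t, ht⟩ : ∃ t : ℝ, φ (p.1, conj p.1, (p.2 : ℂ)) = t :=
      ⟨(φ (p.1, conj p.1, (p.2 : ℂ))).re, Complex.ext (by simp) (by rw [hp]; simp)⟩
    have hWp : W.toFun () ((p.1, conj p.1), (p.2 : ℂ)) = p.2 + Complex.I * t := by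
      change (p.2 : ℂ) + Complex.I * φ (p.1, conj p.1, (p.2 : ℂ)) = _
      rw [ht]
    have hW'p : W'.toFun () ((p.1, conj p.1), (p.2 : ℂ)) = conj (p.2 + Complex.I * t : ℂ) := by
      change (p.2 : ℂ) - Complex.I * φ (p.1, conj p.1, (p.2 : ℂ)) = _
      rw [ht]
      simp
      ring
    have hgr : OnGraph φ (p.1, (p.2 : ℂ) + Complex.I * t) := by
      simp [OnGraph, ht]
    rw [hWp] at hsp
    have h1 := hsp hgr
    set y := H (p.1, (p.2 : ℂ) + Complex.I * t) with hy
    have e1 : Fh ((p.1, conj p.1), (p.2 : ℂ)) = y.1 := by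
      change F (p.1, _) = _
      rw [hWp]; rfl
    have e2 : Gh ((p.1, conj p.1), (p.2 : ℂ)) = y.2 := by
      change G (p.1, _) = _
      rw [hWp]; rfl
    have e3 : Fc ((p.1, conj p.1), (p.2 : ℂ)) = conj y.1 := by
      change conjFun F (conj p.1, _) = _
      rw [hW'p, conjFun, Complex.conj_conj, Complex.conj_conj]; rfl
    have e4 : Gc ((p.1, conj p.1), (p.2 : ℂ)) = conj y.2 := by
      change conjFun G (conj p.1, _) = _
      rw [hW'p, conjFun, Complex.conj_conj, Complex.conj_conj]; rfl
    simp only [e1, e2, e3, e4]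
    have e5 : (y.2 + conj y.2) / 2 = (y.2.re : ℂ) := by
      rw [Complex.add_conj]; push_cast; ring
    have e6 : (y.2 - conj y.2) / (2 * Complex.I) = (y.2.im : ℂ) := by
      rw [Complex.sub_conj]
      have := Complex.I_ne_zero
      push_cast
      field_simp
    rw [e5, e6, h1]
    exact sub_self _)
  obtain ⟨S, hS, hS0, hS1, hS2⟩ := hT.exists_param
  have hSt : Tendsto (fun x : Triple => ((x.1, S x) : Triple)) (𝓝 0) (𝓝 0) := by
    have := (analyticAt_fst.prod hS : AnalyticAt ℂ (fun x : Triple => (x.1, S x)) 0).continuousAt.tendsto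
    simp only [hS0] at this
    exact this
  have hQt : Tendsto (fun x : Triple => (((Fh x, Fc x), (Gh x + Gc x) / 2) : Triple)) (𝓝 0) (𝓝 0) := by
    have := ((hFh.prod hFc).prod ((hGh.add hGc).div_const (c := (2 : ℂ)))).continuousAt.tendsto
    simp only [Pi.add_apply, hFh0, hGh0, hFc0, hGc0, add_zero, zero_div] at this
    exact this
  filter_upwards [hSt.eventually hzero, hS1, hS2, hSt.eventually (hQt.eventually hQ.param)] with
    x h1 h2 h3 h4
  have w1 : W.toFun () (x.1, S x) = x.2 := h2
  have w2 : W'.toFun () (x.1, S x) = T x := h3.symm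
  have e1 : Fh (x.1, S x) = F (x.1.1, x.2) := by simp only [Fh, w1]
  have e2 : Gh (x.1, S x) = G (x.1.1, x.2) := by simp only [Gh, w1]
  have e3 : Fc (x.1, S x) = conjFun F (x.1.2, T x) := by simp only [Fc, w2]
  have e4 : Gc (x.1, S x) = conjFun G (x.1.2, T x) := by simp only [Gc, w2]
  simp only [e1, e2, e3, e4] at h1 h4
  have hI := Complex.I_ne_zero
  have h5 : Complex.I * φ' (F (x.1.1, x.2), conjFun F (x.1.2, T x),
      (G (x.1.1, x.2) + conjFun G (x.1.2, T x)) / 2) =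
      (G (x.1.1, x.2) - conjFun G (x.1.2, T x)) / 2 := by
    rw [← sub_eq_zero.1 h1]
    field_simp
  rw [h5] at h4
  have a1 : (G (x.1.1, x.2) + conjFun G (x.1.2, T x)) / 2 +
      -((G (x.1.1, x.2) - conjFun G (x.1.2, T x)) / 2) = conjFun G (x.1.2, T x) := by ring
  have a2 : (G (x.1.1, x.2) + conjFun G (x.1.2, T x)) / 2 -
      -((G (x.1.1, x.2) - conjFun G (x.1.2, T x)) / 2) = G (x.1.1, x.2) := by ring
  rw [a1, a2] at h4
  exact h4.symm

end SegreIdentity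

section Biholomorphic

theorem IsBiholomorphic.analyticAt {e : OpenPartialHomeomorph (ℂ × ℂ) (ℂ × ℂ)}
    (he : IsBiholomorphic e) {x : ℂ × ℂ} (hx : x ∈ e.source) : AnalyticAt ℂ e x := by
  have h1 : ∀ᶠ y in 𝓝 x, DifferentiableAt ℂ e y := by
    filter_upwards [e.open_source.mem_nhds hx] with y hy
    exact he.1.differentiableAt (e.open_source.mem_nhds hy)
  have h2 : AnalyticAt ℂ (fun y => (e y).1) (x.1, x.2) :=
    analyticAt_of_differentiable_prod (h1.mono fun y hy => hy.fst)
  have h3 : AnalyticAt ℂ (fun y => (e y).2) (x.1, x.2) :=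
    analyticAt_of_differentiable_prod (h1.mono fun y hy => hy.snd)
  exact h2.prod h3

/-- The derivative of a biholomorphic map is invertible. -/
theorem IsBiholomorphic.exists_inverse_fderiv {e : OpenPartialHomeomorph (ℂ × ℂ) (ℂ × ℂ)}
    (he : IsBiholomorphic e) {x : ℂ × ℂ} (hx : x ∈ e.source) :
    ∃ L : ℂ × ℂ →L[ℂ] ℂ × ℂ, (∀ v, fderiv ℂ e x (L v) = v) ∧ ∀ v, L (fderiv ℂ e x v) = v := by
  have h1 : DifferentiableAt ℂ e x := (he.analyticAt hx).differentiableAt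
  have hy := e.map_source hx
  have h2 : DifferentiableAt ℂ e.symm (e x) := he.2.differentiableAt (e.open_target.mem_nhds hy)
  have h1' : HasFDerivAt e (fderiv ℂ e x) (e.symm (e x)) := by
    rw [e.left_inv hx]
    exact h1.hasFDerivAt
  have h3 := h1'.comp (e x) h2.hasFDerivAt
  have h4 := h2.hasFDerivAt.comp x h1.hasFDerivAt
  have h5 : HasFDerivAt (e ∘ e.symm) (ContinuousLinearMap.id ℂ (ℂ × ℂ)) (e x) := by
    refine (hasFDerivAt_id _).congr_of_eventuallyEq ?_
    filter_upwards [e.open_target.mem_nhds hy] with y hy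
    exact e.right_inv hy
  have h6 : HasFDerivAt (e.symm ∘ e) (ContinuousLinearMap.id ℂ (ℂ × ℂ)) x := by
    refine (hasFDerivAt_id _).congr_of_eventuallyEq ?_
    filter_upwards [e.open_source.mem_nhds hx] with y hy
    exact e.left_inv hy
  exact ⟨fderiv ℂ e.symm (e x), fun v => DFunLike.congr_fun (h3.unique h5) v,
    fun v => DFunLike.congr_fun (h4.unique h6) v⟩

theorem IsLocalBiholomorphism.analyticAt {H : ℂ × ℂ → ℂ × ℂ} (hH : IsLocalBiholomorphism H) :
    AnalyticAt ℂ H 0 := by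
  obtain ⟨_, e, h0, he, heq⟩ := hH
  exact (he.analyticAt h0).congr heq.symm

theorem partialDeriv_one_zero {H : ℂ × ℂ → ℂ × ℂ} (hH : AnalyticAt ℂ H 0) :
    partialDeriv 1 0 H 0 = fderiv ℂ H 0 (1, 0) := by
  have h1 : HasDerivAt (fun z : ℂ => (z, (0 : ℂ))) (1, 0) 0 :=
    (hasDerivAt_id (0 : ℂ)).prodMk (hasDerivAt_const _ _)
  have h2 := HasFDerivAt.comp_hasDerivAt (f := fun z : ℂ => (z, (0 : ℂ))) (0 : ℂ)
    hH.differentiableAt.hasFDerivAt h1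
  simp only [partialDeriv, iteratedDeriv_one, iteratedDeriv_zero]
  exact h2.deriv

theorem partialDeriv_zero_one {H : ℂ × ℂ → ℂ × ℂ} (hH : AnalyticAt ℂ H 0) :
    partialDeriv 0 1 H 0 = fderiv ℂ H 0 (0, 1) := by
  have h1 : HasDerivAt (fun z : ℂ => ((0 : ℂ), z)) (0, 1) 0 :=
    (hasDerivAt_const _ _).prodMk (hasDerivAt_id (0 : ℂ))
  have h2 := HasFDerivAt.comp_hasDerivAt (f := fun z : ℂ => ((0 : ℂ), z)) (0 : ℂ)
    hH.differentiableAt.hasFDerivAt h1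
  simp only [partialDeriv, iteratedDeriv_one, iteratedDeriv_zero]
  exact h2.deriv

theorem jacobian_mem_invUpperTriangular {H : ℂ × ℂ → ℂ × ℂ} (hH : IsLocalBiholomorphism H)
    (hG : ∀ᶠ z : ℂ in 𝓝 0, (H (z, 0)).2 = 0) : jacobian H ∈ invUpperTriangular := by
  have ha := hH.analyticAt
  obtain ⟨_, e, h0, he, heq⟩ := hH
  obtain ⟨L, hL1, hL2⟩ := he.exists_inverse_fderiv h0
  rw [← heq.fderiv_eq] at hL1 hL2
  set D := fderiv ℂ H 0 with hD
  have hG0 : (D (1, 0)).2 = 0 := by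
    have h1 : HasDerivAt (fun z : ℂ => (z, (0 : ℂ))) (1, 0) 0 :=
      (hasDerivAt_id (0 : ℂ)).prodMk (hasDerivAt_const _ _)
    have h2 := HasFDerivAt.comp_hasDerivAt (f := fun z : ℂ => (z, (0 : ℂ))) (0 : ℂ)
      ha.differentiableAt.hasFDerivAt h1
    have h3 : HasDerivAt (fun z : ℂ => (H (z, 0)).2) (D (1, 0)).2 0 :=
      (ContinuousLinearMap.snd ℂ ℂ ℂ).hasFDerivAt.comp_hasDerivAt (0 : ℂ) h2
    exact h3.unique ((hasDerivAt_const (0 : ℂ) (0 : ℂ)).congr_of_eventuallyEq hG)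
  have e10 : jacobian H 1 0 = (D (1, 0)).2 := congrArg Prod.snd (partialDeriv_one_zero ha)
  have e00 : jacobian H 0 0 = (D (1, 0)).1 := congrArg Prod.fst (partialDeriv_one_zero ha)
  have e11 : jacobian H 1 1 = (D (0, 1)).2 := congrArg Prod.snd (partialDeriv_zero_one ha)
  refine ⟨by rw [e10, hG0], fun h => ?_, fun h => ?_⟩
  · rw [e00] at h
    have h1 : D (1, 0) = 0 := Prod.ext h hG0
    have h2 := hL2 (1, 0)
    rw [h1, map_zero] at h2
    simpa using congrArg Prod.fst h2
  · rw [e11] at h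
    have h1 := hL1 (0, 1)
    set v := L (0, 1)
    have h2 : v = v.1 • ((1 : ℂ), (0 : ℂ)) + v.2 • ((0 : ℂ), (1 : ℂ)) := by
      refine Prod.ext ?_ ?_ <;> simp
    rw [h2, map_add, map_smul, map_smul] at h1
    have h3 := congrArg Prod.snd h1
    simp [hG0, h] at h3

end Biholomorphic

section LeviFlat

theorem wirtingerBar_im {f : ℂ × ℂ → ℂ} {x : ℂ × ℂ} (hf : DifferentiableAt ℂ f x) (j : Fin 2) :
    wirtingerBar j (fun y => (((f y).im : ℝ) : ℂ)) x =
      Complex.I / 2 * conj (fderiv ℂ f x (stdVec j)) := by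
  have h1 : HasFDerivAt (fun y => (((f y).im : ℝ) : ℂ))
      ((Complex.ofRealCLM.comp Complex.imCLM).comp ((fderiv ℂ f x).restrictScalars ℝ)) x :=
    ((Complex.ofRealCLM.comp Complex.imCLM).hasFDerivAt).comp x
      (hf.hasFDerivAt.restrictScalars ℝ)
  rw [wirtingerBar, h1.fderiv]
  simp only [ContinuousLinearMap.comp_apply, ContinuousLinearMap.coe_restrictScalars', map_smul,
    Complex.ofRealCLM_apply, Complex.imCLM_apply]
  apply Complex.ext <;> simp <;> ring

theorem wirtinger_conj {h : ℂ × ℂ → ℂ} {x : ℂ × ℂ} (hh : DifferentiableAt ℂ h x) (k : Fin 2) :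
    wirtinger k (fun y => Complex.I / 2 * conj (h y)) x = 0 := by
  have h1 : HasFDerivAt (fun y => Complex.I / 2 * conj (h y))
      ((Complex.I / 2) • ((Complex.conjCLE : ℂ →L[ℝ] ℂ).comp
        ((fderiv ℂ h x).restrictScalars ℝ))) x :=
    ((Complex.conjCLE : ℂ →L[ℝ] ℂ).hasFDerivAt.comp x
      (hh.hasFDerivAt.restrictScalars ℝ)).const_mul (Complex.I / 2)
  rw [wirtinger, h1.fderiv]
  simp only [smul_apply, ContinuousLinearMap.comp_apply,
    ContinuousLinearMap.coe_restrictScalars', map_smul, smul_eq_mul]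
  simp
  linear_combination (Complex.I / 2 * conj ((fderiv ℂ h x) (stdVec k))) * Complex.I_sq

theorem isLeviFlatNear_of_eventually_zero {M : Set (ℂ × ℂ)} {p : ℂ × ℂ}
    {Z : OpenPartialHomeomorph (ℂ × ℂ) (ℂ × ℂ)} (hp : p ∈ Z.source) (h0 : Z p = 0)
    (hZ : IsBiholomorphic Z) {φ : ℂ × ℂ × ℂ → ℂ}
    (hM : ∀ᶠ q in 𝓝 p, q ∈ M ↔ OnGraph φ (Z q)) (hφ : ∀ᶠ x in 𝓝 0, φ x = 0) :
    IsLeviFlatNear M p := by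
  let f : ℂ × ℂ → ℂ := fun q => (Z q).2
  have hf : ∀ q ∈ Z.source, AnalyticAt ℂ f q := fun q hq =>
    AnalyticAt.comp (g := fun y : ℂ × ℂ => y.2) analyticAt_snd (hZ.analyticAt hq)
  refine ⟨fun q => (f q).im, ⟨?_, ?_, ?_⟩, ?_⟩
  · exact (Complex.imCLM.analyticAt _).comp (hf p hp).restrictScalars
  · intro hd
    have h1 : HasFDerivAt (fun q => (f q).im)
        (Complex.imCLM.comp ((fderiv ℂ f p).restrictScalars ℝ)) p :=
      Complex.imCLM.hasFDerivAt.comp p ((hf p hp).differentiableAt.hasFDerivAt.restrictScalars ℝ)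
    rw [h1.fderiv] at hd
    obtain ⟨L, hL, -⟩ := hZ.exists_inverse_fderiv hp
    have h2 : fderiv ℂ f p (L (0, Complex.I)) = Complex.I := by
      have h3 : HasFDerivAt f ((ContinuousLinearMap.snd ℂ ℂ ℂ).comp (fderiv ℂ Z p)) p :=
        (ContinuousLinearMap.snd ℂ ℂ ℂ).hasFDerivAt.comp p
          (hZ.analyticAt hp).differentiableAt.hasFDerivAt
      rw [h3.fderiv, ContinuousLinearMap.comp_apply, hL]
      rfl
    have h3 := DFunLike.congr_fun hd (L (0, Complex.I))
    change (fderiv ℂ f p (L (0, Complex.I))).im = 0 at h3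
    rw [h2] at h3
    simp at h3
  · have hc : Tendsto (fun q => (((Z q).1, conj (Z q).1, ((Z q).2.re : ℂ)) : ℂ × ℂ × ℂ))
        (𝓝 p) (𝓝 0) := by
      have h1 : Tendsto Z (𝓝 p) (𝓝 0) := by
        have := (hZ.analyticAt hp).continuousAt.tendsto
        rwa [h0] at this
      have h2 : Continuous (fun x : ℂ × ℂ => ((x.1, conj x.1, (x.2.re : ℂ)) : ℂ × ℂ × ℂ)) := by
        fun_prop
      exact (h2.tendsto' 0 0 (by simp)).comp h1
    filter_upwards [hM, hc.eventually hφ] with q h1 h2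
    rw [h1, OnGraph, h2]
    exact Complex.ofReal_eq_zero
  · filter_upwards [Z.open_source.mem_nhds hp] with q hq _ ξ _
    have h1 : ∀ k j, wirtinger k (wirtingerBar j (fun x => (((f x).im : ℝ) : ℂ))) q = 0 := by
      intro k j
      have h2 : wirtingerBar j (fun x => (((f x).im : ℝ) : ℂ)) =ᶠ[𝓝 q]
          fun y => Complex.I / 2 * conj (fderiv ℂ f y (stdVec j)) := by
        filter_upwards [Z.open_source.mem_nhds hq] with y hy
        exact wirtingerBar_im (hf y hy).differentiableAt j
      have h3 : DifferentiableAt ℂ (fun y => fderiv ℂ f y (stdVec j)) q :=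
        (hf q hq).fderiv.differentiableAt.clm_apply (differentiableAt_const _)
      rw [← wirtinger_conj h3 k, wirtinger, wirtinger, h2.fderiv_eq]
    simp only [leviForm, h1, zero_mul, Finset.sum_const_zero]

end LeviFlat

section Cancellation

variable {E : Type*} [NormedAddCommGroup E] [NormedSpace ℂ E]

theorem eventually_eq_of_pow_mul_eq {f g : E × ℂ → ℂ} {m : ℕ} (hf : AnalyticAt ℂ f 0)
    (hg : AnalyticAt ℂ g 0) (h : ∀ᶠ x in 𝓝 0, x.2 ^ m * f x = x.2 ^ m * g x) :
    ∀ᶠ x in 𝓝 0, f x = g x := by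
  filter_upwards [hf.eventually_analyticAt, hg.eventually_analyticAt, h.eventually_nhds] with
    x h1 h2 h3
  have hc : Tendsto (fun t : ℂ => (x.1, x.2 + t)) (𝓝[≠] 0) (𝓝 x) := by
    have : Continuous (fun t : ℂ => (x.1, x.2 + t)) := by fun_prop
    exact (this.tendsto' 0 x (by simp)).mono_left nhdsWithin_le_nhds
  have hne : ∀ᶠ t : ℂ in 𝓝[≠] 0, x.2 + t ≠ 0 := by
    by_cases hx : x.2 = 0
    · filter_upwards [self_mem_nhdsWithin] with t ht
      simpa [hx] using ht
    · have : Tendsto (fun t : ℂ => x.2 + t) (𝓝 0) (𝓝 x.2) :=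
        (continuous_const.add continuous_id).tendsto' 0 _ (by simp)
      exact (this.mono_left nhdsWithin_le_nhds).eventually (eventually_ne_nhds hx)
  refine tendsto_nhds_unique (h1.continuousAt.tendsto.comp hc)
    ((h2.continuousAt.tendsto.comp hc).congr' ?_)
  filter_upwards [hc.eventually h3, hne] with t h4 h5
  exact (mul_left_cancel₀ (pow_ne_zero m h5) h4).symm

theorem ncoef_const_zero (j : ℕ) : ncoef j (fun _ => 0) = 0 :=
  ncoef_eq_of_eventually (N := j + 1) (a := fun _ => 0) (r := fun _ => 0) analyticAt_const
    continuousAt_const (Eventually.of_forall fun w => by simp) j (by omega)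

theorem ncoef_eq_zero {g : ℂ → ℂ} (h : ∀ᶠ w in 𝓝 0, g w = 0) (j : ℕ) : ncoef j g = 0 :=
  (ncoef_congr h j).trans (ncoef_const_zero j)

end Cancellation

section ReflectionForm

/-- `T = w + w ^ m (χ ^ β a (z, χ) + χ w b (z, χ, w))`. -/
structure ReflectionForm (m β : ℕ) (T : Triple → ℂ) (a : ℂ × ℂ → ℂ) (b : Triple → ℂ) : Prop where
  analytic_fst : AnalyticAt ℂ a 0
  analytic_snd : AnalyticAt ℂ b 0
  map_zero : a 0 = 0
  eq : ∀ᶠ x in 𝓝 0, T x = x.2 + x.2 ^ m * (x.1.2 ^ β * a x.1 + x.1.2 * x.2 * b x)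

theorem exists_reflectionForm {T : Triple → ℂ} (hT : AnalyticAt ℂ T 0) {m β : ℕ} (hβ : β ≠ 0)
    (hX : ∀ᶠ y : ℂ × ℂ in 𝓝 0, T ((y.1, 0), y.2) = y.2)
    (hZ : ∀ᶠ y : ℂ × ℂ in 𝓝 0, T ((0, y.1), y.2) = y.2)
    (hm : ∀ j < m, ∀ᶠ e in 𝓝 0, tcoef j (fun x => T x - x.2) e = 0)
    (hmβ : ∀ j < β, ∀ᶠ z in 𝓝 0, tcoef j (tcoef m (fun x => T x - x.2)) z = 0) :
    ∃ a b, ReflectionForm m β T a b ∧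
      ∀ z, a (z, 0) = tcoef β (tcoef m (fun x => T x - x.2)) z := by
  set D : Triple → ℂ := fun x => T x - x.2 with hDdef
  have hD : AnalyticAt ℂ D 0 := hT.sub analyticAt_snd
  have hA : AnalyticAt ℂ (tcoef m D) 0 := analyticAt_tcoef (e := (0 : ℂ × ℂ)) hD m
  have ha : AnalyticAt ℂ (dquot β (tcoef m D)) 0 := analyticAt_dquot (e := (0 : ℂ)) hA β
  have hB : AnalyticAt ℂ (dquot (m + 1) D) 0 := analyticAt_dquot (e := (0 : ℂ × ℂ)) hD (m + 1)
  have hAeq : ∀ᶠ e in 𝓝 0, tcoef m D e = e.2 ^ β * dquot β (tcoef m D) e := by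
    have hall : ∀ᶠ z in 𝓝 (0 : ℂ), ∀ j ∈ Finset.range β, tcoef j (tcoef m D) z = 0 :=
      (Finset.eventually_all _).2 fun j hj => hmβ j (Finset.mem_range.1 hj)
    filter_upwards [(continuous_fst.tendsto' (0 : ℂ × ℂ) 0 rfl).eventually hall] with e he
    have := eq_sum_tcoef (tcoef m D) β e.1 e.2
    rwa [Finset.sum_eq_zero fun j hj => by rw [he j hj, zero_mul], zero_add] at this
  have hDeq : ∀ᶠ x in 𝓝 0, D x = tcoef m D x.1 * x.2 ^ m + x.2 ^ (m + 1) * dquot (m + 1) D x := by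
    have hall : ∀ᶠ e in 𝓝 (0 : ℂ × ℂ), ∀ j ∈ Finset.range m, tcoef j D e = 0 :=
      (Finset.eventually_all _).2 fun j hj => hm j (Finset.mem_range.1 hj)
    filter_upwards [(continuous_fst.tendsto' (0 : Triple) 0 rfl).eventually hall] with x hx
    have := eq_sum_tcoef D (m + 1) x.1 x.2
    rwa [Finset.sum_range_succ, Finset.sum_eq_zero fun j hj => by rw [hx j hj, zero_mul],
      zero_add] at this
  have hBX : ∀ᶠ y : ℂ × ℂ in 𝓝 0, dquot (m + 1) D ((y.1, 0), y.2) = 0 := by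
    have hc : Tendsto (fun y : ℂ × ℂ => (((y.1, 0), y.2) : Triple)) (𝓝 0) (𝓝 0) :=
      (show Continuous (fun y : ℂ × ℂ => (((y.1, 0), y.2) : Triple)) by fun_prop).tendsto' 0 0 rfl
    have hc1 : Tendsto (fun y : ℂ × ℂ => ((y.1, 0) : ℂ × ℂ)) (𝓝 0) (𝓝 0) :=
      (show Continuous (fun y : ℂ × ℂ => ((y.1, 0) : ℂ × ℂ)) by fun_prop).tendsto' 0 0 rfl
    refine eventually_eq_of_pow_mul_eq (m := m + 1) (g := fun _ => 0) ?_ analyticAt_const ?_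
    · exact AnalyticAt.comp (f := fun y : ℂ × ℂ => (((y.1, 0), y.2) : Triple)) (x := 0) hB
        ((analyticAt_fst.prod analyticAt_const).prod analyticAt_snd)
    · filter_upwards [hX, hc.eventually hDeq, hc1.eventually hAeq] with y h1 h2 h3
      rw [h3] at h2
      simp only [hDdef, h1, sub_self, zero_pow hβ, zero_mul, zero_add] at h2
      rw [← h2, mul_zero]
  let f : (ℂ × ℂ) × ℂ → ℂ := fun y => dquot (m + 1) D ((y.1.1, y.2), y.1.2)
  have hsw : AnalyticAt ℂ (fun y : (ℂ × ℂ) × ℂ => (((y.1.1, y.2), y.1.2) : Triple)) 0 :=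
    ((analyticAt_fst.comp analyticAt_fst).prod analyticAt_snd).prod
      (analyticAt_snd.comp analyticAt_fst)
  have hf : AnalyticAt ℂ f 0 :=
    AnalyticAt.comp (f := fun y : (ℂ × ℂ) × ℂ => (((y.1.1, y.2), y.1.2) : Triple)) (x := 0) hB hsw
  refine ⟨dquot β (tcoef m D), fun x => dquot 1 f ((x.1.1, x.2), x.1.2), ⟨ha, ?_, ?_, ?_⟩,
    fun z => rfl⟩
  · exact AnalyticAt.comp (f := fun y : (ℂ × ℂ) × ℂ => (((y.1.1, y.2), y.1.2) : Triple)) (x := 0)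
      (analyticAt_dquot (e := (0 : ℂ × ℂ)) hf 1) hsw
  · change tcoef β (tcoef m D) 0 = 0
    refine ncoef_eq_zero ?_ β
    have h1 : ∀ᶠ χ in 𝓝 (0 : ℂ), ∀ᶠ w in 𝓝 (0 : ℂ), T ((0, χ), w) = w := eventually_curry_last hZ
    filter_upwards [h1] with χ hχ
    refine ncoef_eq_zero ?_ m
    filter_upwards [hχ] with w hw
    simp only [hDdef, hw, sub_self]
  · have hc : Tendsto (fun x : Triple => ((x.1.1, x.2) : ℂ × ℂ)) (𝓝 0) (𝓝 0) :=
      (show Continuous (fun x : Triple => ((x.1.1, x.2) : ℂ × ℂ)) by fun_prop).tendsto' 0 0 rfl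
    filter_upwards [hDeq, (continuous_fst.tendsto' (0 : Triple) 0 rfl).eventually hAeq,
      hc.eventually hBX] with x h1 h2 h3
    have h4 := eq_sum_tcoef f 1 (x.1.1, x.2) x.1.2
    rw [Finset.sum_range_one, pow_zero, mul_one, pow_one] at h4
    have h5 : tcoef 0 f (x.1.1, x.2) = 0 := h3
    rw [h5, zero_add] at h4
    change dquot (m + 1) D x = _ at h4
    rw [h4, h2] at h1
    have h6 : T x = D x + x.2 := by simp [hDdef]
    rw [h6, h1]
    ring

theorem exists_reflectionForms {T Q : Triple → ℂ} (hT : AnalyticAt ℂ T 0) (hQ : AnalyticAt ℂ Q 0)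
    (hTX : ∀ᶠ y : ℂ × ℂ in 𝓝 0, T ((y.1, 0), y.2) = y.2)
    (hTZ : ∀ᶠ y : ℂ × ℂ in 𝓝 0, T ((0, y.1), y.2) = y.2)
    (hQX : ∀ᶠ y : ℂ × ℂ in 𝓝 0, Q ((y.1, 0), y.2) = y.2)
    (hQZ : ∀ᶠ y : ℂ × ℂ in 𝓝 0, Q ((0, y.1), y.2) = y.2)
    (hne : ¬ ∀ᶠ x in 𝓝 0, Q x = x.2) :
    ∃ m β a b a' b', β ≠ 0 ∧ ReflectionForm m β T a b ∧ ReflectionForm m β Q a' b' ∧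
      ¬ ((∀ᶠ z in 𝓝 0, a (z, 0) = 0) ∧ ∀ᶠ z in 𝓝 0, a' (z, 0) = 0) := by
  classical
  set D : Triple → ℂ := fun x => T x - x.2 with hDdef
  set D' : Triple → ℂ := fun x => Q x - x.2 with hD'def
  have hD : AnalyticAt ℂ D 0 := hT.sub analyticAt_snd
  have hD' : AnalyticAt ℂ D' 0 := hQ.sub analyticAt_snd
  have h1 : ∃ j, ¬ ((∀ᶠ e in 𝓝 0, tcoef j D e = 0) ∧ ∀ᶠ e in 𝓝 0, tcoef j D' e = 0) := by
    obtain ⟨j, hj⟩ := exists_tcoef_ne_zero hD' fun h => hne (h.mono fun x hx => sub_eq_zero.1 hx)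
    exact ⟨j, fun h => hj h.2⟩
  set m := Nat.find h1 with hm
  have hm1 := Nat.find_spec h1
  have hm2 : ∀ j < m, (∀ᶠ e in 𝓝 0, tcoef j D e = 0) ∧ ∀ᶠ e in 𝓝 0, tcoef j D' e = 0 :=
    fun j hj => not_not.1 (Nat.find_min h1 hj)
  have hA : AnalyticAt ℂ (tcoef m D) 0 := analyticAt_tcoef (e := (0 : ℂ × ℂ)) hD m
  have hA' : AnalyticAt ℂ (tcoef m D') 0 := analyticAt_tcoef (e := (0 : ℂ × ℂ)) hD' m
  have h2 : ∃ j, ¬ ((∀ᶠ z in 𝓝 0, tcoef j (tcoef m D) z = 0) ∧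
      ∀ᶠ z in 𝓝 0, tcoef j (tcoef m D') z = 0) := by
    by_contra hcon
    push Not at hcon
    refine hm1 ⟨?_, ?_⟩
    · by_contra h
      obtain ⟨j, hj⟩ := exists_tcoef_ne_zero hA h
      exact hj (hcon j).1
    · by_contra h
      obtain ⟨j, hj⟩ := exists_tcoef_ne_zero hA' h
      exact hj (hcon j).2
  set β := Nat.find h2 with hβ
  have hb1 := Nat.find_spec h2
  have hb2 : ∀ j < β, (∀ᶠ z in 𝓝 0, tcoef j (tcoef m D) z = 0) ∧
      ∀ᶠ z in 𝓝 0, tcoef j (tcoef m D') z = 0 :=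
    fun j hj => not_not.1 (Nat.find_min h2 hj)
  have hzero : ∀ {P : Triple → ℂ}, (∀ᶠ y : ℂ × ℂ in 𝓝 0, P ((y.1, 0), y.2) = y.2) →
      ∀ᶠ z in 𝓝 0, tcoef 0 (tcoef m (fun x => P x - x.2)) z = 0 := by
    intro P hP
    filter_upwards [(eventually_curry_last (e := (0 : ℂ)) hP :
      ∀ᶠ z in 𝓝 (0 : ℂ), ∀ᶠ w in 𝓝 (0 : ℂ), P ((z, 0), w) = w)] with z hz
    refine ncoef_eq_zero ?_ m
    filter_upwards [hz] with w hw
    rw [hw, sub_self]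
  have hβ0 : β ≠ 0 := by
    intro h
    rw [← hβ, h] at hb1
    exact hb1 ⟨hzero hTX, hzero hQX⟩
  obtain ⟨a, b, hab, ha⟩ := exists_reflectionForm hT hβ0 hTX hTZ (fun j hj => (hm2 j hj).1)
    fun j hj => (hb2 j hj).1
  obtain ⟨a', b', hab', ha'⟩ := exists_reflectionForm hQ hβ0 hQX hQZ (fun j hj => (hm2 j hj).2)
    fun j hj => (hb2 j hj).2
  refine ⟨m, β, a, b, a', b', hβ0, hab, hab', ?_⟩
  simp only [ha, ha']
  exact hb1

end ReflectionForm

section DividedIdentity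

theorem tendsto_conj_pair : Tendsto (fun x : ℂ × ℂ => (conj x.1, conj x.2)) (𝓝 0) (𝓝 0) :=
  (show Continuous (fun x : ℂ × ℂ => (conj x.1, conj x.2)) by fun_prop).tendsto' 0 0 (by simp)

theorem conjFun_eventually {p : ℂ × ℂ → Prop} (h : ∀ᶠ x in 𝓝 0, p x) :
    ∀ᶠ x : ℂ × ℂ in 𝓝 0, p (conj x.1, conj x.2) := tendsto_conj_pair.eventually h

theorem conjFun_zero {f : ℂ × ℂ → ℂ} (h : f 0 = 0) : conjFun f 0 = 0 := by
  change conj (f (conj 0, conj 0)) = 0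
  rw [map_zero]
  exact (congrArg conj h).trans (map_zero _)

/-- The transverse component of a map sending the Segre varieties of one hypersurface into those
of another one. -/
structure SegreMap (T Q : Triple → ℂ) (F G : ℂ × ℂ → ℂ) : Prop where
  analytic_fst : AnalyticAt ℂ F 0
  analytic_snd : AnalyticAt ℂ G 0
  map_fst : F 0 = 0
  map_snd : G 0 = 0
  eq : ∀ᶠ x : Triple in 𝓝 0, G (x.1.1, x.2) =
    Q ((F (x.1.1, x.2), conjFun F (x.1.2, T x)), conjFun G (x.1.2, T x))

variable {m β : ℕ} {T Q : Triple → ℂ} {a a' : ℂ × ℂ → ℂ} {b b' : Triple → ℂ} {F G : ℂ × ℂ → ℂ}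

theorem ReflectionForm.eq_self (hT : ReflectionForm m β T a b) (hβ : β ≠ 0) :
    ∀ᶠ y : ℂ × ℂ in 𝓝 0, T ((y.1, 0), y.2) = y.2 := by
  have hc : Tendsto (fun y : ℂ × ℂ => (((y.1, 0), y.2) : Triple)) (𝓝 0) (𝓝 0) :=
    (show Continuous (fun y : ℂ × ℂ => (((y.1, 0), y.2) : Triple)) by fun_prop).tendsto' 0 0 rfl
  filter_upwards [hc.eventually hT.eq] with y hy
  rw [hy]
  simp [hβ]

theorem ReflectionForm.map_zero' (hT : ReflectionForm m β T a b) (hβ : β ≠ 0) : T 0 = 0 :=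
  (hT.eq_self hβ).self_of_nhds

/-- The identity on the complexified hypersurface restricted to `χ = 0`. -/
theorem SegreMap.eq_on_zero (hS : SegreMap T Q F G) (hT : ReflectionForm m β T a b) (hβ : β ≠ 0)
    (hQ : ReflectionForm m β Q a' b') :
    ∀ᶠ y : ℂ × ℂ in 𝓝 0, G y = conjFun G (0, y.2) + conjFun G (0, y.2) ^ m *
      (conjFun F (0, y.2) ^ β * a' (F y, conjFun F (0, y.2)) +
        conjFun F (0, y.2) * conjFun G (0, y.2) *
          b' ((F y, conjFun F (0, y.2)), conjFun G (0, y.2))) := by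
  have hc : Tendsto (fun y : ℂ × ℂ => (((y.1, 0), y.2) : Triple)) (𝓝 0) (𝓝 0) :=
    (show Continuous (fun y : ℂ × ℂ => (((y.1, 0), y.2) : Triple)) by fun_prop).tendsto' 0 0 rfl
  have hc0 : Tendsto (fun y : ℂ × ℂ => ((0, y.2) : ℂ × ℂ)) (𝓝 0) (𝓝 0) :=
    (show Continuous (fun y : ℂ × ℂ => ((0, y.2) : ℂ × ℂ)) by fun_prop).tendsto' 0 0 rfl
  have hF : Tendsto F (𝓝 0) (𝓝 0) := by
    have := hS.analytic_fst.continuousAt.tendsto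
    rwa [hS.map_fst] at this
  have hF' : Tendsto (conjFun F) (𝓝 0) (𝓝 0) := by
    have := (analyticAt_conjFun hS.analytic_fst).continuousAt.tendsto
    rwa [conjFun_zero hS.map_fst] at this
  have hG' : Tendsto (conjFun G) (𝓝 0) (𝓝 0) := by
    have := (analyticAt_conjFun hS.analytic_snd).continuousAt.tendsto
    rwa [conjFun_zero hS.map_snd] at this
  have hq : Tendsto (fun y : ℂ × ℂ => (((F y, conjFun F (0, y.2)), conjFun G (0, y.2)) : Triple))
      (𝓝 0) (𝓝 0) := (hF.prodMk_nhds (hF'.comp hc0)).prodMk_nhds (hG'.comp hc0)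
  filter_upwards [hT.eq_self hβ, hc.eventually hS.eq, hq.eventually hQ.eq] with y h1 h2 h3
  simp only [h1] at h2
  rw [h2, h3]

theorem SegreMap.eventually_zero (hS : SegreMap T Q F G) (hT : ReflectionForm m β T a b)
    (hβ : β ≠ 0) (hQ : ReflectionForm m β Q a' b') : ∀ᶠ z : ℂ in 𝓝 0, G (z, 0) = 0 := by
  have hc : Tendsto (fun z : ℂ => ((z, 0) : ℂ × ℂ)) (𝓝 0) (𝓝 0) :=
    (show Continuous (fun z : ℂ => ((z, 0) : ℂ × ℂ)) by fun_prop).tendsto' 0 0 rfl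
  filter_upwards [hc.eventually (hS.eq_on_zero hT hβ hQ)] with z hz
  have h1 : conjFun F ((0 : ℂ), (0 : ℂ)) = 0 := conjFun_zero hS.map_fst
  have h2 : conjFun G ((0 : ℂ), (0 : ℂ)) = 0 := conjFun_zero hS.map_snd
  rw [hz]
  simp only [h1, h2, zero_pow hβ]
  ring

/-- The function `c` in `g (z, w) = conj g (0, w) + w ^ m c (z, w)`, `G = w g`. -/
noncomputable def transverseCoeff (m β : ℕ) (a' : ℂ × ℂ → ℂ) (b' : Triple → ℂ)
    (F G : ℂ × ℂ → ℂ) : ℂ × ℂ → ℂ := fun y =>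
  conjFun (dquot 1 G) (0, y.2) ^ m * dquot 1 (conjFun F) (0, y.2) *
    (conjFun F (0, y.2) ^ (β - 1) * a' (F y, conjFun F (0, y.2)) +
      y.2 * conjFun (dquot 1 G) (0, y.2) *
        b' ((F y, conjFun F (0, y.2)), conjFun G (0, y.2)))

theorem analyticAt_zero_snd {f : ℂ × ℂ → ℂ} (hf : AnalyticAt ℂ f 0) :
    AnalyticAt ℂ (fun y : ℂ × ℂ => f (0, y.2)) 0 :=
  AnalyticAt.comp (f := fun y : ℂ × ℂ => ((0, y.2) : ℂ × ℂ)) (x := 0) hf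
    (analyticAt_const.prod analyticAt_snd)

theorem SegreMap.analyticAt_transverseCoeff (hS : SegreMap T Q F G)
    (hQ : ReflectionForm m β Q a' b') : AnalyticAt ℂ (transverseCoeff m β a' b' F G) 0 := by
  have h1 := analyticAt_zero_snd (analyticAt_conjFun (analyticAt_dquot (e := (0 : ℂ)) hS.analytic_snd 1))
  have h2 := analyticAt_zero_snd
    (analyticAt_dquot (e := (0 : ℂ)) (analyticAt_conjFun hS.analytic_fst) 1)
  have h3 := analyticAt_zero_snd (analyticAt_conjFun hS.analytic_fst)
  have h4 := analyticAt_zero_snd (analyticAt_conjFun hS.analytic_snd)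
  have h30 : conjFun F (0, (0 : ℂ × ℂ).2) = 0 := conjFun_zero hS.map_fst
  have h40 : conjFun G (0, (0 : ℂ × ℂ).2) = 0 := conjFun_zero hS.map_snd
  have h5 : AnalyticAt ℂ (fun y => (F y, conjFun F (0, y.2))) 0 := hS.analytic_fst.prod h3
  have h50 : (F 0, conjFun F (0, (0 : ℂ × ℂ).2)) = 0 := by rw [hS.map_fst, h30]; rfl
  have h6 : AnalyticAt ℂ (fun y => a' (F y, conjFun F (0, y.2))) 0 := by
    refine AnalyticAt.comp (f := fun y => (F y, conjFun F (0, y.2))) ?_ h5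
    rw [h50]
    exact hQ.analytic_fst
  have h7 : AnalyticAt ℂ (fun y => b' ((F y, conjFun F (0, y.2)), conjFun G (0, y.2))) 0 := by
    refine AnalyticAt.comp (f := fun y => ((F y, conjFun F (0, y.2)), conjFun G (0, y.2))) ?_
      (h5.prod h4)
    rw [h50, h40]
    exact hQ.analytic_snd
  exact ((h1.pow m).mul h2).mul (((h3.pow (β - 1)).mul h6).add ((analyticAt_snd.mul h1).mul h7))

theorem SegreMap.eq_mul_dquot (hS : SegreMap T Q F G) (hT : ReflectionForm m β T a b)
    (hβ : β ≠ 0) (hQ : ReflectionForm m β Q a' b') :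
    ∀ᶠ y : ℂ × ℂ in 𝓝 0, G y = y.2 * dquot 1 G y := by
  filter_upwards [(continuous_fst.tendsto' (0 : ℂ × ℂ) 0 rfl).eventually
    (hS.eventually_zero hT hβ hQ)] with y hy
  have := eq_sum_tcoef G 1 y.1 y.2
  have h0 : tcoef 0 G y.1 = 0 := hy
  rwa [Finset.sum_range_one, h0, zero_mul, zero_add, pow_one] at this

theorem SegreMap.conjFun_eq_mul (hS : SegreMap T Q F G) (hT : ReflectionForm m β T a b)
    (hβ : β ≠ 0) (hQ : ReflectionForm m β Q a' b') :
    ∀ᶠ y : ℂ × ℂ in 𝓝 0, conjFun G y = y.2 * conjFun (dquot 1 G) y := by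
  filter_upwards [conjFun_eventually (hS.eq_mul_dquot hT hβ hQ)] with y hy
  simp only [conjFun]
  rw [hy, map_mul, Complex.conj_conj]

theorem SegreMap.dquot_eq (hS : SegreMap T Q F G) (hT : ReflectionForm m β T a b)
    (hβ : β ≠ 0) (hQ : ReflectionForm m β Q a' b') :
    ∀ᶠ y : ℂ × ℂ in 𝓝 0, dquot 1 G y =
      conjFun (dquot 1 G) (0, y.2) + y.2 ^ m * transverseCoeff m β a' b' F G y := by
  have hc0 : Tendsto (fun y : ℂ × ℂ => ((0, y.2) : ℂ × ℂ)) (𝓝 0) (𝓝 0) :=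
    (show Continuous (fun y : ℂ × ℂ => ((0, y.2) : ℂ × ℂ)) by fun_prop).tendsto' 0 0 rfl
  have hg := analyticAt_dquot (e := (0 : ℂ)) hS.analytic_snd 1
  refine eventually_eq_of_pow_mul_eq (m := 1) hg ((analyticAt_zero_snd (analyticAt_conjFun hg)).add
    ((analyticAt_snd.pow m).mul (hS.analyticAt_transverseCoeff hQ))) ?_
  filter_upwards [hS.eq_on_zero hT hβ hQ, hS.eq_mul_dquot hT hβ hQ,
    hc0.eventually (hS.conjFun_eq_mul hT hβ hQ)] with y h1 h2 h3
  rw [pow_one, ← h2, h1, transverseCoeff]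
  have h5 := eq_sum_tcoef (conjFun F) 1 0 y.2
  have h50 : tcoef 0 (conjFun F) 0 = 0 := conjFun_zero hS.map_fst
  rw [Finset.sum_range_one, h50, zero_mul, zero_add, pow_one] at h5
  obtain ⟨n, rfl⟩ := Nat.exists_eq_succ_of_ne_zero hβ
  simp only [Nat.succ_eq_add_one, Nat.add_sub_cancel]
  set u := conjFun F (0, y.2)
  set A := a' (F y, u)
  set B := b' ((F y, u), conjFun G (0, y.2))
  rw [h3]
  have h6 : u ^ (n + 1) = u ^ n * (y.2 * dquot 1 (conjFun F) (0, y.2)) := by rw [pow_succ, ← h5]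
  have h7 : u * (y.2 * conjFun (dquot 1 G) (0, y.2)) * B =
    y.2 * dquot 1 (conjFun F) (0, y.2) * (y.2 * conjFun (dquot 1 G) (0, y.2)) * B := by rw [← h5]
  rw [h6, h7]
  ring

/-- The divided difference in the first variable. -/
noncomputable def slopeFst (f : ℂ × ℂ → ℂ) : ℂ × ℂ → ℂ :=
  fun y => dquot 1 (fun x : ℂ × ℂ => f (x.2, x.1)) (y.2, y.1)

theorem eq_add_mul_slopeFst (f : ℂ × ℂ → ℂ) (y : ℂ × ℂ) :
    f y = f (0, y.2) + y.1 * slopeFst f y := by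
  have := eq_sum_tcoef (fun x : ℂ × ℂ => f (x.2, x.1)) 1 y.2 y.1
  rw [Finset.sum_range_one, pow_zero, mul_one, pow_one] at this
  exact this

theorem analyticAt_swap {f : ℂ × ℂ → ℂ} (hf : AnalyticAt ℂ f 0) :
    AnalyticAt ℂ (fun x : ℂ × ℂ => f (x.2, x.1)) 0 :=
  AnalyticAt.comp (f := fun x : ℂ × ℂ => (x.2, x.1)) (x := 0) hf (analyticAt_snd.prod analyticAt_fst)

theorem analyticAt_slopeFst {f : ℂ × ℂ → ℂ} (hf : AnalyticAt ℂ f 0) :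
    AnalyticAt ℂ (slopeFst f) 0 :=
  analyticAt_swap (analyticAt_dquot (e := (0 : ℂ)) (analyticAt_swap hf) 1)

theorem SegreMap.conjFun_dquot_eq (hS : SegreMap T Q F G) (hT : ReflectionForm m β T a b)
    (hβ : β ≠ 0) (hQ : ReflectionForm m β Q a' b') :
    ∀ᶠ y : ℂ × ℂ in 𝓝 0, conjFun (dquot 1 G) y = conjFun (dquot 1 G) (0, y.2) +
      y.2 ^ m * (y.1 * slopeFst (conjFun (transverseCoeff m β a' b' F G)) y) := by
  have hc0 : Tendsto (fun y : ℂ × ℂ => ((0, y.2) : ℂ × ℂ)) (𝓝 0) (𝓝 0) :=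
    (show Continuous (fun y : ℂ × ℂ => ((0, y.2) : ℂ × ℂ)) by fun_prop).tendsto' 0 0 rfl
  have h := conjFun_eventually (hS.dquot_eq hT hβ hQ)
  set c := transverseCoeff m β a' b' F G
  filter_upwards [h, hc0.eventually h] with y h1 h2
  have h3 := eq_add_mul_slopeFst (conjFun c) y
  have e1 := congrArg conj h1
  have e2 := congrArg conj h2
  simp only [conjFun, map_add, map_mul, map_pow, Complex.conj_conj, map_zero] at e1 e2 h3 ⊢
  linear_combination e1 - e2 + y.2 ^ m * h3

/-- The factor `ε` in `T = w + w ^ m ε`. -/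
noncomputable def reflectionRemainder (β : ℕ) (a : ℂ × ℂ → ℂ) (b : Triple → ℂ) : Triple → ℂ :=
  fun x => x.1.2 ^ β * a x.1 + x.1.2 * x.2 * b x

/-- The factor `θ` in `T ^ m = w ^ m θ`. -/
noncomputable def reflectionFactor (m β : ℕ) (a : ℂ × ℂ → ℂ) (b : Triple → ℂ) : Triple → ℂ :=
  fun x => (1 + x.2 ^ (m - 1) * reflectionRemainder β a b x) ^ m

theorem ReflectionForm.analyticAt_remainder (hT : ReflectionForm m β T a b) :
    AnalyticAt ℂ (reflectionRemainder β a b) 0 := by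
  have h2 : AnalyticAt ℂ (fun x : Triple => x.1.2) 0 := analyticAt_snd.comp analyticAt_fst
  have h3 : AnalyticAt ℂ (fun x : Triple => a x.1) 0 :=
    AnalyticAt.comp (f := fun x : Triple => x.1) (x := 0) hT.analytic_fst analyticAt_fst
  exact ((h2.pow β).mul h3).add ((h2.mul analyticAt_snd).mul hT.analytic_snd)

theorem ReflectionForm.analyticAt_factor (hT : ReflectionForm m β T a b) :
    AnalyticAt ℂ (reflectionFactor m β a b) 0 :=
  (analyticAt_const.add ((analyticAt_snd.pow (m - 1)).mul hT.analyticAt_remainder)).pow m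

theorem ReflectionForm.pow_eq (hT : ReflectionForm m β T a b) :
    ∀ᶠ x in 𝓝 0, T x ^ m = x.2 ^ m * reflectionFactor m β a b x := by
  filter_upwards [hT.eq] with x hx
  rcases m with _ | m
  · simp [reflectionFactor]
  · rw [hx, reflectionFactor, ← mul_pow, reflectionRemainder, Nat.add_sub_cancel]
    congr 1
    ring

/-- `∑ s ^ i t ^ (j - 1 - i)`. -/
def homogSum {R : Type*} [CommRing R] (j : ℕ) (s t : R) : R :=
  ∑ i ∈ Finset.range j, s ^ i * t ^ (j - 1 - i)

theorem homogSum_mul {R : Type*} [CommRing R] (j : ℕ) (s t : R) :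
    homogSum j s t * (s - t) = s ^ j - t ^ j := (Commute.all s t).geom_sum₂_mul j

theorem SegreMap.divided_identity (hS : SegreMap T Q F G) (hTa : AnalyticAt ℂ T 0)
    (hT : ReflectionForm m β T a b)
    (hβ : β ≠ 0) (hQ : ReflectionForm m β Q a' b') (N : ℕ) :
    ∃ ρ₁ ρ₂ : Triple → ℂ, AnalyticAt ℂ ρ₁ 0 ∧ AnalyticAt ℂ ρ₂ 0 ∧ ∀ᶠ x : Triple in 𝓝 0,
      x.2 * transverseCoeff m β a' b' F G (x.1.1, x.2) =
        reflectionRemainder β a b x *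
          ∑ j ∈ Finset.range N, tcoef j (conjFun G) 0 * homogSum j (T x) x.2 +
        reflectionRemainder β a b x * homogSum N (T x) x.2 * ρ₁ x +
        x.2 ^ N * (reflectionRemainder β a b x * ρ₂ x) +
        reflectionFactor m β a b x * (T x * (x.1.2 *
          slopeFst (conjFun (transverseCoeff m β a' b' F G)) (x.1.2, T x))) +
        reflectionFactor m β a b x * conjFun (dquot 1 G) (x.1.2, T x) ^ m *
          (conjFun F (x.1.2, T x) ^ β * a' (F (x.1.1, x.2), conjFun F (x.1.2, T x)) +
            conjFun G (x.1.2, T x) * conjFun F (x.1.2, T x) *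
              b' ((F (x.1.1, x.2), conjFun F (x.1.2, T x)), conjFun G (x.1.2, T x))) := by
  have hT0 := hT.map_zero' hβ
  have hTt : Tendsto T (𝓝 0) (𝓝 0) := by
    have := hTa.continuousAt.tendsto
    rwa [hT0] at this
  have hF0 := hS.map_fst
  have hF' := analyticAt_conjFun hS.analytic_fst
  have hG' := analyticAt_conjFun hS.analytic_snd
  have hg := analyticAt_dquot (e := (0 : ℂ)) hS.analytic_snd 1
  have hg' := analyticAt_conjFun hg
  have hc := hS.analyticAt_transverseCoeff hQ
  have he := analyticAt_slopeFst (analyticAt_conjFun hc)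
  have hε := hT.analyticAt_remainder
  have hθ := hT.analyticAt_factor
  set ε := reflectionRemainder β a b
  set θ := reflectionFactor m β a b
  set c := transverseCoeff m β a' b' F G
  let γ : ℂ → ℂ := fun w => conjFun G (0, w)
  let ρ : ℂ → ℂ := fun w => dquot N (conjFun G) (0, w)
  have hρ : AnalyticAt ℂ ρ 0 :=
    AnalyticAt.comp (f := fun w : ℂ => ((0, w) : ℂ × ℂ)) (x := 0)
      (analyticAt_dquot (e := (0 : ℂ)) hG' N) (analyticAt_const.prod analyticAt_id)
  let r : ℂ × ℂ → ℂ := dquot 1 (fun y : ℂ × ℂ => ρ (y.1 + y.2))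
  have hr : AnalyticAt ℂ r 0 := by
    refine analyticAt_dquot (e := (0 : ℂ)) ?_ 1
    have hadd : AnalyticAt ℂ (fun y : ℂ × ℂ => y.1 + y.2) 0 := analyticAt_fst.add analyticAt_snd
    refine AnalyticAt.comp (g := ρ) (f := fun y : ℂ × ℂ => y.1 + y.2) (x := 0) ?_ hadd
    simpa using hρ
  have hreq : ∀ s t, ρ s = ρ t + (s - t) * r (t, s - t) := by
    intro s t
    have h := eq_sum_tcoef (fun y : ℂ × ℂ => ρ (y.1 + y.2)) 1 t (s - t)
    have h0 : tcoef 0 (fun y : ℂ × ℂ => ρ (y.1 + y.2)) t = ρ t := by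
      change ρ (t + 0) = ρ t
      rw [add_zero]
    rw [Finset.sum_range_one, h0, pow_zero, mul_one, pow_one, add_sub_cancel] at h
    exact h
  have hγ : ∀ w, γ w = ∑ j ∈ Finset.range N, tcoef j (conjFun G) 0 * w ^ j + w ^ N * ρ w :=
    fun w => eq_sum_tcoef (conjFun G) N 0 w
  have hXTa : AnalyticAt ℂ (fun x : Triple => (x.1.2, T x)) 0 :=
    (analyticAt_snd.comp analyticAt_fst).prod hTa
  have hXT0 : ((0 : Triple).1.2, T 0) = 0 := by rw [hT0]; rfl
  have hXTt : Tendsto (fun x : Triple => (x.1.2, T x)) (𝓝 0) (𝓝 0) := by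
    have := hXTa.continuousAt.tendsto
    simp only [hXT0] at this
    exact this
  have hZWt : Tendsto (fun x : Triple => ((x.1.1, x.2) : ℂ × ℂ)) (𝓝 0) (𝓝 0) :=
    (show Continuous (fun x : Triple => ((x.1.1, x.2) : ℂ × ℂ)) by fun_prop).tendsto' 0 0 rfl
  have hZ0t : Tendsto (fun x : Triple => ((0, x.2) : ℂ × ℂ)) (𝓝 0) (𝓝 0) :=
    (show Continuous (fun x : Triple => ((0, x.2) : ℂ × ℂ)) by fun_prop).tendsto' 0 0 rfl
  have h0Tt : Tendsto (fun x : Triple => ((0, T x) : ℂ × ℂ)) (𝓝 0) (𝓝 0) :=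
    (tendsto_const_nhds (x := (0 : ℂ))).prodMk_nhds hTt
  have hcompXT : ∀ {f : ℂ × ℂ → ℂ}, AnalyticAt ℂ f 0 →
      AnalyticAt ℂ (fun x : Triple => f (x.1.2, T x)) 0 := by
    intro f hf
    refine AnalyticAt.comp (f := fun x : Triple => (x.1.2, T x)) ?_ hXTa
    rw [hXT0]
    exact hf
  have hcompZW : ∀ {f : ℂ × ℂ → ℂ}, AnalyticAt ℂ f 0 →
      AnalyticAt ℂ (fun x : Triple => f (x.1.1, x.2)) 0 := by
    intro f hf
    exact AnalyticAt.comp (f := fun x : Triple => (x.1.1, x.2)) (x := 0) hf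
      ((analyticAt_fst.comp analyticAt_fst).prod analyticAt_snd)
  have hUa := hcompXT hF'
  have hVa := hcompXT hG'
  have hFa := hcompZW hS.analytic_fst
  have hU0 : conjFun F ((0 : Triple).1.2, T 0) = 0 := by rw [hXT0]; exact conjFun_zero hS.map_fst
  have hV0 : conjFun G ((0 : Triple).1.2, T 0) = 0 := by rw [hXT0]; exact conjFun_zero hS.map_snd
  have hF00 : F ((0 : Triple).1.1, (0 : Triple).2) = 0 := hF0
  have hFUa := hFa.prod hUa
  have hFUVa := hFUa.prod hVa
  have hFUVt : Tendsto (fun x : Triple => (((F (x.1.1, x.2), conjFun F (x.1.2, T x)),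
      conjFun G (x.1.2, T x)) : Triple)) (𝓝 0) (𝓝 0) := by
    have := hFUVa.continuousAt.tendsto
    simp only [hU0, hV0, hF00] at this
    exact this
  have haa : AnalyticAt ℂ (fun x : Triple => a' (F (x.1.1, x.2), conjFun F (x.1.2, T x))) 0 := by
    refine AnalyticAt.comp (f := fun x : Triple => (F (x.1.1, x.2), conjFun F (x.1.2, T x))) ?_ hFUa
    rw [hF00, hU0]
    exact hQ.analytic_fst
  have hba : AnalyticAt ℂ (fun x : Triple => b' ((F (x.1.1, x.2), conjFun F (x.1.2, T x)),
      conjFun G (x.1.2, T x))) 0 := by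
    refine AnalyticAt.comp (f := fun x : Triple => ((F (x.1.1, x.2), conjFun F (x.1.2, T x)),
      conjFun G (x.1.2, T x))) ?_ hFUVa
    rw [hF00, hU0, hV0]
    exact hQ.analytic_snd
  have hρT : AnalyticAt ℂ (fun x : Triple => ρ (T x)) 0 := by
    refine AnalyticAt.comp (g := ρ) (f := T) ?_ hTa
    rw [hT0]
    exact hρ
  have hr2 : AnalyticAt ℂ (fun x : Triple => r (x.2, T x - x.2)) 0 := by
    refine AnalyticAt.comp (g := r) (f := fun x : Triple => (x.2, T x - x.2)) ?_
      (analyticAt_snd.prod (hTa.sub analyticAt_snd))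
    have : ((0 : Triple).2, T 0 - (0 : Triple).2) = 0 := by rw [hT0]; simp
    rw [this]
    exact hr
  have hhom : ∀ j, AnalyticAt ℂ (fun x : Triple => homogSum j (T x) x.2) 0 := fun j =>
    Finset.analyticAt_fun_sum _ fun i _ => (hTa.pow i).mul (analyticAt_snd.pow _)
  refine ⟨fun x => ρ (T x), fun x => r (x.2, T x - x.2), hρT, hr2, ?_⟩
  refine eventually_eq_of_pow_mul_eq (m := m) (analyticAt_snd.mul (hcompZW hc)) ?_ ?_
  · refine AnalyticAt.add (AnalyticAt.add (AnalyticAt.add (AnalyticAt.add ?_ ?_) ?_) ?_) ?_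
    · exact hε.mul (Finset.analyticAt_fun_sum _ fun j _ => analyticAt_const.mul (hhom j))
    · exact (hε.mul (hhom N)).mul hρT
    · exact (analyticAt_snd.pow N).mul (hε.mul hr2)
    · exact hθ.mul (hTa.mul ((analyticAt_snd.comp analyticAt_fst).mul (hcompXT he)))
    · exact (hθ.mul ((hcompXT hg').pow m)).mul (((hUa.pow β).mul haa).add ((hVa.mul hUa).mul hba))
  · filter_upwards [hS.eq, hFUVt.eventually hQ.eq, hT.eq, hT.pow_eq,
      hZWt.eventually (hS.eq_mul_dquot hT hβ hQ), hZWt.eventually (hS.dquot_eq hT hβ hQ),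
      hXTt.eventually (hS.conjFun_eq_mul hT hβ hQ), hXTt.eventually (hS.conjFun_dquot_eq hT hβ hQ),
      hZ0t.eventually (hS.conjFun_eq_mul hT hβ hQ), h0Tt.eventually (hS.conjFun_eq_mul hT hβ hQ)]
      with x e1 e2 e3 e4 e5 e6 e7 e8 e9 e10
    have e3' : T x = x.2 + x.2 ^ m * ε x := e3
    have g1 := hγ (T x)
    have g2 := hγ x.2
    have g3 := hreq (T x) x.2
    have s1 : x.2 ^ m * (ε x * ∑ j ∈ Finset.range N, tcoef j (conjFun G) 0 * homogSum j (T x) x.2) =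
        ∑ j ∈ Finset.range N, tcoef j (conjFun G) 0 * T x ^ j -
          ∑ j ∈ Finset.range N, tcoef j (conjFun G) 0 * x.2 ^ j := by
      rw [← Finset.sum_sub_distrib, ← mul_assoc, Finset.mul_sum]
      refine Finset.sum_congr rfl fun j _ => ?_
      have := homogSum_mul j (T x) x.2
      linear_combination tcoef j (conjFun G) 0 * this -
        tcoef j (conjFun G) 0 * homogSum j (T x) x.2 * e3'
    have s2 : x.2 ^ m * (ε x * homogSum N (T x) x.2) = T x ^ N - x.2 ^ N := by
      linear_combination homogSum_mul N (T x) x.2 - homogSum N (T x) x.2 * e3'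
    have g1' : conjFun G (0, T x) = _ := g1
    have g2' : conjFun G (0, x.2) = _ := g2
    set A := a' (F (x.1.1, x.2), conjFun F (x.1.2, T x))
    set B := b' ((F (x.1.1, x.2), conjFun F (x.1.2, T x)), conjFun G (x.1.2, T x))
    set U := conjFun F (x.1.2, T x)
    set V := conjFun G (x.1.2, T x)
    set gb := conjFun (dquot 1 G) (x.1.2, T x)
    set Gx := G (x.1.1, x.2)
    set e := slopeFst (conjFun c) (x.1.2, T x)
    have v1 : V ^ m = x.2 ^ m * θ x * gb ^ m := by rw [e7, mul_pow, e4]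
    have v2 : V = conjFun G (0, T x) + x.2 ^ m * θ x * (T x * (x.1.2 * e)) := by
      rw [e7, e10, e8, ← e4]; ring
    have l1 : x.2 ^ m * (x.2 * c (x.1.1, x.2)) = Gx - conjFun G (0, x.2) := by
      rw [e5, e6, e9]; ring
    rw [l1, e1, e2]
    rw [v1]
    have v2' := v2
    rw [g1'] at v2'
    rw [g2']
    linear_combination v2' - s1 - ρ (T x) * s2 + x.2 ^ N * (g3 + r (x.2, T x - x.2) * e3')

end DividedIdentity

section NilpotentAlgebra

variable {R : Type*} [CommRing R] {x y T t₁ t₂ : R} {β k : ℕ}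

theorem exists_pow_succ_eq (hβ : β ≠ 0) (hx : x ^ (β + 1) = 0) (hT : T = y * t₁ + x ^ β * t₂)
    (j : ℕ) : ∃ r, T ^ (j + 1) = y ^ (j + 1) * t₁ ^ (j + 1) + x ^ β * y ^ j * r := by
  have hxx : x ^ β * x ^ β = 0 := by
    rw [← pow_add]
    exact pow_eq_zero_of_le (by omega) hx
  induction j with
  | zero => exact ⟨t₂, by rw [hT]; ring⟩
  | succ j ih =>
    obtain ⟨r, hr⟩ := ih
    refine ⟨y ^ 0 * (t₂ * t₁ ^ (j + 1) + r * t₁), ?_⟩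
    rw [pow_succ, hr, hT]
    linear_combination (y ^ j * r * t₂) * hxx

theorem exists_pow_eq_mul (hβ : β ≠ 0) (hx : x ^ (β + 1) = 0) (hy : y ^ (k + 1) = 0)
    (hT : T = y * t₁ + x ^ β * t₂) : ∃ r, T ^ (k + 1) = x ^ β * y ^ k * r := by
  obtain ⟨r, hr⟩ := exists_pow_succ_eq hβ hx hT k
  exact ⟨r, by rw [hr, hy, zero_mul, zero_add]⟩

theorem mul_pow_eq_of_mul_eq {s t u : R} (h : u * s = u * t) (n : ℕ) : u * s ^ n = u * t ^ n := by
  induction n with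
  | zero => simp
  | succ n ih => linear_combination s * ih + t ^ n * h

theorem remainder_mul_homogSum {ε e₁ e₂ : R} (hβ : β ≠ 0) (hx : x ^ (β + 1) = 0)
    (hy : y ^ (k + 1) = 0) (hT : T = y * t₁ + x ^ β * t₂) (hε : ε = x ^ β * e₁ + x * y * e₂) :
    ε * homogSum (k + 2) T y = 0 := by
  have hxx : x ^ β * x ^ β = 0 := by
    rw [← pow_add]
    exact pow_eq_zero_of_le (by omega) hx
  have h1 : ε * T = ε * (y * t₁) := by
    rw [pow_succ] at hx
    rw [hT, hε]
    linear_combination (e₁ * t₂) * hxx + (y * e₂ * t₂) * hx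
  rw [homogSum, Finset.mul_sum]
  refine Finset.sum_eq_zero fun i hi => ?_
  have hi' : i ≤ k + 1 := by have := Finset.mem_range.1 hi; omega
  have h2 := mul_pow_eq_of_mul_eq h1 i
  have h3 : y ^ i * y ^ (k + 1 - i) = 0 := by
    rw [← pow_add, Nat.add_sub_cancel' hi', hy]
  have h4 : k + 2 - 1 - i = k + 1 - i := by omega
  rw [h4, ← mul_assoc, h2, mul_pow]
  linear_combination (ε * t₁ ^ i) * h3

theorem add_pow_succ_of_sq_zero {s d : R} (hd : d * d = 0) (n : ℕ) :
    (s + d) ^ (n + 1) = s ^ (n + 1) + (n + 1) * (s ^ n * d) := by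
  induction n with
  | zero => simp
  | succ n ih =>
    rw [pow_succ, ih]
    push_cast
    linear_combination ((n + 1) * s ^ n) * hd

theorem pow_mul_of_eq_add {s u₁ u₂ : R} (hy : y ^ (k + 1) = 0) (hs : s = x * u₁ + y * u₂) (n : ℕ) :
    y ^ k * s ^ n = y ^ k * (x * u₁) ^ n := by
  refine mul_pow_eq_of_mul_eq ?_ n
  rw [pow_succ] at hy
  rw [hs]
  linear_combination u₂ * hy

theorem pow_eq_of_eq_add_sq {s u u₁ u₂ r : R} (hβ : β ≠ 0) (hk : k ≠ 0) (hx : x ^ (β + 1) = 0)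
    (hy : y ^ (k + 1) = 0) (hs : s = x * u₁ + y * u₂) (hu : u = s + x ^ 2 * y ^ k * r) :
    u ^ β = s ^ β := by
  obtain ⟨n, rfl⟩ := Nat.exists_eq_succ_of_ne_zero hβ
  have hyy : y ^ k * y ^ k = 0 := by
    rw [← pow_add]
    exact pow_eq_zero_of_le (by omega) hy
  have hd : x ^ 2 * y ^ k * r * (x ^ 2 * y ^ k * r) = 0 := by
    linear_combination (x ^ 4 * r ^ 2) * hyy
  rw [hu, Nat.succ_eq_add_one, add_pow_succ_of_sq_zero hd]
  have h1 := pow_mul_of_eq_add hy hs n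
  have h2 : s ^ n * (x ^ 2 * y ^ k * r) = 0 := by
    have hx' : x ^ n * x ^ 2 = 0 := by rw [← pow_add]; exact hx
    rw [mul_pow] at h1
    linear_combination (x ^ 2 * r) * h1 + (y ^ k * u₁ ^ n * r) * hx'
  rw [h2, mul_zero, add_zero]

/-- Extraction of the leading unknown term modulo `(x ^ (β + 1), y ^ (k + 1))`. -/
theorem exists_adm_add_leading {Adm : Subring R} {m : ℕ} {L Γ E θ g gs U Us V α αs b bs u₁ u₂ v₁ v₂ f a₁ κ
      r₀ r₁ r₂ : R}
    (hβ : β ≠ 0) (hk : k ≠ 0) (hx : x ^ (β + 1) = 0) (hy : y ^ (k + 1) = 0)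
    (hL : L = Γ + E + θ * g ^ m * (U ^ β * α + V * U * b))
    (hΓ : Γ ∈ Adm) (hE : E ∈ Adm) (hθ : θ ∈ Adm) (hV : V ∈ Adm) (hUs : Us ∈ Adm) (hgs : gs ∈ Adm)
    (hαs : αs ∈ Adm) (hbs : bs ∈ Adm)
    (hVeq : V = y * v₁ + x ^ β * v₂) (hU : U = Us + x ^ 2 * y ^ k * r₀) (hUseq : Us = x * u₁ + y * u₂)
    (hg : g ^ m * U = gs * U) (hα : α = αs + y ^ k * f * a₁ + x ^ 2 * y ^ k * r₁)
    (hb : b = bs + y ^ k * r₂)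
    (hκ : x ^ β * y ^ k * (θ * gs * u₁ ^ β * a₁) = x ^ β * y ^ k * κ) :
    ∃ r ∈ Adm, L = r + x ^ β * y ^ k * (κ * f) := by
  refine ⟨Γ + E + θ * gs * (Us ^ β * αs + V * Us * bs), ?_, ?_⟩
  · exact Adm.add_mem (Adm.add_mem hΓ hE) (Adm.mul_mem (Adm.mul_mem hθ hgs)
      (Adm.add_mem (Adm.mul_mem (Adm.pow_mem hUs _) hαs) (Adm.mul_mem (Adm.mul_mem hV hUs) hbs)))
  · have e1 : U ^ β = Us ^ β := pow_eq_of_eq_add_sq hβ hk hx hy hUseq hU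
    have hx' : x ^ β * x = 0 := by rwa [pow_succ] at hx
    have hy' : y ^ k * y = 0 := by rwa [pow_succ] at hy
    have e2 := pow_mul_of_eq_add hy hUseq β
    rw [mul_pow] at e2
    have e3 : y ^ k * (V * Us) = 0 := by
      rw [hVeq, hUseq]
      linear_combination (v₁ * (x * u₁ + y * u₂) + x ^ β * v₂ * u₂) * hy' + (y ^ k * v₂ * u₁) * hx'
    have e4 : V * U = V * Us := by
      rw [hU, hVeq]
      linear_combination (v₁ * x ^ 2 * r₀) * hy' + (v₂ * x * y ^ k * r₀) * hx'
    have e5 : θ * g ^ m * (U ^ β * α + V * U * b) = θ * gs * (U ^ β * α + V * U * b) := by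
      obtain ⟨n, rfl⟩ := Nat.exists_eq_succ_of_ne_zero hβ
      rw [Nat.succ_eq_add_one, pow_succ]
      linear_combination (θ * (U ^ n * α + V * b)) * hg
    rw [hL, e5, e1, e4, hα, hb]
    linear_combination (θ * gs * r₂) * e3 + (θ * gs * (f * a₁ + x ^ 2 * r₁)) * e2 + f * hκ +
      (θ * gs * x * y ^ k * u₁ ^ β * r₁) * hx'

/-- The leading coefficient of the divided identity for `y = 0`. -/
theorem leading_term_eq_zero {m : ℕ} {c σ₁ γ ρ₁ ρ₂ e₁ e₂ ε E θ g U V α b u₁ u₂ : R}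
    (hβ : β ≠ 0) (hx : x ^ (β + 1) = 0) (hy : y = 0) (hT : T = y * t₁ + x ^ β * t₂)
    (hε : ε = x ^ β * e₁ + x * y * e₂) (hU : U = x * u₁ + y * u₂) (hV : V = T * g)
    (hσ : σ₁ = γ)
    (h : y * c = ε * σ₁ + ε * homogSum 2 T y * ρ₁ + y ^ 2 * (ε * ρ₂) + θ * (T * (x * E)) +
      θ * g ^ m * (U ^ β * α + V * U * b)) :
    x ^ β * (e₁ * γ + θ * g ^ m * u₁ ^ β * α) = 0 := by
  have hy' : y ^ (0 + 1) = 0 := by rw [hy, zero_add, pow_one]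
  have h0 : ε * homogSum 2 T y = 0 := remainder_mul_homogSum (k := 0) hβ hx hy' hT hε
  have hx' : x ^ β * x = 0 := by rwa [pow_succ] at hx
  rw [h0, hσ] at h
  rw [hε, hV, hT, hU, hy] at h
  simp only [zero_mul, mul_zero, zero_add, add_zero, zero_pow two_ne_zero, mul_pow] at h
  linear_combination (-θ * t₂ * E - θ * g ^ m * t₂ * g * u₁ * b) * hx' - h

end NilpotentAlgebra

section FamilyTools

variable {ι : Type} {E E' : Type} [NormedAddCommGroup E] [NormedSpace ℂ E]
  [NormedAddCommGroup E'] [NormedSpace ℂ E'] {A B : ℕ}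

/-- Evaluation at a point. -/
noncomputable def AnFam.eval (i : ι) (x : E) : AnFam ι E →+* ℂ :=
  ((Pi.evalRingHom (fun _ : E => ℂ) x).comp (Pi.evalRingHom (fun _ : ι => E → ℂ) i)).comp
    (AnFam ι E).subtype

theorem AnFam.eval_apply (i : ι) (x : E) (f : AnFam ι E) : AnFam.eval i x f = f.1 i x := rfl

/-- The constant family of maps. -/
def VanFam.known (ι : Type) (d : E' → E) (hd : AnalyticAt ℂ d 0) (h0 : d 0 = 0) : VanFam ι E' E :=
  ⟨fun _ => d, fun _ => hd, fun _ => h0⟩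

def VanFam.ofFam (f : AnFam ι E') (h : ∀ i, f.1 i 0 = 0) : VanFam ι E' ℂ := ⟨f.1, f.2, h⟩

theorem AnFam.comp_congr {X Y : VanFam ι E' E} (h : ∀ i x, X.toFun i x = Y.toFun i x)
    (f : AnFam ι E) : AnFam.comp X f = AnFam.comp Y f :=
  Subtype.ext (funext fun i => funext fun x => congrArg (f.1 i) (h i x))

/-- The families of iterated divided differences. -/
noncomputable def slopeFam (N : ℕ) (f : AnFam ι ℂ) : AnFam ι ℂ :=
  ⟨fun i => slopeZero^[N] (f.1 i), fun i => analyticAt_slopeZero_iterate (f.2 i) N⟩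

theorem AnFam.comp_expand_num (f : AnFam ι ℂ) (Y : VanFam ι Triple ℂ) (N : ℕ) :
    AnFam.comp Y f = ∑ j ∈ Finset.range N,
      AnFam.comp (coordZ ι) (numFam fun i => ncoef j (f.1 i)) * Y.toFam ^ j +
        Y.toFam ^ N * AnFam.comp Y (slopeFam N f) := by
  refine Subtype.ext (funext fun i => funext fun x => ?_)
  have h := eq_sum_ncoef (f.1 i) N (Y.toFun i x)
  simp only [Subring.coe_add, Subring.coe_mul, AddSubmonoidClass.coe_finsetSum, Pi.add_apply,
    Finset.sum_apply, Pi.mul_apply, SubmonoidClass.coe_pow, Pi.pow_apply]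
  exact h

theorem map_homogSum {R R' : Type*} [CommRing R] [CommRing R'] (φ : R →+* R') (j : ℕ) (s t : R) :
    φ (homogSum j s t) = homogSum j (φ s) (φ t) := by
  simp only [homogSum, map_sum, map_mul, map_pow]

theorem proj_comp_coordX_mem {S : Subring (AnFam ι ℂ)} {f : AnFam ι ℂ}
    (h : ∀ u, numFam (fun i => ncoef u (f.1 i)) ∈ S) :
    proj A B (AnFam.comp (coordX ι) f) ∈ adm S A B := by
  rw [AnFam.comp_expand_num f (coordX ι) A, map_add, map_mul, map_pow]
  change _ + clX ι A B ^ A * _ ∈ _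
  rw [clX_pow, zero_mul, add_zero, map_sum]
  refine Subring.sum_mem _ fun j _ => ?_
  rw [map_mul, map_pow]
  exact Subring.mul_mem _ (clZ_mem_adm (h j)) (Subring.pow_mem _ clX_mem_adm _)

theorem proj_known_mem {S : Subring (AnFam ι ℂ)}
    (hS : ∀ (q : ℂ → ℂ) (hq : AnalyticAt ℂ q 0), AnFam.known ι q hq ∈ S)
    {d : Triple → ℂ} (hd : AnalyticAt ℂ d 0) : proj A B (AnFam.known ι d hd) ∈ adm S A B :=
  proj_mem_adm_of_tc fun u _ v _ => hS (tcoef u (tcoef v d)) (analyticAt_tcoef (e := (0 : ℂ))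
    (analyticAt_tcoef (e := (0 : ℂ × ℂ)) hd v) u)

theorem clX_pow_mul_clW_pow_mul_proj {n k : ℕ} (f : AnFam ι Triple) :
    clX ι (n + 1) (k + 1) ^ n * clW ι (n + 1) (k + 1) ^ k * proj (n + 1) (k + 1) f =
      clX ι (n + 1) (k + 1) ^ n * clW ι (n + 1) (k + 1) ^ k * clZ (n + 1) (k + 1) (restrictZ f) := by
  obtain ⟨r, s, h⟩ := exists_proj_eq_restrictZ (A := n + 1) (B := k + 1) f
  have h1 := clX_pow (ι := ι) (A := n + 1) (B := k + 1)
  have h2 := clW_pow (ι := ι) (A := n + 1) (B := k + 1)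
  rw [h]
  generalize clX ι (n + 1) (k + 1) = x at *
  generalize clW ι (n + 1) (k + 1) = y at *
  generalize proj (n + 1) (k + 1) r = r' at *
  generalize proj (n + 1) (k + 1) s = s' at *
  generalize clZ (n + 1) (k + 1) (restrictZ f) = z at *
  rw [pow_succ] at h1 h2
  calc _ = x ^ n * y ^ k * z + (x ^ n * x) * y ^ k * r' + x ^ n * (y ^ k * y) * s' := by ring
    _ = _ := by rw [h1, h2]; ring

theorem isNilpotent_clX : IsNilpotent (clX ι A B) := ⟨A, clX_pow⟩

theorem isNilpotent_clW : IsNilpotent (clW ι A B) := ⟨B, clW_pow⟩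

theorem isNilpotent_add_mul {R : Type*} [CommRing R] {x y : R} (hx : IsNilpotent x)
    (hy : IsNilpotent y) (u v : R) : IsNilpotent (x * u + y * v) :=
  (Commute.all _ _).isNilpotent_add ((Commute.all x u).isNilpotent_mul_right hx)
    ((Commute.all y v).isNilpotent_mul_right hy)

end FamilyTools

section SegreFamilies

variable {ι : Type} {m β : ℕ} {T Q : Triple → ℂ} {a a' : ℂ × ℂ → ℂ} {b b' : Triple → ℂ}
  {F G : ι → ℂ × ℂ → ℂ}

noncomputable def vanF (hS : ∀ i, SegreMap T Q (F i) (G i)) : VanFam ι (ℂ × ℂ) ℂ :=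
  ⟨F, fun i => (hS i).analytic_fst, fun i => (hS i).map_fst⟩

noncomputable def vanConjF (hS : ∀ i, SegreMap T Q (F i) (G i)) : VanFam ι (ℂ × ℂ) ℂ :=
  ⟨fun i => conjFun (F i), fun i => analyticAt_conjFun (hS i).analytic_fst,
    fun i => conjFun_zero (hS i).map_fst⟩

noncomputable def vanConjG (hS : ∀ i, SegreMap T Q (F i) (G i)) : VanFam ι (ℂ × ℂ) ℂ :=
  ⟨fun i => conjFun (G i), fun i => analyticAt_conjFun (hS i).analytic_snd,
    fun i => conjFun_zero (hS i).map_snd⟩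

/-- The conjugate of `G / w`. -/
noncomputable def famConjg (hS : ∀ i, SegreMap T Q (F i) (G i)) : AnFam ι (ℂ × ℂ) :=
  ⟨fun i => conjFun (dquot 1 (G i)), fun i => analyticAt_conjFun
    (analyticAt_dquot (e := (0 : ℂ)) (hS i).analytic_snd 1)⟩

noncomputable def famc (hS : ∀ i, SegreMap T Q (F i) (G i)) (hQ : ReflectionForm m β Q a' b') :
    AnFam ι (ℂ × ℂ) :=
  ⟨fun i => transverseCoeff m β a' b' (F i) (G i), fun i => (hS i).analyticAt_transverseCoeff hQ⟩

noncomputable def fame (hS : ∀ i, SegreMap T Q (F i) (G i)) (hQ : ReflectionForm m β Q a' b') :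
    AnFam ι (ℂ × ℂ) :=
  ⟨fun i => slopeFst (conjFun (transverseCoeff m β a' b' (F i) (G i))), fun i =>
    analyticAt_slopeFst (analyticAt_conjFun ((hS i).analyticAt_transverseCoeff hQ))⟩

/-- The map `(z, χ, w) ↦ (z, w)`. -/
noncomputable def pointZW (ι : Type) : VanFam ι Triple (ℂ × ℂ) := (coordZ ι).pair (coordW ι)

/-- The map `(z, χ, w) ↦ (χ, T)`. -/
noncomputable def pointXT (t : VanFam ι Triple ℂ) : VanFam ι Triple (ℂ × ℂ) := (coordX ι).pair t

theorem proj_divided_identity (hS : ∀ i, SegreMap T Q (F i) (G i)) (hTa : AnalyticAt ℂ T 0)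
    (hT0 : T 0 = 0) (hT : ReflectionForm m β T a b) (hβ : β ≠ 0) (hQ : ReflectionForm m β Q a' b')
    (A B N : ℕ) {t : VanFam ι Triple ℂ} (ht : t = VanFam.known ι T hTa hT0)
    {f u v : VanFam ι Triple ℂ} (hf : f = (vanF hS).comp (pointZW ι))
    (hu : u = (vanConjF hS).comp (pointXT t)) (hv : v = (vanConjG hS).comp (pointXT t)) :
    ∃ ρ₁ ρ₂ : TruncRing ι A B,
      clW ι A B * proj A B (AnFam.comp (pointZW ι) (famc hS hQ)) =
        proj A B (AnFam.known ι _ hT.analyticAt_remainder) *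
          ∑ j ∈ Finset.range N, clZ A B (numFam fun i => tcoef j (conjFun (G i)) 0) *
            homogSum j (proj A B t.toFam) (clW ι A B) +
        proj A B (AnFam.known ι _ hT.analyticAt_remainder) *
          homogSum N (proj A B t.toFam) (clW ι A B) * ρ₁ +
        clW ι A B ^ N * (proj A B (AnFam.known ι _ hT.analyticAt_remainder) * ρ₂) +
        proj A B (AnFam.known ι _ hT.analyticAt_factor) * (proj A B t.toFam * (clX ι A B *
          proj A B (AnFam.comp (pointXT t) (fame hS hQ)))) +
        proj A B (AnFam.known ι _ hT.analyticAt_factor) *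
          proj A B (AnFam.comp (pointXT t) (famConjg hS)) ^ m *
          (proj A B u.toFam ^ β *
              proj A B (AnFam.comp (f.pair u) (AnFam.known ι a' hQ.analytic_fst)) +
            proj A B v.toFam * proj A B u.toFam *
              proj A B (AnFam.comp ((f.pair u).pair v) (AnFam.known ι b' hQ.analytic_snd))) := by
  choose r₁ r₂ h1 h2 h using fun i => (hS i).divided_identity hTa hT hβ hQ N
  refine ⟨proj A B ⟨r₁, h1⟩, proj A B ⟨r₂, h2⟩, ?_⟩
  have key := proj_congr (A := A) (B := B)
    (f := (coordW ι).toFam * AnFam.comp (pointZW ι) (famc hS hQ))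
    (g := AnFam.known ι _ hT.analyticAt_remainder *
          ∑ j ∈ Finset.range N, AnFam.comp (coordZ ι) (numFam fun i => tcoef j (conjFun (G i)) 0) *
            homogSum j t.toFam (coordW ι).toFam +
        AnFam.known ι _ hT.analyticAt_remainder *
          homogSum N t.toFam (coordW ι).toFam * ⟨r₁, h1⟩ +
        (coordW ι).toFam ^ N * (AnFam.known ι _ hT.analyticAt_remainder * ⟨r₂, h2⟩) +
        AnFam.known ι _ hT.analyticAt_factor * (t.toFam * ((coordX ι).toFam *
          AnFam.comp (pointXT t) (fame hS hQ))) +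
        AnFam.known ι _ hT.analyticAt_factor *
          AnFam.comp (pointXT t) (famConjg hS) ^ m *
          (u.toFam ^ β * AnFam.comp (f.pair u) (AnFam.known ι a' hQ.analytic_fst) +
            v.toFam * u.toFam *
              AnFam.comp ((f.pair u).pair v) (AnFam.known ι b' hQ.analytic_snd))) ?_
  · simp only [map_add, map_mul, map_pow, map_sum, map_homogSum] at key
    exact key
  · intro i
    filter_upwards [h i] with x hx
    rw [← AnFam.eval_apply, ← AnFam.eval_apply]
    simp only [map_add, map_mul, map_pow, map_sum, map_homogSum]
    subst ht hf hu hv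
    exact hx

end SegreFamilies

section SegreFamilies

variable {ι : Type} {m β : ℕ} {T Q : Triple → ℂ} {a a' : ℂ × ℂ → ℂ} {b b' : Triple → ℂ}
  {F G : ι → ℂ × ℂ → ℂ} {A B : ℕ}

theorem ReflectionForm.analyticAt_fst_comp (hT : ReflectionForm m β T a b) :
    AnalyticAt ℂ (fun x : Triple => a x.1) 0 :=
  AnalyticAt.comp (f := fun x : Triple => x.1) (x := 0) hT.analytic_fst analyticAt_fst

/-- The cofactor of `w` in `T`. -/
noncomputable def reflectionCofactorW (ι : Type) (hT : ReflectionForm m β T a b) :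
    AnFam ι Triple :=
  1 + (coordW ι).toFam ^ m * ((coordX ι).toFam * AnFam.known ι b hT.analytic_snd)

/-- The cofactor of `χ ^ β` in `T`. -/
noncomputable def reflectionCofactorX (ι : Type) (hT : ReflectionForm m β T a b) :
    AnFam ι Triple :=
  (coordW ι).toFam ^ m * AnFam.known ι _ hT.analyticAt_fst_comp

theorem proj_reflection (hT : ReflectionForm m β T a b) (hTa : AnalyticAt ℂ T 0) (hT0 : T 0 = 0)
    {t : VanFam ι Triple ℂ} (ht : t = VanFam.known ι T hTa hT0) :
    proj A B t.toFam = clW ι A B * proj A B (reflectionCofactorW ι hT) +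
      clX ι A B ^ β * proj A B (reflectionCofactorX ι hT) := by
  have key := proj_congr (A := A) (B := B) (f := t.toFam)
    (g := (coordW ι).toFam * reflectionCofactorW ι hT +
      (coordX ι).toFam ^ β * reflectionCofactorX ι hT) ?_
  · simp only [map_add, map_mul, map_pow] at key
    exact key
  · intro i
    filter_upwards [hT.eq] with x hx
    rw [← AnFam.eval_apply, ← AnFam.eval_apply, reflectionCofactorW, reflectionCofactorX]
    simp only [map_add, map_mul, map_pow, map_one]
    subst ht
    change T x = x.2 * (1 + x.2 ^ m * (x.1.2 * b x)) + x.1.2 ^ β * (x.2 ^ m * a x.1)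
    rw [hx]
    ring

theorem proj_remainder (hT : ReflectionForm m β T a b) :
    proj A B (AnFam.known ι _ hT.analyticAt_remainder) =
      clX ι A B ^ β * proj A B (AnFam.known ι _ hT.analyticAt_fst_comp) +
        clX ι A B * clW ι A B * proj A B (AnFam.known ι b hT.analytic_snd) := by
  rw [clX, clW, ← map_pow, ← map_mul, ← map_mul, ← map_mul, ← map_add]
  rfl

noncomputable def conjFCofactor (hS : ∀ i, SegreMap T Q (F i) (G i)) : AnFam ι Triple :=
  AnFam.comp (coordX ι) (slopeFam 1 (AnFam.tc 0 (vanConjF hS).toFam))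

noncomputable def conjFCofactorT (hS : ∀ i, SegreMap T Q (F i) (G i)) (t : VanFam ι Triple ℂ) :
    AnFam ι Triple :=
  AnFam.comp (pointXT t) (AnFam.dq 1 (vanConjF hS).toFam)

theorem conjF_eq (hS : ∀ i, SegreMap T Q (F i) (G i)) {t u : VanFam ι Triple ℂ}
    (hu : u = (vanConjF hS).comp (pointXT t)) :
    u.toFam = (coordX ι).toFam * conjFCofactor hS + t.toFam * conjFCofactorT hS t := by
  have h1 := AnFam.comp_expand (vanConjF hS).toFam (coordX ι) t 1
  have h2 := AnFam.comp_expand_num (AnFam.tc 0 (vanConjF hS).toFam) (coordX ι) 1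
  have h3 : (numFam fun i => ncoef 0 ((AnFam.tc 0 (vanConjF hS).toFam).1 i)) = 0 := by
    refine Subtype.ext (funext fun i => funext fun z => ?_)
    exact (vanConjF hS).map_zero i
  rw [Finset.sum_range_one, pow_zero, mul_one, pow_one] at h1 h2
  rw [h3, map_zero, zero_add] at h2
  rw [h2] at h1
  subst hu
  exact h1

/-- The coefficient of `χ` in `conj F (χ, T)`. -/
noncomputable def conjFLeading (hS : ∀ i, SegreMap T Q (F i) (G i)) (hT : ReflectionForm m β T a b)
    (t : VanFam ι Triple ℂ) : AnFam ι Triple :=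
  conjFCofactor hS + (coordX ι).toFam ^ (β - 1) * (reflectionCofactorX ι hT * conjFCofactorT hS t)

theorem proj_conjF (hS : ∀ i, SegreMap T Q (F i) (G i)) (hTa : AnalyticAt ℂ T 0)
    (hT0 : T 0 = 0) (hT : ReflectionForm m β T a b) (hβ : β ≠ 0)
    {t : VanFam ι Triple ℂ} (ht : t = VanFam.known ι T hTa hT0)
    {u : VanFam ι Triple ℂ} (hu : u = (vanConjF hS).comp (pointXT t)) :
    proj A B u.toFam = clX ι A B * proj A B (conjFLeading hS hT t) +
      clW ι A B * (proj A B (reflectionCofactorW ι hT) * proj A B (conjFCofactorT hS t)) := by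
  rw [conjF_eq hS hu, map_add, map_mul, map_mul, proj_reflection hT hTa hT0 ht, conjFLeading,
    map_add, map_mul, map_mul, map_pow]
  change clX ι A B * _ + _ = clX ι A B * (_ + clX ι A B ^ (β - 1) * _) + _
  have hp : clX ι A B ^ β = clX ι A B * clX ι A B ^ (β - 1) := by
    rw [← pow_succ', Nat.sub_add_cancel (Nat.pos_of_ne_zero hβ)]
  rw [hp]
  generalize clX ι A B = x
  generalize clW ι A B = y
  generalize proj A B (reflectionCofactorW ι hT) = s
  generalize proj A B (reflectionCofactorX ι hT) = s'
  generalize proj A B (conjFCofactorT hS t) = s''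
  ring

theorem eventually_reflection_zero (hT : ReflectionForm m β T a b) (hβ : β ≠ 0) :
    ∀ᶠ z : ℂ in 𝓝 0, T ((z, 0), 0) = 0 := by
  have hc : Tendsto (fun z : ℂ => ((z, 0) : ℂ × ℂ)) (𝓝 0) (𝓝 0) :=
    (show Continuous (fun z : ℂ => ((z, 0) : ℂ × ℂ)) by fun_prop).tendsto' 0 0 rfl
  exact hc.eventually (hT.eq_self hβ)

theorem ReflectionForm.analyticAt_restrict (hT : ReflectionForm m β T a b) :
    AnalyticAt ℂ (fun z : ℂ => a (z, 0)) 0 :=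
  AnalyticAt.comp (f := fun z : ℂ => ((z, 0) : ℂ × ℂ)) (x := 0) hT.analytic_fst
    (analyticAt_id.prod analyticAt_const)

/-- The restriction of the coefficient of `χ` in `conj F (χ, T)` to `χ = w = 0`. -/
noncomputable def conjFSlope (F : ι → ℂ × ℂ → ℂ) (hT : ReflectionForm m β T a b) :
    AnFam ι ℂ :=
  numFam (fun i => ncoef 1 (tcoef 0 (conjFun (F i)))) + numFam (fun _ => 0 ^ (β - 1) * 0 ^ m) *
    (AnFam.known ι _ hT.analyticAt_restrict * numFam (fun i => ncoef 0 (tcoef 1 (conjFun (F i)))))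

theorem restrictZ_conjFLeading (hS : ∀ i, SegreMap T Q (F i) (G i)) (hTa : AnalyticAt ℂ T 0)
    (hT0 : T 0 = 0) (hT : ReflectionForm m β T a b) (hβ : β ≠ 0)
    {t : VanFam ι Triple ℂ} (ht : t = VanFam.known ι T hTa hT0) (i : ι) :
    ∀ᶠ z in 𝓝 0, (conjFLeading hS hT t).1 i ((z, 0), 0) = (conjFSlope F hT).1 i z := by
  filter_upwards [eventually_reflection_zero hT hβ] with z hz
  rw [← AnFam.eval_apply, ← AnFam.eval_apply, conjFLeading, conjFSlope, reflectionCofactorX]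
  simp only [map_add, map_mul, map_pow]
  have h2 : AnFam.eval i ((z, 0), 0) (conjFCofactorT hS t) =
      AnFam.eval i z (numFam (fun i => ncoef 0 (tcoef 1 (conjFun (F i))))) := by
    subst ht
    change dquot 1 (conjFun (F i)) (0, T ((z, 0), 0)) = dquot 1 (conjFun (F i)) (0, 0)
    rw [hz]
  rw [h2]
  change _ + (0 : ℂ) ^ (β - 1) * ((0 : ℂ) ^ m * a (z, 0) * _) =
    _ + (0 : ℂ) ^ (β - 1) * (0 : ℂ) ^ m * (a (z, 0) * _)
  rw [mul_assoc, mul_assoc]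
  rfl

theorem proj_conjG (hS : ∀ i, SegreMap T Q (F i) (G i)) (hT : ReflectionForm m β T a b)
    (hβ : β ≠ 0) (hQ : ReflectionForm m β Q a' b') {t : VanFam ι Triple ℂ}
    {v : VanFam ι Triple ℂ} (hv : v = (vanConjG hS).comp (pointXT t)) :
    proj A B v.toFam = proj A B t.toFam * proj A B (AnFam.comp (pointXT t) (famConjg hS)) := by
  rw [← map_mul]
  refine proj_congr fun i => ?_
  have h1 : Tendsto ((pointXT t).toFun i) (𝓝 0) (𝓝 0) := by
    have := ((pointXT t).analytic i).continuousAt.tendsto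
    rwa [(pointXT t).map_zero i] at this
  filter_upwards [h1.eventually ((hS i).conjFun_eq_mul hT hβ hQ)] with x hx
  subst hv
  exact hx

/-- The family `w ↦ conj g (0, w)`. -/
noncomputable def famConjgZero (hS : ∀ i, SegreMap T Q (F i) (G i)) : AnFam ι ℂ :=
  ⟨fun i w => conjFun (dquot 1 (G i)) (0, w), fun i =>
    AnalyticAt.comp (f := fun w : ℂ => ((0, w) : ℂ × ℂ)) (x := 0) ((famConjg hS).2 i)
      (analyticAt_const.prod analyticAt_id)⟩

theorem proj_conjg (hS : ∀ i, SegreMap T Q (F i) (G i)) (hT : ReflectionForm m β T a b)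
    (hβ : β ≠ 0) (hQ : ReflectionForm m β Q a' b') (t : VanFam ι Triple ℂ) :
    proj A B (AnFam.comp (pointXT t) (famConjg hS)) =
      proj A B (AnFam.comp t (famConjgZero hS)) + proj A B t.toFam ^ m *
        (clX ι A B * proj A B (AnFam.comp (pointXT t) (fame hS hQ))) := by
  rw [clX, ← map_mul, ← map_pow, ← map_mul, ← map_add]
  refine proj_congr fun i => ?_
  have h1 : Tendsto ((pointXT t).toFun i) (𝓝 0) (𝓝 0) := by
    have := ((pointXT t).analytic i).continuousAt.tendsto
    rwa [(pointXT t).map_zero i] at this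
  filter_upwards [h1.eventually ((hS i).conjFun_dquot_eq hT hβ hQ)] with x hx
  exact hx

theorem restrictZ_factor (hβ : β ≠ 0) (z : ℂ) :
    reflectionFactor m β a b ((z, 0), 0) = 1 := by
  simp [reflectionFactor, reflectionRemainder, hβ]

theorem tcoef_conjFun_dquot {g : ℂ × ℂ → ℂ} (hg : AnalyticAt ℂ g 0) (j : ℕ) :
    tcoef j (conjFun (dquot 1 g)) 0 = tcoef (j + 1) (conjFun g) 0 :=
  (ncoef_tcoef_conjFun (analyticAt_dquot (e := (0 : ℂ)) hg 1) 0 j).trans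
    (ncoef_tcoef_conjFun hg 0 (j + 1)).symm

theorem leading_coefficient_eq_zero (hS : ∀ i, SegreMap T Q (F i) (G i)) (hTa : AnalyticAt ℂ T 0)
    (hT0 : T 0 = 0) (hT : ReflectionForm m β T a b) (hβ : β ≠ 0) (hQ : ReflectionForm m β Q a' b')
    (i : ι) : ∀ᶠ z in 𝓝 0, a (z, 0) * tcoef 1 (conjFun (G i)) 0 +
      tcoef 1 (conjFun (G i)) 0 ^ m * (conjFSlope F hT).1 i z ^ β * a' (F i (z, 0), 0) = 0 := by
  set t : VanFam ι Triple ℂ := VanFam.known ι T hTa hT0 with ht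
  set f := (vanF hS).comp (pointZW ι) with hf
  set u := (vanConjF hS).comp (pointXT t) with hu
  set v := (vanConjG hS).comp (pointXT t) with hv
  obtain ⟨ρ₁, ρ₂, h⟩ := proj_divided_identity hS hTa hT0 hT hβ hQ (β + 1) 1 2 ht hf hu hv
  have hx := clX_pow (ι := ι) (A := β + 1) (B := 1)
  have hy : clW ι (β + 1) 1 = 0 := by
    have := clW_pow (ι := ι) (A := β + 1) (B := 1)
    rwa [pow_one] at this
  have hσ : ∑ j ∈ Finset.range 2, clZ (β + 1) 1 (numFam fun i => tcoef j (conjFun (G i)) 0) *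
      homogSum j (proj (β + 1) 1 t.toFam) (clW ι (β + 1) 1) =
      clZ (β + 1) 1 (numFam fun i => tcoef 1 (conjFun (G i)) 0) := by
    rw [Finset.sum_range_succ, Finset.sum_range_one]
    simp [homogSum]
  have key := leading_term_eq_zero hβ hx hy (proj_reflection hT hTa hT0 ht)
    (proj_remainder hT) (proj_conjF hS hTa hT0 hT hβ ht hu)
    (proj_conjG hS hT hβ hQ hv) hσ h
  let P : AnFam ι Triple := AnFam.known ι _ hT.analyticAt_fst_comp *
      AnFam.comp (coordZ ι) (numFam fun i => tcoef 1 (conjFun (G i)) 0) +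
    AnFam.known ι _ hT.analyticAt_factor * AnFam.comp (pointXT t) (famConjg hS) ^ m *
      conjFLeading hS hT t ^ β * AnFam.comp (f.pair u) (AnFam.known ι a' hQ.analytic_fst)
  have h1 := clX_pow_mul_clW_pow_mul_proj (n := β) (k := 0) P
  rw [pow_zero, mul_one, zero_add] at h1
  have h2 : clX ι (β + 1) 1 ^ β * clZ (β + 1) 1 (restrictZ P) = 0 := by
    rw [← h1, ← key]
    simp only [P, map_add, map_mul, map_pow]
    rfl
  have h3 := eventually_zero_of_sum_eq_zero (A := β + 1) (B := 1)
    (g := fun a _ => if a = β then restrictZ P else 0) (by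
      rw [Finset.sum_eq_single_of_mem β (Finset.mem_range.2 (by omega))]
      · rw [Finset.sum_range_one, if_pos rfl, pow_zero, mul_one, mul_comm, h2]
      · intro j _ hj
        simp [hj]) (Nat.lt_succ_self β) one_pos i
  rw [if_pos rfl] at h3
  filter_upwards [h3, restrictZ_conjFLeading hS hTa hT0 hT hβ ht i,
    eventually_reflection_zero hT hβ] with z h4 h5 h6
  rw [restrictZ_apply, ← AnFam.eval_apply] at h4
  simp only [P, map_add, map_mul, map_pow] at h4
  rw [AnFam.eval_apply _ _ (conjFLeading hS hT t), h5] at h4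
  have e1 : AnFam.eval i ((z, 0), 0) (AnFam.known ι _ hT.analyticAt_factor) = 1 :=
    restrictZ_factor hβ z
  have e2 : AnFam.eval i ((z, 0), 0) (AnFam.comp (pointXT t) (famConjg hS)) =
      tcoef 1 (conjFun (G i)) 0 := by
    rw [← tcoef_conjFun_dquot (hS i).analytic_snd]
    change conjFun (dquot 1 (G i)) (0, T ((z, 0), 0)) = conjFun (dquot 1 (G i)) (0, 0)
    rw [h6]
  have e3 : AnFam.eval i ((z, 0), 0) (AnFam.comp (f.pair u) (AnFam.known ι a' hQ.analytic_fst)) =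
      a' (F i (z, 0), 0) := by
    change a' (F i (z, 0), conjFun (F i) (0, T ((z, 0), 0))) = _
    rw [h6]
    congr 2
    exact conjFun_zero (hS i).map_fst
  rw [e1, e2, e3, one_mul] at h4
  exact h4

end SegreFamilies

section SegreStep

variable {ι : Type} {m β k : ℕ} {T Q : Triple → ℂ} {a a' : ℂ × ℂ → ℂ} {b b' : Triple → ℂ}
  {F G : ι → ℂ × ℂ → ℂ} {S : Subring (AnFam ι ℂ)}

/-- A subring of families of germs which contains all the data of order less than `k`. -/
structure ContainsLowerOrder (S : Subring (AnFam ι ℂ)) (hS : ∀ i, SegreMap T Q (F i) (G i))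
    (hQ : ReflectionForm m β Q a' b') (k : ℕ) : Prop where
  germClosed : GermClosed S
  known_mem : ∀ (q : ℂ → ℂ) (hq : AnalyticAt ℂ q 0), AnFam.known ι q hq ∈ S
  comp_mem : ∀ (q : ℂ → ℂ) (hq : AnalyticAt ℂ q 0),
    AnFam.comp ((vanF hS).comp (VanFam.ofCLM ι (ContinuousLinearMap.inl ℂ ℂ ℂ)))
      (AnFam.known ι q hq) ∈ S
  fst_mem : ∀ j < k, AnFam.tc j (vanF hS).toFam ∈ S
  conjFst_mem : ∀ j < k, ∀ u, numFam (fun i => ncoef u (tcoef j (conjFun (F i)))) ∈ S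
  conjFst_mem' : ∀ u j, u + j ≤ k + 1 → numFam (fun i => ncoef u (tcoef j (conjFun (F i)))) ∈ S
  conjSnd_mem : ∀ j ≤ k + 1, numFam (fun i => tcoef j (conjFun (G i)) 0) ∈ S
  slope_mem : ∀ j < k, ∀ u, numFam (fun i => ncoef u (tcoef j ((fame hS hQ).1 i))) ∈ S

variable {hS : ∀ i, SegreMap T Q (F i) (G i)} {hQ : ReflectionForm m β Q a' b'}

theorem pow_mul_clX (hT : ReflectionForm m β T a b) (hTa : AnalyticAt ℂ T 0) (hT0 : T 0 = 0)
    {t : VanFam ι Triple ℂ} (ht : t = VanFam.known ι T hTa hT0) (j : ℕ) :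
    clX ι (β + 1) (k + 1) * proj (β + 1) (k + 1) t.toFam ^ j = clX ι (β + 1) (k + 1) *
      (clW ι (β + 1) (k + 1) * proj (β + 1) (k + 1) (reflectionCofactorW ι hT)) ^ j := by
  refine mul_pow_eq_of_mul_eq ?_ j
  have h := clX_pow (ι := ι) (A := β + 1) (B := k + 1)
  rw [proj_reflection hT hTa hT0 ht]
  generalize clX ι (β + 1) (k + 1) = x at *
  rw [pow_succ] at h
  linear_combination proj (β + 1) (k + 1) (reflectionCofactorX ι hT) * h

theorem proj_reflection_mem (hC : ContainsLowerOrder S hS hQ k) {hTa : AnalyticAt ℂ T 0}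
    {hT0 : T 0 = 0} {t : VanFam ι Triple ℂ} (ht : t = VanFam.known ι T hTa hT0) :
    proj (β + 1) (k + 1) t.toFam ∈ adm S (β + 1) (k + 1) := by
  subst ht
  exact proj_known_mem hC.known_mem hTa

theorem reflection_mul_slope_mem (hC : ContainsLowerOrder S hS hQ k)
    (hT : ReflectionForm m β T a b) {hTa : AnalyticAt ℂ T 0} {hT0 : T 0 = 0}
    {t : VanFam ι Triple ℂ} (ht : t = VanFam.known ι T hTa hT0) :
    proj (β + 1) (k + 1) t.toFam * (clX ι (β + 1) (k + 1) *
      proj (β + 1) (k + 1) (AnFam.comp (pointXT t) (fame hS hQ))) ∈ adm S (β + 1) (k + 1) := by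
  have h1 := congrArg (proj (β + 1) (k + 1)) (AnFam.comp_expand (fame hS hQ) (coordX ι) t k)
  have h2 := pow_mul_clX (k := k) hT hTa hT0 ht (k + 1)
  rw [mul_pow, clW_pow, zero_mul, mul_zero] at h2
  rw [map_add, map_mul, map_pow] at h1
  have h3 : proj (β + 1) (k + 1) t.toFam * (clX ι (β + 1) (k + 1) *
      proj (β + 1) (k + 1) (AnFam.comp (pointXT t) (fame hS hQ))) =
      proj (β + 1) (k + 1) t.toFam * (clX ι (β + 1) (k + 1) *
        proj (β + 1) (k + 1) (∑ j ∈ Finset.range k,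
          AnFam.comp (coordX ι) (AnFam.tc j (fame hS hQ)) * t.toFam ^ j)) := by
    rw [pointXT, h1]
    rw [pow_succ] at h2
    generalize proj (β + 1) (k + 1) (AnFam.comp ((coordX ι).pair t) _) = s
    generalize proj (β + 1) (k + 1) (Finset.sum _ _) = s'
    linear_combination s * h2
  rw [h3, map_sum]
  refine Subring.mul_mem _ (proj_reflection_mem hC ht) (Subring.mul_mem _ clX_mem_adm
    (Subring.sum_mem _ fun j hj => ?_))
  rw [map_mul, map_pow]
  exact Subring.mul_mem _ (proj_comp_coordX_mem (hC.slope_mem j (Finset.mem_range.1 hj)))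
    (Subring.pow_mem _ (proj_reflection_mem hC ht) _)

theorem conjg_sum_mem (hC : ContainsLowerOrder S hS hQ k) {hTa : AnalyticAt ℂ T 0} {hT0 : T 0 = 0}
    {t : VanFam ι Triple ℂ} (ht : t = VanFam.known ι T hTa hT0) :
    ∃ p ∈ adm S (β + 1) (k + 1), ∃ r, proj (β + 1) (k + 1) (AnFam.comp t (famConjgZero hS)) =
      p + proj (β + 1) (k + 1) t.toFam ^ (k + 1) * r := by
  have h0 := congrArg (proj (β + 1) (k + 1))
    (AnFam.comp_expand_num (famConjgZero hS) t (k + 1))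
  rw [map_add, map_mul, map_pow] at h0
  refine ⟨_, ?_, _, h0⟩
  rw [map_sum]
  refine Subring.sum_mem _ fun j hj => ?_
  rw [map_mul, map_pow]
  refine Subring.mul_mem _ ?_ (Subring.pow_mem _ (proj_reflection_mem hC ht) _)
  rw [proj_comp_coordZ]
  refine clZ_mem_adm ?_
  have h1 := hC.conjSnd_mem (j + 1) (by have := Finset.mem_range.1 hj; omega)
  refine hC.germClosed h1 fun i => Eventually.of_forall fun z => ?_
  exact (tcoef_conjFun_dquot (hS i).analytic_snd j).symm

theorem conjG_mem (hC : ContainsLowerOrder S hS hQ k)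
    (hT : ReflectionForm m β T a b) (hβ : β ≠ 0) {hTa : AnalyticAt ℂ T 0} {hT0 : T 0 = 0}
    {t : VanFam ι Triple ℂ} (ht : t = VanFam.known ι T hTa hT0)
    {v : VanFam ι Triple ℂ} (hv : v = (vanConjG hS).comp (pointXT t)) :
    proj (β + 1) (k + 1) v.toFam ∈ adm S (β + 1) (k + 1) := by
  obtain ⟨p, hp, r, h⟩ := conjg_sum_mem hC ht
  have hx := clX_pow (ι := ι) (A := β + 1) (B := k + 1)
  have hy := clW_pow (ι := ι) (A := β + 1) (B := k + 1)
  obtain ⟨s, hs⟩ := exists_pow_eq_mul hβ hx hy (proj_reflection hT hTa hT0 ht)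
  have hE := reflection_mul_slope_mem hC hT ht
  have hTm := proj_reflection_mem hC ht
  have hTeq := proj_reflection (A := β + 1) (B := k + 1) hT hTa hT0 ht
  rw [proj_conjG hS hT hβ hQ hv, proj_conjg hS hT hβ hQ t, h]
  have hxx : clX ι (β + 1) (k + 1) ^ β * clX ι (β + 1) (k + 1) ^ β = 0 := by
    rw [← pow_add]
    exact pow_eq_zero_of_le (by omega) hx
  have h0 : proj (β + 1) (k + 1) t.toFam * proj (β + 1) (k + 1) t.toFam ^ (k + 1) = 0 := by
    rw [hs, hTeq]
    rw [pow_succ] at hy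
    generalize clX ι (β + 1) (k + 1) = x at *
    generalize clW ι (β + 1) (k + 1) = y at *
    generalize proj (β + 1) (k + 1) (reflectionCofactorW ι hT) = s₁
    generalize proj (β + 1) (k + 1) (reflectionCofactorX ι hT) = s₂
    linear_combination (s₁ * x ^ β * s) * hy + (s₂ * y ^ k * s) * hxx
  have h1 : ∀ e : TruncRing ι (β + 1) (k + 1), proj (β + 1) (k + 1) t.toFam *
      (p + proj (β + 1) (k + 1) t.toFam ^ (k + 1) * r + proj (β + 1) (k + 1) t.toFam ^ m * e) =
      proj (β + 1) (k + 1) t.toFam * p + proj (β + 1) (k + 1) t.toFam ^ m *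
        (proj (β + 1) (k + 1) t.toFam * e) := by
    intro e
    generalize proj (β + 1) (k + 1) t.toFam = τ at *
    linear_combination r * h0
  rw [h1]
  exact Subring.add_mem _ (Subring.mul_mem _ hTm hp)
    (Subring.mul_mem _ (Subring.pow_mem _ hTm _) hE)

theorem exists_conjg_pow_eq (hC : ContainsLowerOrder S hS hQ k)
    (hT : ReflectionForm m β T a b) (hβ : β ≠ 0) {hTa : AnalyticAt ℂ T 0} {hT0 : T 0 = 0}
    {t : VanFam ι Triple ℂ} (ht : t = VanFam.known ι T hTa hT0)
    {u : TruncRing ι (β + 1) (k + 1)} {u₁ u₂ : TruncRing ι (β + 1) (k + 1)}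
    (hu : u = clX ι (β + 1) (k + 1) * u₁ + clW ι (β + 1) (k + 1) * u₂) :
    ∃ p ∈ adm S (β + 1) (k + 1),
      proj (β + 1) (k + 1) (AnFam.comp (pointXT t) (famConjg hS)) ^ m * u = p * u ∧
      clX ι (β + 1) (k + 1) ^ β *
        proj (β + 1) (k + 1) (AnFam.comp (pointXT t) (famConjg hS)) ^ m =
          clX ι (β + 1) (k + 1) ^ β * p := by
  rcases Nat.eq_zero_or_pos m with rfl | hm
  · exact ⟨1, Subring.one_mem _, by rw [pow_zero], by rw [pow_zero]⟩
  obtain ⟨p, hp, r, h⟩ := conjg_sum_mem hC ht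
  have hx := clX_pow (ι := ι) (A := β + 1) (B := k + 1)
  have hy := clW_pow (ι := ι) (A := β + 1) (B := k + 1)
  obtain ⟨s, hs⟩ := exists_pow_eq_mul hβ hx hy (proj_reflection hT hTa hT0 ht)
  have hE := reflection_mul_slope_mem hC hT ht
  have hTm := proj_reflection_mem hC ht
  have hg := proj_conjg (A := β + 1) (B := k + 1) hS hT hβ hQ t
  rw [h, hs] at hg
  have hxx : clX ι (β + 1) (k + 1) ^ β * clX ι (β + 1) (k + 1) ^ β = 0 := by
    rw [← pow_add]
    exact pow_eq_zero_of_le (by omega) hx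
  obtain ⟨n, rfl⟩ := Nat.exists_eq_add_of_le' hm
  refine ⟨(p + proj (β + 1) (k + 1) t.toFam ^ n * (proj (β + 1) (k + 1) t.toFam *
    (clX ι (β + 1) (k + 1) * proj (β + 1) (k + 1) (AnFam.comp (pointXT t) (fame hS hQ))))) ^ (n + 1),
    Subring.pow_mem _ (Subring.add_mem _ hp (Subring.mul_mem _ (Subring.pow_mem _ hTm _) hE)) _, ?_, ?_⟩
  all_goals
    generalize proj (β + 1) (k + 1) t.toFam = τ at *
    generalize proj (β + 1) (k + 1) (AnFam.comp (pointXT t) (famConjg hS)) = γ at *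
    generalize proj (β + 1) (k + 1) (AnFam.comp (pointXT t) (fame hS hQ)) = ε at *
    generalize clX ι (β + 1) (k + 1) = x at *
    generalize clW ι (β + 1) (k + 1) = y at *
  · rw [mul_comm, mul_comm _ u]
    refine mul_pow_eq_of_mul_eq ?_ _
    rw [pow_succ] at hx hy
    rw [hg, hu]
    linear_combination (u₁ * y ^ k * s * r) * hx + (u₂ * x ^ β * s * r) * hy
  · refine mul_pow_eq_of_mul_eq ?_ _
    rw [hg]
    linear_combination (y ^ k * s * r) * hxx

/-- The unknown part of `conj F (χ, T)` is divisible by `χ ^ 2 w ^ k`. -/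
theorem exists_conjF_eq_add (hC : ContainsLowerOrder S hS hQ k)
    (hT : ReflectionForm m β T a b) (hβ : β ≠ 0) {hTa : AnalyticAt ℂ T 0} {hT0 : T 0 = 0}
    {t : VanFam ι Triple ℂ} (ht : t = VanFam.known ι T hTa hT0)
    {u : VanFam ι Triple ℂ} (hu : u = (vanConjF hS).comp (pointXT t)) :
    ∃ r : AnFam ι Triple, proj (β + 1) (k + 1) u.toFam -
      clX ι (β + 1) (k + 1) ^ 2 * clW ι (β + 1) (k + 1) ^ k * proj (β + 1) (k + 1) r ∈
        adm S (β + 1) (k + 1) := by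
  have hx := clX_pow (ι := ι) (A := β + 1) (B := k + 1)
  have hy := clW_pow (ι := ι) (A := β + 1) (B := k + 1)
  have hTeq := proj_reflection (A := β + 1) (B := k + 1) hT hTa hT0 ht
  obtain ⟨s, hs⟩ := exists_pow_eq_mul hβ hx hy hTeq
  have hTm := proj_reflection_mem hC ht
  have h1 := congrArg (proj (β + 1) (k + 1))
    (AnFam.comp_expand (vanConjF hS).toFam (coordX ι) t (k + 2))
  rw [Finset.sum_range_succ, Finset.sum_range_succ] at h1
  have h2 := congrArg (proj (β + 1) (k + 1))
    (AnFam.comp_expand_num (AnFam.tc k (vanConjF hS).toFam) (coordX ι) 2)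
  have h3 := congrArg (proj (β + 1) (k + 1))
    (AnFam.comp_expand_num (AnFam.tc (k + 1) (vanConjF hS).toFam) (coordX ι) 1)
  rw [Finset.sum_range_succ, Finset.sum_range_one] at h2
  rw [Finset.sum_range_one] at h3
  simp only [map_add, map_mul, map_pow, pow_zero, mul_one, pow_one] at h1 h2 h3
  have hu' : proj (β + 1) (k + 1) u.toFam = proj (β + 1) (k + 1)
    (AnFam.comp ((coordX ι).pair t) (vanConjF hS).toFam) := by subst hu; rfl
  have hk0 : clZ (β + 1) (k + 1) (numFam fun i => ncoef 0 (tcoef k (conjFun (F i)))) ∈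
    adm S (β + 1) (k + 1) := clZ_mem_adm (hC.conjFst_mem' 0 k (by omega))
  have hk1 : clZ (β + 1) (k + 1) (numFam fun i => ncoef 1 (tcoef k (conjFun (F i)))) ∈
    adm S (β + 1) (k + 1) := clZ_mem_adm (hC.conjFst_mem' 1 k (by omega))
  have hk2 : clZ (β + 1) (k + 1) (numFam fun i => ncoef 0 (tcoef (k + 1) (conjFun (F i)))) ∈
    adm S (β + 1) (k + 1) := clZ_mem_adm (hC.conjFst_mem' 0 (k + 1) (by omega))
  have hsum : proj (β + 1) (k + 1) (∑ j ∈ Finset.range k,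
      AnFam.comp (coordX ι) (AnFam.tc j (vanConjF hS).toFam) * t.toFam ^ j) ∈
        adm S (β + 1) (k + 1) := by
    rw [map_sum]
    refine Subring.sum_mem _ fun j hj => ?_
    rw [map_mul, map_pow]
    exact Subring.mul_mem _ (proj_comp_coordX_mem (hC.conjFst_mem j (Finset.mem_range.1 hj)))
      (Subring.pow_mem _ hTm _)
  have hxT := pow_mul_clX (k := k) hT hTa hT0 ht k
  refine ⟨AnFam.comp (coordX ι) (slopeFam 2 (AnFam.tc k (vanConjF hS).toFam)) *
    reflectionCofactorW ι hT ^ k, ?_⟩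
  rw [hu', h1, h2, h3, map_mul, map_pow]
  change _ + (_ + _ * clX ι (β + 1) (k + 1) + clX ι (β + 1) (k + 1) ^ 2 * _) * _ +
    (_ + clX ι (β + 1) (k + 1) * _) * _ + _ - _ ∈ _
  have key := Subring.add_mem _ (Subring.add_mem _ hsum (Subring.mul_mem _
    (Subring.add_mem _ hk0 (Subring.mul_mem _ hk1 clX_mem_adm)) (Subring.pow_mem _ hTm k)))
      (Subring.mul_mem _ hk2 (Subring.pow_mem _ hTm (k + 1)))
  have hh : ∀ {p q : TruncRing ι (β + 1) (k + 1)}, p ∈ adm S (β + 1) (k + 1) → q = p →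
    q ∈ adm S (β + 1) (k + 1) := fun hp h => h ▸ hp
  refine hh key ?_
  have hxx : clX ι (β + 1) (k + 1) ^ β * clX ι (β + 1) (k + 1) ^ β = 0 := by
    rw [← pow_add]
    exact pow_eq_zero_of_le (by omega) hx
  have hT2 : proj (β + 1) (k + 1) t.toFam ^ (k + 2) = 0 := by
    rw [pow_succ, hs, hTeq]
    rw [pow_succ] at hy
    generalize clX ι (β + 1) (k + 1) = x at *
    generalize clW ι (β + 1) (k + 1) = y at *
    generalize proj (β + 1) (k + 1) (reflectionCofactorW ι hT) = s₁
    generalize proj (β + 1) (k + 1) (reflectionCofactorX ι hT) = s₂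
    linear_combination (s₁ * x ^ β * s) * hy + (s₂ * y ^ k * s) * hxx
  have hT3 : clX ι (β + 1) (k + 1) * proj (β + 1) (k + 1) t.toFam ^ (k + 1) = 0 := by
    rw [hs]
    rw [pow_succ] at hx
    generalize clX ι (β + 1) (k + 1) = x at *
    linear_combination (clW ι (β + 1) (k + 1) ^ k * s) * hx
  rw [hT2]
  simp only [proj_comp_coordZ]
  change _ + (clZ (β + 1) (k + 1) (numFam fun i => ncoef 0 (tcoef k (conjFun (F i)))) +
    clZ (β + 1) (k + 1) (numFam fun i => ncoef 1 (tcoef k (conjFun (F i)))) * _ + _) * _ +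
    (clZ (β + 1) (k + 1) (numFam fun i => ncoef 0 (tcoef (k + 1) (conjFun (F i)))) + _) * _ + _ - _
      = _
  rw [mul_pow] at hxT
  generalize clX ι (β + 1) (k + 1) = x at *
  generalize clW ι (β + 1) (k + 1) = y at *
  generalize clZ (β + 1) (k + 1) (numFam fun i => ncoef 0 (tcoef k (conjFun (F i)))) = c₁
  generalize clZ (β + 1) (k + 1) (numFam fun i => ncoef 1 (tcoef k (conjFun (F i)))) = c₂
  generalize clZ (β + 1) (k + 1) (numFam fun i => ncoef 0 (tcoef (k + 1) (conjFun (F i)))) = c₃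
  generalize proj (β + 1) (k + 1) (reflectionCofactorW ι hT) = s₁ at *
  generalize proj (β + 1) (k + 1) t.toFam = τ at *
  generalize proj (β + 1) (k + 1) (AnFam.comp (coordX ι) (slopeFam 2 _)) = d₁
  generalize proj (β + 1) (k + 1) (AnFam.comp (coordX ι) (slopeFam 1 _)) = d₂
  generalize proj (β + 1) (k + 1) (Finset.sum _ _) = d₃
  linear_combination (x * d₁) * hxT + d₂ * hT3

end SegreStep

section SegreStep

variable {ι : Type} {m β k : ℕ} {T Q : Triple → ℂ} {a a' : ℂ × ℂ → ℂ} {b b' : Triple → ℂ}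
  {F G : ι → ℂ × ℂ → ℂ} {S : Subring (AnFam ι ℂ)}

/-- The family `z ↦ F (z, 0)`. -/
noncomputable def vanFZero (hS : ∀ i, SegreMap T Q (F i) (G i)) : VanFam ι ℂ ℂ :=
  (vanF hS).comp (VanFam.ofCLM ι (ContinuousLinearMap.inl ℂ ℂ ℂ))

variable {hS : ∀ i, SegreMap T Q (F i) (G i)} {hQ : ReflectionForm m β Q a' b'}

theorem proj_comp_known_mem (hcomp : ∀ (q : ℂ → ℂ) (hq : AnalyticAt ℂ q 0),
      AnFam.comp (vanFZero hS) (AnFam.known ι q hq) ∈ S) {A B : ℕ}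
    {n u : VanFam ι Triple ℂ} (hn : proj A B n.toFam ∈ adm S A B)
    (hn' : IsNilpotent (proj A B n.toFam)) (hu : proj A B u.toFam ∈ adm S A B)
    (hu' : IsNilpotent (proj A B u.toFam)) {d : ℂ × ℂ → ℂ} (hd : AnalyticAt ℂ d 0) :
    proj A B (AnFam.comp ((((vanFZero hS).comp (coordZ ι)).shift 1 n).pair u)
      (AnFam.known ι d hd)) ∈ adm S A B := by
  let d' : (ℂ × ℂ) × ℂ → ℂ := fun p => d (p.1.1 + p.2 • 1, p.1.2)
  have hd' : AnalyticAt ℂ d' 0 := by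
    have h : AnalyticAt ℂ (fun p : (ℂ × ℂ) × ℂ => (p.1.1 + p.2 • (1 : ℂ), p.1.2)) 0 :=
      ((analyticAt_fst.comp analyticAt_fst).add (analyticAt_snd.smul analyticAt_const)).prod
        (analyticAt_snd.comp analyticAt_fst)
    refine AnalyticAt.comp (g := d) (f := fun p : (ℂ × ℂ) × ℂ => (p.1.1 + p.2 • (1 : ℂ), p.1.2))
      (x := 0) ?_ h
    change AnalyticAt ℂ d ((0 : ℂ) + (0 : ℂ) • (1 : ℂ), (0 : ℂ))
    rw [zero_smul, add_zero]
    exact hd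
  obtain ⟨N, hN⟩ := hn'
  obtain ⟨M, hM⟩ := hu'
  exact adm_comp_pair (f := AnFam.known ι d' hd')
    (X := ((vanFZero hS).comp (coordZ ι)).pair u) (Y := n) hN hn fun j _ =>
    adm_comp_pair (f := AnFam.tc j (AnFam.known ι d' hd')) (X := (vanFZero hS).comp (coordZ ι))
      (Y := u) hM hu fun l _ => clZ_mem_adm (hcomp (tcoef l (tcoef j d'))
        (analyticAt_tcoef (e := (0 : ℂ)) (analyticAt_tcoef (e := (0 : ℂ × ℂ)) hd' j) l))

theorem proj_comp_known_mem' (hcomp : ∀ (q : ℂ → ℂ) (hq : AnalyticAt ℂ q 0),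
      AnFam.comp (vanFZero hS) (AnFam.known ι q hq) ∈ S) {A B : ℕ}
    {n u v : VanFam ι Triple ℂ} (hn : proj A B n.toFam ∈ adm S A B)
    (hn' : IsNilpotent (proj A B n.toFam)) (hu : proj A B u.toFam ∈ adm S A B)
    (hu' : IsNilpotent (proj A B u.toFam)) (hv : proj A B v.toFam ∈ adm S A B)
    (hv' : IsNilpotent (proj A B v.toFam)) {d : Triple → ℂ} (hd : AnalyticAt ℂ d 0) :
    proj A B (AnFam.comp (((((vanFZero hS).comp (coordZ ι)).shift 1 n).pair u).pair v)
      (AnFam.known ι d hd)) ∈ adm S A B := by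
  obtain ⟨N, hN⟩ := hv'
  exact adm_comp_pair (f := AnFam.known ι d hd) hN hv fun j _ =>
    proj_comp_known_mem hcomp hn hn' hu hu' (analyticAt_tcoef (e := (0 : ℂ × ℂ)) hd j)

/-- The expansion of `F (z, w)` up to the order `k`. -/
theorem exists_remainder_mem (hC : ContainsLowerOrder S hS hQ k) (hk : k ≠ 0) {A : ℕ}
    {f : VanFam ι Triple ℂ} (hf : f = (vanF hS).comp (pointZW ι)) :
    ∃ n d : VanFam ι Triple ℂ,
      d.toFam = (coordW ι).toFam ^ k * AnFam.comp (coordZ ι) (AnFam.tc k (vanF hS).toFam) ∧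
      (∀ i x, f.toFun i x = (((((vanFZero hS).comp (coordZ ι)).shift 1 n).shift 1 d).toFun i x)) ∧
      proj A (k + 1) n.toFam ∈ adm S A (k + 1) ∧ IsNilpotent (proj A (k + 1) n.toFam) ∧
      ∀ i z, n.toFun i ((z, 0), 0) = 0 := by
  let d : VanFam ι Triple ℂ := VanFam.ofFam
    ((coordW ι).toFam ^ k * AnFam.comp (coordZ ι) (AnFam.tc k (vanF hS).toFam)) (by
      intro i
      change (0 : ℂ) ^ k * _ = 0
      rw [zero_pow hk, zero_mul])
  let n : VanFam ι Triple ℂ := VanFam.ofFam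
    (f.toFam - ((vanFZero hS).comp (coordZ ι)).toFam - d.toFam) (by
      intro i
      change f.toFun i 0 - ((vanFZero hS).comp (coordZ ι)).toFun i 0 - d.toFun i 0 = 0
      rw [f.map_zero, VanFam.map_zero, d.map_zero]
      ring)
  have hn : proj A (k + 1) n.toFam = clW ι A (k + 1) * ∑ j ∈ Finset.range (k - 1),
      clZ A (k + 1) (AnFam.tc (j + 1) (vanF hS).toFam) * clW ι A (k + 1) ^ j := by
    have h1 := congrArg (proj A (k + 1))
      (AnFam.comp_expand (vanF hS).toFam (coordZ ι) (coordW ι) (k + 1))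
    obtain ⟨l, rfl⟩ : ∃ l, k = l + 1 := ⟨k - 1, by omega⟩
    have habs : ∀ p q r : TruncRing ι A (l + 1 + 1), p + q + r - q - r = p := by
      intro p q r
      ring
    rw [Finset.sum_range_succ, Finset.sum_range_succ', map_add, map_add, map_add, map_mul _
      ((coordW ι).toFam ^ (l + 1 + 1)), map_pow] at h1
    change _ = _ + _ + _ + clW ι A (l + 1 + 1) ^ (l + 1 + 1) * _ at h1
    rw [clW_pow, zero_mul, add_zero] at h1
    change proj A (l + 1 + 1) (f.toFam - ((vanFZero hS).comp (coordZ ι)).toFam - d.toFam) = _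
    have h2 : f.toFam = AnFam.comp ((coordZ ι).pair (coordW ι)) (vanF hS).toFam := by
      subst hf; rfl
    have h3 : proj A (l + 1 + 1) d.toFam = proj A (l + 1 + 1) (AnFam.comp (coordZ ι)
      (AnFam.tc (l + 1) (vanF hS).toFam) * (coordW ι).toFam ^ (l + 1)) := by
      rw [mul_comm]; rfl
    have h4 : ((vanFZero hS).comp (coordZ ι)).toFam =
      AnFam.comp (coordZ ι) (AnFam.tc 0 (vanF hS).toFam) * (coordW ι).toFam ^ 0 := by
      rw [pow_zero, mul_one]; rfl
    rw [map_sub, map_sub, h2, h3, h4, h1, map_sum, Nat.add_sub_cancel, Finset.mul_sum]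
    simp only [map_mul, map_pow, proj_comp_coordZ]
    rw [habs]
    refine Finset.sum_congr rfl fun j _ => ?_
    change _ * clW ι A (l + 1 + 1) ^ (j + 1) = _
    ring
  refine ⟨n, d, rfl, fun i x => ?_, ?_, ?_, fun i z => ?_⟩
  · change f.toFun i x = _ + (f.toFun i x - ((vanFZero hS).comp (coordZ ι)).toFun i x -
      d.toFun i x) • 1 + d.toFun i x • 1
    rw [smul_eq_mul, smul_eq_mul]
    ring
  · rw [hn]
    refine Subring.mul_mem _ clW_mem_adm (Subring.sum_mem _ fun j hj => ?_)
    have := Finset.mem_range.1 hj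
    exact Subring.mul_mem _ (clZ_mem_adm (hC.fst_mem (j + 1) (by omega)))
      (Subring.pow_mem _ clW_mem_adm _)
  · rw [hn]
    exact (Commute.all _ _).isNilpotent_mul_right isNilpotent_clW
  · subst hf
    change F i (z, 0) - F i (z, 0) - (0 : ℂ) ^ k * _ = 0
    rw [zero_pow hk, zero_mul, sub_self, sub_zero]

/-- The derivative of `z' ↦ a' (z', 0)`. -/
noncomputable def restrictDeriv (a' : ℂ × ℂ → ℂ) : ℂ → ℂ := fun s =>
  ncoef 1 (fun η => a' (s + η, 0))

theorem analyticAt_shift_fst {a' : ℂ × ℂ → ℂ} (h : AnalyticAt ℂ a' 0) :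
    AnalyticAt ℂ (fun y : (ℂ × ℂ) × ℂ => a' (y.1.1 + y.2, y.1.2)) 0 := by
  have h1 : AnalyticAt ℂ (fun y : (ℂ × ℂ) × ℂ => (y.1.1 + y.2, y.1.2)) 0 :=
    ((analyticAt_fst.comp analyticAt_fst).add analyticAt_snd).prod
      (analyticAt_snd.comp analyticAt_fst)
  refine AnalyticAt.comp (g := a') (f := fun y : (ℂ × ℂ) × ℂ => (y.1.1 + y.2, y.1.2)) (x := 0) ?_ h1
  change AnalyticAt ℂ a' ((0 : ℂ) + (0 : ℂ), (0 : ℂ))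
  rw [add_zero]
  exact h

theorem analyticAt_restrictDeriv {a' : ℂ × ℂ → ℂ} (h : AnalyticAt ℂ a' 0) :
    AnalyticAt ℂ (restrictDeriv a') 0 :=
  AnalyticAt.comp (g := tcoef 1 (fun y : (ℂ × ℂ) × ℂ => a' (y.1.1 + y.2, y.1.2)))
    (f := fun s : ℂ => ((s, 0) : ℂ × ℂ)) (x := 0)
    (analyticAt_tcoef (e := (0 : ℂ × ℂ)) (analyticAt_shift_fst h) 1)
    (analyticAt_id.prod analyticAt_const)

theorem leading_mul_coeff_mem (hC : ContainsLowerOrder S hS hQ k) (hk : k ≠ 0)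
    (hT : ReflectionForm m β T a b) (hβ : β ≠ 0) (hTa : AnalyticAt ℂ T 0) (hT0 : T 0 = 0) :
    numFam (fun i => tcoef 1 (conjFun (G i)) 0) ^ m * conjFSlope F hT ^ β *
      AnFam.comp (vanFZero hS) (AnFam.known ι _ (analyticAt_restrictDeriv hQ.analytic_fst)) *
        AnFam.tc k (vanF hS).toFam ∈ S := by
  set t : VanFam ι Triple ℂ := VanFam.known ι T hTa hT0 with ht
  set f := (vanF hS).comp (pointZW ι) with hf
  set u := (vanConjF hS).comp (pointXT t) with hu
  set v := (vanConjG hS).comp (pointXT t) with hv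
  obtain ⟨ρ₁, ρ₂, h⟩ := proj_divided_identity hS hTa hT0 hT hβ hQ (β + 1) (k + 1) (k + 2) ht hf hu hv
  have hx := clX_pow (ι := ι) (A := β + 1) (B := k + 1)
  have hy := clW_pow (ι := ι) (A := β + 1) (B := k + 1)
  have hTeq := proj_reflection (A := β + 1) (B := k + 1) hT hTa hT0 ht
  have hεeq := proj_remainder (ι := ι) (A := β + 1) (B := k + 1) hT
  have hUeq := proj_conjF (A := β + 1) (B := k + 1) hS hTa hT0 hT hβ ht hu
  have hTm := proj_reflection_mem hC ht
  have hε : proj (β + 1) (k + 1) (AnFam.known ι _ hT.analyticAt_remainder) ∈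
    adm S (β + 1) (k + 1) := proj_known_mem hC.known_mem _
  have hθ : proj (β + 1) (k + 1) (AnFam.known ι _ hT.analyticAt_factor) ∈
    adm S (β + 1) (k + 1) := proj_known_mem hC.known_mem _
  have hy2 : clW ι (β + 1) (k + 1) ^ (k + 2) = 0 := pow_eq_zero_of_le (by omega) hy
  have h' := h
  rw [remainder_mul_homogSum hβ hx hy hTeq hεeq, hy2, zero_mul, zero_mul, add_zero, add_zero] at h'
  have hΓ : proj (β + 1) (k + 1) (AnFam.known ι _ hT.analyticAt_remainder) *
      ∑ j ∈ Finset.range (k + 2), clZ (β + 1) (k + 1) (numFam fun i => tcoef j (conjFun (G i)) 0) *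
        homogSum j (proj (β + 1) (k + 1) t.toFam) (clW ι (β + 1) (k + 1)) ∈
          adm S (β + 1) (k + 1) := by
    refine Subring.mul_mem _ hε (Subring.sum_mem _ fun j hj => ?_)
    have := Finset.mem_range.1 hj
    refine Subring.mul_mem _ (clZ_mem_adm (hC.conjSnd_mem j (by omega))) ?_
    exact Subring.sum_mem _ fun l _ => Subring.mul_mem _ (Subring.pow_mem _ hTm _)
      (Subring.pow_mem _ clW_mem_adm _)
  have hE : proj (β + 1) (k + 1) (AnFam.known ι _ hT.analyticAt_factor) *
      (proj (β + 1) (k + 1) t.toFam * (clX ι (β + 1) (k + 1) *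
        proj (β + 1) (k + 1) (AnFam.comp (pointXT t) (fame hS hQ)))) ∈ adm S (β + 1) (k + 1) :=
    Subring.mul_mem _ hθ (reflection_mul_slope_mem hC hT ht)
  have hV := conjG_mem hC hT hβ ht hv
  have hVeq : proj (β + 1) (k + 1) v.toFam = clW ι (β + 1) (k + 1) *
      (proj (β + 1) (k + 1) (reflectionCofactorW ι hT) *
        proj (β + 1) (k + 1) (AnFam.comp (pointXT t) (famConjg hS))) +
      clX ι (β + 1) (k + 1) ^ β * (proj (β + 1) (k + 1) (reflectionCofactorX ι hT) *
        proj (β + 1) (k + 1) (AnFam.comp (pointXT t) (famConjg hS))) := by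
    rw [proj_conjG hS hT hβ hQ hv, hTeq]
    ring
  obtain ⟨r, hr⟩ := exists_conjF_eq_add hC hT hβ ht hu
  obtain ⟨gs, hgs, hg1, hg2⟩ := exists_conjg_pow_eq hC hT hβ ht hUeq
  obtain ⟨n, d, hd, hfeq, hn, hn', hn0⟩ := exists_remainder_mem hC hk (A := β + 1) hf
  let d₂ : VanFam ι Triple ℂ := VanFam.ofFam
    ((coordX ι).toFam ^ 2 * (coordW ι).toFam ^ k * r) (by
      intro i
      change (0 : ℂ) ^ 2 * (0 : ℂ) ^ k * r.1 i 0 = 0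
      rw [zero_pow two_ne_zero, zero_mul, zero_mul])
  have hd₂ : proj (β + 1) (k + 1) d₂.toFam = clX ι (β + 1) (k + 1) ^ 2 *
      clW ι (β + 1) (k + 1) ^ k * proj (β + 1) (k + 1) r := by
    rw [clX, clW, ← map_pow, ← map_pow, ← map_mul, ← map_mul]
    rfl
  let us : VanFam ι Triple ℂ := VanFam.ofFam (u.toFam - d₂.toFam) (by
    intro i
    change u.toFun i 0 - d₂.toFun i 0 = 0
    rw [u.map_zero, d₂.map_zero, sub_zero])
  have husP : proj (β + 1) (k + 1) us.toFam = proj (β + 1) (k + 1) u.toFam -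
      clX ι (β + 1) (k + 1) ^ 2 * clW ι (β + 1) (k + 1) ^ k * proj (β + 1) (k + 1) r := by
    rw [← hd₂, ← map_sub]
    rfl
  have hus : proj (β + 1) (k + 1) us.toFam ∈ adm S (β + 1) (k + 1) := by rw [husP]; exact hr
  let lead : AnFam ι Triple := conjFLeading hS hT t -
    (coordX ι).toFam * ((coordW ι).toFam ^ k * r)
  have hlead : proj (β + 1) (k + 1) lead = proj (β + 1) (k + 1) (conjFLeading hS hT t) -
      clX ι (β + 1) (k + 1) * (clW ι (β + 1) (k + 1) ^ k * proj (β + 1) (k + 1) r) := by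
    simp only [lead, map_sub, map_mul, map_pow]
    rfl
  have husEq : proj (β + 1) (k + 1) us.toFam = clX ι (β + 1) (k + 1) * proj (β + 1) (k + 1) lead +
      clW ι (β + 1) (k + 1) * (proj (β + 1) (k + 1) (reflectionCofactorW ι hT) *
        proj (β + 1) (k + 1) (conjFCofactorT hS t)) := by
    rw [husP, hUeq, hlead]
    ring
  have hus' : IsNilpotent (proj (β + 1) (k + 1) us.toFam) := by
    rw [husEq]
    exact isNilpotent_add_mul isNilpotent_clX isNilpotent_clW _ _
  have hv' : IsNilpotent (proj (β + 1) (k + 1) v.toFam) := by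
    rw [hVeq]
    exact isNilpotent_add_mul isNilpotent_clW (isNilpotent_clX.pow_of_pos hβ) _ _
  set f₀ : VanFam ι Triple ℂ := ((vanFZero hS).comp (coordZ ι)).shift 1 n with hf₀
  have hdP : proj (β + 1) (k + 1) d.toFam = clW ι (β + 1) (k + 1) ^ k *
      clZ (β + 1) (k + 1) (AnFam.tc k (vanF hS).toFam) := by
    rw [hd, map_mul, map_pow]
    rfl
  have hyy : clW ι (β + 1) (k + 1) ^ k * clW ι (β + 1) (k + 1) ^ k = 0 := by
    rw [← pow_add]
    exact pow_eq_zero_of_le (by omega) hy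
  -- the first order expansions of the two functions of `F` and `conj F`
  obtain ⟨r₁, hα⟩ : ∃ r₁, proj (β + 1) (k + 1)
      (AnFam.comp (f.pair u) (AnFam.known ι a' hQ.analytic_fst)) =
      proj (β + 1) (k + 1) (AnFam.comp (f₀.pair us) (AnFam.known ι a' hQ.analytic_fst)) +
      clW ι (β + 1) (k + 1) ^ k * clZ (β + 1) (k + 1) (AnFam.tc k (vanF hS).toFam) *
        proj (β + 1) (k + 1) (AnFam.comp (f₀.pair us)
          (AnFam.tc 1 (AnFam.dir ((1, 0) : ℂ × ℂ) (AnFam.known ι a' hQ.analytic_fst)))) +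
      clX ι (β + 1) (k + 1) ^ 2 * clW ι (β + 1) (k + 1) ^ k * r₁ := by
    have e1 : AnFam.comp (f.pair u) (AnFam.known ι a' hQ.analytic_fst) =
        AnFam.comp (((f₀.pair us).shift ((1, 0) : ℂ × ℂ) d).shift ((0, 1) : ℂ × ℂ) d₂)
          (AnFam.known ι a' hQ.analytic_fst) := by
      refine AnFam.comp_congr (fun i x => Prod.ext ?_ ?_) _
      · change f.toFun i x = f₀.toFun i x + d.toFun i x * 1 + d₂.toFun i x * 0
        rw [mul_zero, add_zero]
        exact hfeq i x
      · change u.toFun i x = u.toFun i x - d₂.toFun i x + d.toFun i x * 0 + d₂.toFun i x * 1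
        ring
    obtain ⟨p, hp⟩ := AnFam.exists_comp_shift_eq (AnFam.known ι a' hQ.analytic_fst)
      ((f₀.pair us).shift ((1, 0) : ℂ × ℂ) d) ((0, 1) : ℂ × ℂ) d₂
    obtain ⟨q, hq⟩ := AnFam.exists_comp_shift_eq_two (AnFam.known ι a' hQ.analytic_fst)
      (f₀.pair us) ((1, 0) : ℂ × ℂ) d
    refine ⟨proj (β + 1) (k + 1) r * proj (β + 1) (k + 1) p, ?_⟩
    rw [e1, hp, hq]
    simp only [map_add, map_mul, map_pow, hdP, hd₂]
    generalize clX ι (β + 1) (k + 1) = x at *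
    generalize clW ι (β + 1) (k + 1) = y at *
    linear_combination (clZ (β + 1) (k + 1) (AnFam.tc k (vanF hS).toFam) ^ 2 *
      proj (β + 1) (k + 1) q) * hyy
  obtain ⟨r₂, hb⟩ : ∃ r₂, proj (β + 1) (k + 1)
      (AnFam.comp ((f.pair u).pair v) (AnFam.known ι b' hQ.analytic_snd)) =
      proj (β + 1) (k + 1) (AnFam.comp ((f₀.pair us).pair v)
        (AnFam.known ι b' hQ.analytic_snd)) + clW ι (β + 1) (k + 1) ^ k * r₂ := by
    have e1 : AnFam.comp ((f.pair u).pair v) (AnFam.known ι b' hQ.analytic_snd) =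
        AnFam.comp ((((f₀.pair us).pair v).shift (((1, 0), 0) : Triple) d).shift
          (((0, 1), 0) : Triple) d₂) (AnFam.known ι b' hQ.analytic_snd) := by
      refine AnFam.comp_congr (fun i x => Prod.ext (Prod.ext ?_ ?_) ?_) _
      · change f.toFun i x = f₀.toFun i x + d.toFun i x * 1 + d₂.toFun i x * 0
        rw [mul_zero, add_zero]
        exact hfeq i x
      · change u.toFun i x = u.toFun i x - d₂.toFun i x + d.toFun i x * 0 + d₂.toFun i x * 1
        ring
      · change v.toFun i x = v.toFun i x + d.toFun i x * 0 + d₂.toFun i x * 0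
        ring
    obtain ⟨p, hp⟩ := AnFam.exists_comp_shift_eq (AnFam.known ι b' hQ.analytic_snd)
      (((f₀.pair us).pair v).shift (((1, 0), 0) : Triple) d) (((0, 1), 0) : Triple) d₂
    obtain ⟨q, hq⟩ := AnFam.exists_comp_shift_eq (AnFam.known ι b' hQ.analytic_snd)
      ((f₀.pair us).pair v) (((1, 0), 0) : Triple) d
    refine ⟨clZ (β + 1) (k + 1) (AnFam.tc k (vanF hS).toFam) * proj (β + 1) (k + 1) q +
      clX ι (β + 1) (k + 1) ^ 2 * proj (β + 1) (k + 1) r * proj (β + 1) (k + 1) p, ?_⟩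
    rw [e1, hp, hq]
    simp only [map_add, map_mul, hdP, hd₂]
    ring
  have hαs : proj (β + 1) (k + 1)
      (AnFam.comp (f₀.pair us) (AnFam.known ι a' hQ.analytic_fst)) ∈ adm S (β + 1) (k + 1) :=
    proj_comp_known_mem hC.comp_mem hn hn' hus hus' _
  have hbs : proj (β + 1) (k + 1) (AnFam.comp ((f₀.pair us).pair v)
      (AnFam.known ι b' hQ.analytic_snd)) ∈ adm S (β + 1) (k + 1) :=
    proj_comp_known_mem' hC.comp_mem hn hn' hus hus' hV hv' _
  let P : AnFam ι Triple := AnFam.known ι _ hT.analyticAt_factor *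
    AnFam.comp (pointXT t) (famConjg hS) ^ m * lead ^ β * AnFam.comp (f₀.pair us)
      (AnFam.tc 1 (AnFam.dir ((1, 0) : ℂ × ℂ) (AnFam.known ι a' hQ.analytic_fst)))
  have hκ : clX ι (β + 1) (k + 1) ^ β * clW ι (β + 1) (k + 1) ^ k *
      (proj (β + 1) (k + 1) (AnFam.known ι _ hT.analyticAt_factor) * gs *
        proj (β + 1) (k + 1) lead ^ β * proj (β + 1) (k + 1) (AnFam.comp (f₀.pair us)
          (AnFam.tc 1 (AnFam.dir ((1, 0) : ℂ × ℂ) (AnFam.known ι a' hQ.analytic_fst))))) =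
      clX ι (β + 1) (k + 1) ^ β * clW ι (β + 1) (k + 1) ^ k *
        clZ (β + 1) (k + 1) (restrictZ P) := by
    rw [← clX_pow_mul_clW_pow_mul_proj]
    simp only [P, map_mul, map_pow]
    generalize clX ι (β + 1) (k + 1) = x at *
    generalize clW ι (β + 1) (k + 1) = y at *
    generalize proj (β + 1) (k + 1) (AnFam.comp (f₀.pair us) (AnFam.tc 1 _)) = w₁
    generalize proj (β + 1) (k + 1) (AnFam.known ι _ hT.analyticAt_factor) = w₂
    linear_combination -(y ^ k * w₁ * w₂ * proj (β + 1) (k + 1) lead ^ β) * hg2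
  have hU' : proj (β + 1) (k + 1) u.toFam = proj (β + 1) (k + 1) us.toFam +
      clX ι (β + 1) (k + 1) ^ 2 * clW ι (β + 1) (k + 1) ^ k * proj (β + 1) (k + 1) r := by
    rw [husP, sub_add_cancel]
  obtain ⟨s, hs, hfin⟩ := exists_adm_add_leading hβ hk hx hy h' hΓ hE hθ hV hus hgs hαs hbs hVeq
    hU' husEq hg1 hα hb hκ
  have hleft : clW ι (β + 1) (k + 1) *
      proj (β + 1) (k + 1) (AnFam.comp (pointZW ι) (famc hS hQ)) =
      ∑ j ∈ Finset.range (k + 1), clZ (β + 1) (k + 1)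
        (if j = 0 then 0 else AnFam.tc (j - 1) (famc hS hQ)) * clW ι (β + 1) (k + 1) ^ j := by
    have h1 := congrArg (proj (β + 1) (k + 1))
      (AnFam.comp_expand (famc hS hQ) (coordZ ι) (coordW ι) k)
    rw [map_add, map_mul, map_pow, map_sum] at h1
    rw [pointZW, h1, Finset.sum_range_succ', if_pos rfl, map_zero, zero_mul, add_zero, mul_add,
      Finset.mul_sum]
    change _ + clW ι (β + 1) (k + 1) * (clW ι (β + 1) (k + 1) ^ k * _) = _
    rw [← mul_assoc, ← pow_succ', hy, zero_mul, add_zero]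
    refine Finset.sum_congr rfl fun j _ => ?_
    rw [map_mul, map_pow, if_neg (Nat.succ_ne_zero j), Nat.add_sub_cancel]
    change clW ι (β + 1) (k + 1) * (_ * clW ι (β + 1) (k + 1) ^ j) = _
    rw [pow_succ']
    exact mul_left_comm _ _ _
  rw [hleft, ← map_mul] at hfin
  have hmem := coeff_mem_of_eq hC.germClosed hs (Nat.lt_succ_self β) (Nat.lt_succ_self k) hβ hfin
  refine hC.germClosed hmem fun i => ?_
  filter_upwards [restrictZ_conjFLeading hS hTa hT0 hT hβ ht i,
    eventually_reflection_zero hT hβ] with z h5 h6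
  rw [← AnFam.eval_apply, ← AnFam.eval_apply, map_mul, map_mul, map_mul, map_mul, map_pow, map_pow,
    AnFam.eval_apply i z (restrictZ P), restrictZ_apply, ← AnFam.eval_apply]
  simp only [P, map_mul, map_pow]
  have e1 : AnFam.eval i ((z, 0), 0) (AnFam.known ι _ hT.analyticAt_factor) = 1 :=
    restrictZ_factor hβ z
  have e2 : AnFam.eval i ((z, 0), 0) (AnFam.comp (pointXT t) (famConjg hS)) =
      tcoef 1 (conjFun (G i)) 0 := by
    rw [← tcoef_conjFun_dquot (hS i).analytic_snd]
    change conjFun (dquot 1 (G i)) (0, T ((z, 0), 0)) = conjFun (dquot 1 (G i)) (0, 0)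
    rw [h6]
  have e3 : AnFam.eval i ((z, 0), 0) lead = (conjFSlope F hT).1 i z := by
    rw [← h5]
    change (conjFLeading hS hT t).1 i ((z, 0), 0) - (0 : ℂ) * _ = _
    rw [zero_mul, sub_zero]
  have e4 : AnFam.eval i ((z, 0), 0) (AnFam.comp (f₀.pair us)
      (AnFam.tc 1 (AnFam.dir ((1, 0) : ℂ × ℂ) (AnFam.known ι a' hQ.analytic_fst)))) =
      restrictDeriv a' (F i (z, 0)) := by
    have g1 : f₀.toFun i ((z, 0), 0) = F i (z, 0) := by
      change F i (z, 0) + n.toFun i ((z, 0), 0) * 1 = _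
      rw [hn0, zero_mul, add_zero]
    have g2 : us.toFun i ((z, 0), 0) = 0 := by
      change conjFun (F i) (0, T ((z, 0), 0)) - (0 : ℂ) ^ 2 * (0 : ℂ) ^ k * r.1 i ((z, 0), 0) = 0
      rw [h6, zero_pow two_ne_zero, zero_mul, zero_mul, sub_zero]
      exact conjFun_zero (hS i).map_fst
    change ncoef 1 (fun η : ℂ => a' ((f₀.toFun i ((z, 0), 0), us.toFun i ((z, 0), 0)) +
      η • ((1, 0) : ℂ × ℂ))) = _
    rw [g1, g2, restrictDeriv]
    congr 1
    funext η
    simp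
  rw [e1, e2, e3, e4, one_mul]
  rfl

end SegreStep

section TransverseCoefficients

variable {ι : Type} {m β k : ℕ} {T Q : Triple → ℂ} {a a' : ℂ × ℂ → ℂ} {b b' : Triple → ℂ}
  {F G : ι → ℂ × ℂ → ℂ} {S : Subring (AnFam ι ℂ)} {A B : ℕ}

theorem tc_mem_of_proj_mem (hS : GermClosed S) {f : AnFam ι (ℂ × ℂ)}
    (h : proj 1 B (AnFam.comp (pointZW ι) f) ∈ adm S 1 B) {j : ℕ} (hj : j < B) :
    AnFam.tc j f ∈ S := by
  obtain ⟨g, hg, he⟩ := exists_normal_form h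
  have h1 := congrArg (proj 1 B) (AnFam.comp_expand f (coordZ ι) (coordW ι) B)
  rw [map_add, map_mul, map_pow, map_sum] at h1
  change proj 1 B (AnFam.comp (pointZW ι) f) = _ + clW ι 1 B ^ B * _ at h1
  rw [clW_pow, zero_mul, add_zero, he, Finset.sum_range_one] at h1
  have h2 : ∑ a ∈ Finset.range 1, ∑ b ∈ Finset.range B,
      clZ 1 B (g a b - AnFam.tc b f) * clX ι 1 B ^ a * clW ι 1 B ^ b = 0 := by
    rw [Finset.sum_range_one]
    simp only [map_sub, sub_mul, Finset.sum_sub_distrib]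
    rw [h1, sub_eq_zero]
    refine Finset.sum_congr rfl fun j _ => ?_
    rw [pow_zero, mul_one, map_mul, map_pow]
    rfl
  refine hS (hg 0 j) fun i => ?_
  filter_upwards [eventually_zero_of_sum_eq_zero h2 zero_lt_one hj i] with z hz
  exact sub_eq_zero.1 hz

theorem proj_comp_coordW_mem {f : AnFam ι ℂ}
    (h : ∀ j < B, numFam (fun i => ncoef j (f.1 i)) ∈ S) :
    proj A B (AnFam.comp (coordW ι) f) ∈ adm S A B := by
  rw [AnFam.comp_expand_num f (coordW ι) B, map_add, map_mul, map_pow]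
  change _ + clW ι A B ^ B * _ ∈ _
  rw [clW_pow, zero_mul, add_zero, map_sum]
  refine Subring.sum_mem _ fun j hj => ?_
  rw [map_mul, map_pow]
  exact Subring.mul_mem _ (clZ_mem_adm (h j (Finset.mem_range.1 hj)))
    (Subring.pow_mem _ clW_mem_adm _)

/-- The family `w ↦ f (0, w)`. -/
noncomputable def onZero (f : AnFam ι (ℂ × ℂ)) : AnFam ι ℂ :=
  AnFam.comp (VanFam.ofCLM ι (ContinuousLinearMap.inr ℂ ℂ ℂ)) f

theorem proj_comp_onZero_mem {f : AnFam ι (ℂ × ℂ)}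
    (h : ∀ j < B, numFam (fun i => tcoef j (f.1 i) 0) ∈ S) :
    proj A B (AnFam.comp (coordW ι) (onZero f)) ∈ adm S A B := proj_comp_coordW_mem h

theorem isNilpotent_proj_onZero {f : AnFam ι (ℂ × ℂ)} (h : ∀ i, f.1 i 0 = 0) :
    IsNilpotent (proj A B (AnFam.comp (coordW ι) (onZero f))) := by
  have h1 := AnFam.comp_expand_num (onZero f) (coordW ι) 1
  have h2 : (numFam fun i => ncoef 0 ((onZero f).1 i)) = 0 :=
    Subtype.ext (funext fun i => funext fun z => h i)
  rw [Finset.sum_range_one, h2, map_zero, zero_mul, zero_add, pow_one] at h1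
  rw [h1, map_mul]
  exact (Commute.all _ _).isNilpotent_mul_right isNilpotent_clW

theorem exists_shift_mem (hS : ∀ i, SegreMap T Q (F i) (G i)) {f : VanFam ι Triple ℂ}
    (hf : f = (vanF hS).comp (pointZW ι)) (h : ∀ j < B, AnFam.tc j (vanF hS).toFam ∈ S) :
    ∃ n : VanFam ι Triple ℂ,
      (∀ i x, f.toFun i x = ((((vanFZero hS).comp (coordZ ι)).shift 1 n).toFun i x)) ∧
      proj A B n.toFam ∈ adm S A B ∧ IsNilpotent (proj A B n.toFam) := by
  let n : VanFam ι Triple ℂ := VanFam.ofFam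
    (f.toFam - ((vanFZero hS).comp (coordZ ι)).toFam) (by
      intro i
      change f.toFun i 0 - ((vanFZero hS).comp (coordZ ι)).toFun i 0 = 0
      rw [f.map_zero, VanFam.map_zero, sub_zero])
  have h1 : proj A B n.toFam = proj A B f.toFam - clZ A B (AnFam.tc 0 (vanF hS).toFam) := by
    change proj A B (f.toFam - ((vanFZero hS).comp (coordZ ι)).toFam) = _
    rw [map_sub]
    rfl
  have hf' : f.toFam = AnFam.comp ((coordZ ι).pair (coordW ι)) (vanF hS).toFam := by
    subst hf; rfl
  refine ⟨n, fun i x => ?_, ?_, ?_⟩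
  · change f.toFun i x = _ + (f.toFun i x - ((vanFZero hS).comp (coordZ ι)).toFun i x) • 1
    rw [smul_eq_mul]
    ring
  · rcases Nat.eq_zero_or_pos B with rfl | hB
    · have : (0 : TruncRing ι A 0) = 1 := by
        rw [← clW_pow (ι := ι) (A := A) (B := 0), pow_zero]
      rw [eq_of_zero_eq_one this (proj A 0 n.toFam) 0]
      exact Subring.zero_mem _
    rw [h1]
    refine Subring.sub_mem _ ?_ (clZ_mem_adm (h 0 hB))
    rw [hf', AnFam.comp_expand (vanF hS).toFam (coordZ ι) (coordW ι) B, map_add, map_mul, map_pow]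
    change _ + clW ι A B ^ B * _ ∈ _
    rw [clW_pow, zero_mul, add_zero, map_sum]
    refine Subring.sum_mem _ fun j hj => ?_
    rw [map_mul, map_pow]
    exact Subring.mul_mem _ (clZ_mem_adm (h j (Finset.mem_range.1 hj)))
      (Subring.pow_mem _ clW_mem_adm _)
  · rw [h1, hf', AnFam.comp_expand (vanF hS).toFam (coordZ ι) (coordW ι) 1, map_add, map_mul,
      Finset.sum_range_one, pow_zero, mul_one, pow_one, proj_comp_coordZ, add_sub_cancel_left]
    exact (Commute.all _ _).isNilpotent_mul_right isNilpotent_clW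

variable {hS : ∀ i, SegreMap T Q (F i) (G i)} {hQ : ReflectionForm m β Q a' b'}

/-- The Taylor coefficients of the transverse coefficient `c` are expressed by those of `F`. -/
theorem tc_famc_mem (hg : GermClosed S)
    (hcomp : ∀ (q : ℂ → ℂ) (hq : AnalyticAt ℂ q 0),
      AnFam.comp (vanFZero hS) (AnFam.known ι q hq) ∈ S)
    (hF : ∀ j < k, AnFam.tc j (vanF hS).toFam ∈ S)
    (hF' : ∀ j ≤ k, numFam (fun i => tcoef j (conjFun (F i)) 0) ∈ S)
    (hG' : ∀ j ≤ k, numFam (fun i => tcoef j (conjFun (G i)) 0) ∈ S) {j : ℕ} (hj : j < k) :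
    AnFam.tc j (famc hS hQ) ∈ S := by
  refine tc_mem_of_proj_mem hg (B := k) ?_ hj
  obtain ⟨n, hn, hn1, hn2⟩ := exists_shift_mem (A := 1) (B := k) hS rfl hF
  let u : VanFam ι Triple ℂ := VanFam.ofFam (AnFam.comp (coordW ι) (onZero (vanConjF hS).toFam))
    fun i => conjFun_zero (hS i).map_fst
  let v : VanFam ι Triple ℂ := VanFam.ofFam (AnFam.comp (coordW ι) (onZero (vanConjG hS).toFam))
    fun i => conjFun_zero (hS i).map_snd
  have hu1 : proj 1 k u.toFam ∈ adm S 1 k :=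
    proj_comp_onZero_mem (f := (vanConjF hS).toFam) fun j hj => hF' j hj.le
  have hv1 : proj 1 k v.toFam ∈ adm S 1 k :=
    proj_comp_onZero_mem (f := (vanConjG hS).toFam) fun j hj => hG' j hj.le
  have hu2 : IsNilpotent (proj 1 k u.toFam) :=
    isNilpotent_proj_onZero (f := (vanConjF hS).toFam) fun i => conjFun_zero (hS i).map_fst
  have hv2 : IsNilpotent (proj 1 k v.toFam) :=
    isNilpotent_proj_onZero (f := (vanConjG hS).toFam) fun i => conjFun_zero (hS i).map_snd
  have hgm : proj 1 k (AnFam.comp (coordW ι) (onZero (famConjg hS))) ∈ adm S 1 k := by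
    refine proj_comp_onZero_mem fun j hj => ?_
    refine hg (hG' (j + 1) hj) fun i => Eventually.of_forall fun z => ?_
    exact (tcoef_conjFun_dquot (hS i).analytic_snd j).symm
  have hfm : proj 1 k (AnFam.comp (coordW ι) (onZero (AnFam.dq 1 (vanConjF hS).toFam))) ∈
      adm S 1 k := proj_comp_onZero_mem fun j hj => hF' (j + 1) hj
  have ha := proj_comp_known_mem hcomp hn1 hn2 hu1 hu2 hQ.analytic_fst
  have hb := proj_comp_known_mem' hcomp hn1 hn2 hu1 hu2 hv1 hv2 hQ.analytic_snd
  have heq : AnFam.comp (pointZW ι) (famc hS hQ) =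
      AnFam.comp (coordW ι) (onZero (famConjg hS)) ^ m *
        AnFam.comp (coordW ι) (onZero (AnFam.dq 1 (vanConjF hS).toFam)) *
        (u.toFam ^ (β - 1) * AnFam.comp ((((vanFZero hS).comp (coordZ ι)).shift 1 n).pair u)
          (AnFam.known ι a' hQ.analytic_fst) + (coordW ι).toFam *
          AnFam.comp (coordW ι) (onZero (famConjg hS)) *
          AnFam.comp (((((vanFZero hS).comp (coordZ ι)).shift 1 n).pair u).pair v)
          (AnFam.known ι b' hQ.analytic_snd)) := by
    refine Subtype.ext (funext fun i => funext fun x => ?_)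
    have h1 : F i (x.1.1, x.2) =
      (((vanFZero hS).comp (coordZ ι)).shift 1 n).toFun i x := hn i x
    rw [← AnFam.eval_apply, ← AnFam.eval_apply]
    simp only [map_add, map_mul, map_pow]
    change _ * _ * (_ * a' (F i (x.1.1, x.2), conjFun (F i) (0, x.2)) + _ * _ *
      b' ((F i (x.1.1, x.2), conjFun (F i) (0, x.2)), conjFun (G i) (0, x.2))) = _
    rw [h1]
    rfl
  rw [heq]
  simp only [map_add, map_mul, map_pow]
  exact Subring.mul_mem _ (Subring.mul_mem _ (Subring.pow_mem _ hgm _) hfm)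
    (Subring.add_mem _ (Subring.mul_mem _ (Subring.pow_mem _ hu1 _) ha)
      (Subring.mul_mem _ (Subring.mul_mem _ clW_mem_adm hgm) hb))

noncomputable def famG (hS : ∀ i, SegreMap T Q (F i) (G i)) : AnFam ι (ℂ × ℂ) :=
  ⟨G, fun i => (hS i).analytic_snd⟩

/-- The Taylor coefficients of the transverse component are expressed by those of `c`. -/
theorem tc_famG_mem (hg : GermClosed S) (hT : ReflectionForm m β T a b) (hβ : β ≠ 0)
    (hc : ∀ j < k, AnFam.tc j (famc hS hQ) ∈ S)
    (hG' : ∀ j ≤ k, numFam (fun i => tcoef j (conjFun (G i)) 0) ∈ S) :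
    AnFam.tc k (famG hS) ∈ S := by
  refine tc_mem_of_proj_mem hg (B := k + 1) ?_ (Nat.lt_succ_self k)
  have heq : proj 1 (k + 1) (AnFam.comp (pointZW ι) (famG hS)) =
      proj 1 (k + 1) (AnFam.comp (coordW ι) (onZero (vanConjG hS).toFam)) +
        clW ι 1 (k + 1) ^ m * (clW ι 1 (k + 1) *
          proj 1 (k + 1) (AnFam.comp (pointZW ι) (famc hS hQ))) := by
    rw [clW, ← map_mul, ← map_pow, ← map_mul, ← map_add]
    refine proj_congr fun i => ?_
    have h1 : Tendsto (fun x : Triple => ((x.1.1, x.2) : ℂ × ℂ)) (𝓝 0) (𝓝 0) :=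
      (show Continuous (fun x : Triple => ((x.1.1, x.2) : ℂ × ℂ)) by fun_prop).tendsto' 0 0 rfl
    have h2 : Tendsto (fun x : Triple => ((0, x.2) : ℂ × ℂ)) (𝓝 0) (𝓝 0) :=
      (show Continuous (fun x : Triple => ((0, x.2) : ℂ × ℂ)) by fun_prop).tendsto' 0 0 rfl
    filter_upwards [h1.eventually ((hS i).eq_mul_dquot hT hβ hQ),
      h1.eventually ((hS i).dquot_eq hT hβ hQ),
      h2.eventually ((hS i).conjFun_eq_mul hT hβ hQ)] with x e1 e2 e3
    change G i (x.1.1, x.2) = conjFun (G i) (0, x.2) + x.2 ^ m * (x.2 *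
      transverseCoeff m β a' b' (F i) (G i) (x.1.1, x.2))
    rw [e1, e2, e3]
    ring
  rw [heq]
  refine Subring.add_mem _ (proj_comp_onZero_mem fun j hj => hG' j (Nat.lt_succ_iff.1 hj))
    (Subring.mul_mem _ (Subring.pow_mem _ clW_mem_adm _) ?_)
  have h1 := congrArg (proj 1 (k + 1))
    (AnFam.comp_expand (famc hS hQ) (coordZ ι) (coordW ι) k)
  rw [map_add, map_mul, map_pow, map_sum] at h1
  change proj 1 (k + 1) (AnFam.comp (pointZW ι) (famc hS hQ)) = _ + clW ι 1 (k + 1) ^ k * _ at h1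
  rw [h1, mul_add, ← mul_assoc, ← pow_succ', clW_pow, zero_mul, add_zero]
  refine Subring.mul_mem _ clW_mem_adm (Subring.sum_mem _ fun j hj => ?_)
  rw [map_mul, map_pow]
  exact Subring.mul_mem _ (clZ_mem_adm (hc j (Finset.mem_range.1 hj)))
    (Subring.pow_mem _ clW_mem_adm _)

theorem ncoef_tcoef_slopeFst {f : ℂ × ℂ → ℂ} (hf : AnalyticAt ℂ f 0) (u j : ℕ) :
    ncoef u (tcoef j (slopeFst f)) = ncoef (u + 1) (tcoef j f) := by
  have he := analyticAt_slopeFst hf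
  have h1 := tcoef_eq_of_eventually (e := (0 : ℂ)) (N := j + 1)
    (a := fun l χ => tcoef l f 0 + χ * tcoef l (slopeFst f) χ)
    (r := fun y => dquot (j + 1) f (0, y.2) + y.1 * dquot (j + 1) (slopeFst f) y) hf
    ((analyticAt_zero_snd (analyticAt_dquot (e := (0 : ℂ)) hf (j + 1))).add
      (analyticAt_fst.mul (analyticAt_dquot (e := (0 : ℂ)) he (j + 1))))
    (Eventually.of_forall fun y => by
      have e1 := eq_add_mul_slopeFst f y
      have e2 := eq_sum_tcoef f (j + 1) 0 y.2
      have e3 := eq_sum_tcoef (slopeFst f) (j + 1) y.1 y.2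
      simp only [add_mul, Finset.sum_add_distrib, mul_assoc, ← Finset.mul_sum]
      rw [e1, e2]
      linear_combination y.1 * e3) j (Nat.lt_succ_self j)
  have hfj := analyticAt_tcoef (e := (0 : ℂ)) hf j
  have h2 := eventually_eq_of_mul_eq (analyticAt_tcoef (e := (0 : ℂ)) he j)
    (analyticAt_slopeZero hfj) (by
      filter_upwards [h1] with χ hχ
      have := eq_add_mul_slopeZero (tcoef j f) χ
      linear_combination this - hχ)
  rw [ncoef_succ]
  exact ncoef_congr h2 u

end TransverseCoefficients

section OneVariable

theorem exists_analytic_root {v : ℂ → ℂ} (hv : AnalyticAt ℂ v 0) (h1 : v 0 = 1) {n : ℕ}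
    (hn : n ≠ 0) :
    ∃ r : ℂ → ℂ, AnalyticAt ℂ r 0 ∧ r 0 = 1 ∧ ∀ᶠ z in 𝓝 0, r z ^ n = v z := by
  refine ⟨fun z => Complex.exp (Complex.log (v z) / n), ?_, by simp [h1], ?_⟩
  · exact ((hv.clog (by rw [h1]; exact Complex.one_mem_slitPlane)).div_const).cexp
  · filter_upwards [hv.continuousAt.eventually_ne (by rw [h1]; exact one_ne_zero)] with z hz
    rw [← Complex.exp_nat_mul, mul_div_cancel₀ _ (Nat.cast_ne_zero.2 hn), Complex.exp_log hz]

theorem exists_analytic_pow_mul_pow {α : ℕ} (hα : α ≠ 0) (β : ℕ) :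
    ∃ d : ℂ → ℂ, AnalyticAt ℂ d 0 ∧ d 0 = 1 ∧ ∀ᶠ y in 𝓝 0, d y ^ α * (1 + y) ^ β = 1 := by
  have hv : AnalyticAt ℂ (fun y : ℂ => (1 + y) ^ β) 0 := (analyticAt_const.add analyticAt_id).pow β
  obtain ⟨d, hd, hd0, hda⟩ := exists_analytic_root (v := fun y => ((1 + y) ^ β)⁻¹)
    (hv.inv (by simp)) (by simp) hα
  refine ⟨d, hd, hd0, ?_⟩
  filter_upwards [hda, hv.continuousAt.eventually_ne (y := 0) (by simp)] with y h1 h2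
  rw [h1]
  exact inv_mul_cancel₀ h2

/-- The inverse function of `z ↦ z r(z)`, where `r 0 = 1`. -/
theorem exists_inverse_factor {r : ℂ → ℂ} (hr : AnalyticAt ℂ r 0) (h1 : r 0 = 1) :
    ∃ s : ℂ → ℂ, AnalyticAt ℂ s 0 ∧ s 0 = 1 ∧ ∀ᶠ z in 𝓝 0, z * r z * s (z * r z) = z := by
  have hf : AnalyticAt ℂ (fun z => z * r z) 0 := analyticAt_id.mul hr
  have hd : HasStrictDerivAt (fun z => z * r z) 1 0 := by
    have := (hasStrictDerivAt_id (0 : ℂ)).mul hr.hasStrictDerivAt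
    rw [one_mul, id, zero_mul, add_zero, h1] at this
    exact this
  have hdf := hd.hasStrictFDerivAt_equiv one_ne_zero
  have hs := hdf.mem_toOpenPartialHomeomorph_source
  have hja : AnalyticAt ℂ (hdf.toOpenPartialHomeomorph _).symm 0 := by
    have := (hdf.toOpenPartialHomeomorph _).analyticAt_symm' hs hf hdf.hasFDerivAt.fderiv
    simpa using this
  have hleft : ∀ᶠ z in 𝓝 0, (hdf.toOpenPartialHomeomorph _).symm (z * r z) = z :=
    (hdf.toOpenPartialHomeomorph _).eventually_left_inverse hs
  set j := (hdf.toOpenPartialHomeomorph _).symm with hj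
  have hj0 : j 0 = 0 := by simpa using hleft.self_of_nhds
  have hmul : ∀ᶠ z in 𝓝 0, z * r z * slopeZero j (z * r z) = z := by
    filter_upwards [hleft] with z hz
    have := eq_add_mul_slopeZero j (z * r z)
    rw [hj0, hz, zero_add] at this
    exact this.symm
  have hsa := analyticAt_slopeZero hja
  have hc : AnalyticAt ℂ (fun z => slopeZero j (z * r z)) 0 :=
    AnalyticAt.comp (f := fun z => z * r z) (by rw [zero_mul]; exact hsa) hf
  refine ⟨slopeZero j, hsa, ?_, hmul⟩
  have h2 : (fun z => r z * slopeZero j (z * r z)) =ᶠ[𝓝 0] fun _ => 1 :=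
    eventually_eq_of_mul_eq (hr.mul hc) analyticAt_const (by
      filter_upwards [hmul] with z hz
      rw [mul_one, ← mul_assoc, hz])
  simpa [h1] using h2.self_of_nhds

theorem eventually_eq_of_pow_eq {f g : ℂ → ℂ} (hf : ContinuousAt f 0) (hg : ContinuousAt g 0)
    {n : ℕ} (hn : n ≠ 0) (h0 : f 0 = g 0) (hne : g 0 ≠ 0) (h : ∀ᶠ z in 𝓝 0, f z ^ n = g z ^ n) :
    ∀ᶠ z in 𝓝 0, f z = g z := by
  have hc : ContinuousAt (fun z => ∑ i ∈ Finset.range n, f z ^ i * g z ^ (n - 1 - i)) 0 :=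
    tendsto_finsetSum _ fun i _ => (hf.pow i).mul (hg.pow _)
  have hc0 : ∑ i ∈ Finset.range n, f 0 ^ i * g 0 ^ (n - 1 - i) ≠ 0 := by
    rw [h0, Finset.sum_congr rfl (fun i hi => by
      rw [← pow_add, show i + (n - 1 - i) = n - 1 by have := Finset.mem_range.1 hi; omega])]
    simpa using ⟨hn, fun h => absurd h hne⟩
  filter_upwards [h, hc.eventually_ne hc0] with z h1 h2
  have h3 := (Commute.all (f z) (g z)).geom_sum₂_mul n
  rw [h1, sub_self] at h3
  exact sub_eq_zero.1 ((mul_eq_zero.1 h3).resolve_left h2)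

/-- The first component of a map on the Segre set through the origin: `f` vanishes at the origin
with derivative `Λ₁₁` and solves the base equation. -/
structure IsBaseSolution (m β : ℕ) (δ : ℂ) (q q' : ℂ → ℂ) (A B : OneJet) (f : ℂ → ℂ) : Prop where
  analytic : AnalyticAt ℂ f 0
  map_zero : f 0 = 0
  slope : slopeZero f 0 = A 0 0
  mem : A ∈ invUpperTriangular
  conj_mem : B ∈ invUpperTriangular
  eq : ∀ᶠ z in 𝓝 0,
    q z * B 1 1 + B 1 1 ^ m * (B 0 0 + δ * (q z * B 0 1)) ^ β * q' (f z) = 0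

variable {m β : ℕ} {δ : ℂ} {q q' : ℂ → ℂ}

theorem eventually_eq_of_pow_mul_eq_pow_mul {f g : ℂ → ℂ} (hf : AnalyticAt ℂ f 0)
    (hg : AnalyticAt ℂ g 0) {n : ℕ} (h : ∀ᶠ z in 𝓝 0, z ^ n * f z = z ^ n * g z) :
    ∀ᶠ z in 𝓝 0, f z = g z := by
  induction n generalizing f g with
  | zero => simpa using h
  | succ n ih =>
    refine eventually_eq_of_mul_eq hf hg (ih (analyticAt_id.mul hf) (analyticAt_id.mul hg) ?_)
    filter_upwards [h] with z hz
    rw [← mul_assoc, ← mul_assoc, ← pow_succ, hz]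

theorem IsBaseSolution.exists_pow_mul {A B : OneJet} {f u' : ℂ → ℂ} {α : ℕ}
    (h : IsBaseSolution m β δ q q' A B f) (hq : AnalyticAt ℂ q 0) (hq0 : q 0 = 0)
    (hu' : AnalyticAt ℂ u' 0) (hu0 : u' 0 ≠ 0) (he : ∀ᶠ z in 𝓝 0, q' z = z ^ α * u' z) :
    ∃ u : ℂ → ℂ, AnalyticAt ℂ u 0 ∧ u 0 ≠ 0 ∧ ∀ᶠ z in 𝓝 0, q z = z ^ α * u z := by
  obtain ⟨hA1, hA2, hA3⟩ := h.mem
  obtain ⟨hB1, hB2, hB3⟩ := h.conj_mem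
  have ht : Tendsto f (𝓝 0) (𝓝 0) := by simpa [h.map_zero] using h.analytic.continuousAt.tendsto
  have hu'f : AnalyticAt ℂ (fun z => u' (f z)) 0 :=
    AnalyticAt.comp (f := f) (by rw [h.map_zero]; exact hu') h.analytic
  refine ⟨fun z => -(B 1 1)⁻¹ * (B 1 1 ^ m * (B 0 0 + δ * (q z * B 0 1)) ^ β *
    (slopeZero f z ^ α * u' (f z))), ?_, ?_, ?_⟩
  · exact analyticAt_const.mul ((analyticAt_const.mul ((analyticAt_const.add
      (analyticAt_const.mul (hq.mul analyticAt_const))).pow β)).mul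
      (((analyticAt_slopeZero h.analytic).pow α).mul hu'f))
  · simp [hq0, h.slope, h.map_zero, hA2, hB2, hB3, hu0]
  · filter_upwards [h.eq, ht.eventually he] with z h1 h2
    have h3 := eq_add_mul_slopeZero f z
    rw [h.map_zero, zero_add] at h3
    have h4 : q' (f z) = z ^ α * slopeZero f z ^ α * u' (f z) := by
      rw [h2, ← mul_pow, ← h3]
    rw [h4] at h1
    field_simp
    linear_combination h1

/-- The base equation determines `f` as a holomorphic function of `z` and the first jets. -/
theorem exists_base_solution_formula (hq : AnalyticAt ℂ q 0) (hq0 : q 0 = 0)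
    (hq' : AnalyticAt ℂ q' 0) (hq0' : q' 0 = 0)
    (hne : ¬((∀ᶠ z in 𝓝 0, q z = 0) ∧ ∀ᶠ z in 𝓝 0, q' z = 0)) {A₀ B₀ : OneJet} {f₀ : ℂ → ℂ}
    (h₀ : IsBaseSolution m β δ q q' A₀ B₀ f₀) :
    ∃ Ψ ∈ holCoeff, (∀ A ∈ invUpperTriangular, ∀ B ∈ invUpperTriangular, Ψ (0, A, B) ≠ 0) ∧
      (∀ A B f, IsBaseSolution m β δ q q' A B f → ∀ᶠ z in 𝓝 0, f z = z * Ψ (z, A, B)) ∧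
      ∃ (n : ℕ) (w : ℂ → ℂ), AnalyticAt ℂ w 0 ∧ w 0 ≠ 0 ∧
        ∀ᶠ z in 𝓝 0, q' z = z ^ (n + 1) * w z := by
  have hq'ne : ¬∀ᶠ z in 𝓝 0, q' z = 0 := by
    intro h
    refine hne ⟨?_, h⟩
    have ht : Tendsto f₀ (𝓝 0) (𝓝 0) := by
      simpa [h₀.map_zero] using h₀.analytic.continuousAt.tendsto
    filter_upwards [h₀.eq, ht.eventually h] with z h1 h2
    rw [h2, mul_zero, add_zero] at h1
    exact (mul_eq_zero.1 h1).resolve_right h₀.conj_mem.2.2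
  obtain ⟨α, u', hu', hu0', he'⟩ :=
    (hq'.exists_eventuallyEq_pow_smul_nonzero_iff).2 hq'ne
  simp only [sub_zero, smul_eq_mul] at he'
  have hα : α ≠ 0 := by
    rintro rfl
    have := he'.self_of_nhds
    rw [hq0', pow_zero, one_mul] at this
    exact hu0' this.symm
  obtain ⟨u, hu, hu0, he⟩ := h₀.exists_pow_mul hq hq0 hu' hu0' he'
  obtain ⟨r, hr, hr0, hrα⟩ := exists_analytic_root (hu.div_const (c := u 0)) (div_self hu0) hα
  obtain ⟨r', hr', hr0', hrα'⟩ :=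
    exists_analytic_root (hu'.div_const (c := u' 0)) (div_self hu0') hα
  obtain ⟨d, hd, hd0, hdα⟩ := exists_analytic_pow_mul_pow hα β
  obtain ⟨s, hs, hs0, hsr⟩ := exists_inverse_factor hr' hr0'
  let κ : CoeffPoint → ℂ := fun x => δ * (q x.1 * x.2.2 0 1) * (x.2.2 0 0)⁻¹
  have hκ : κ ∈ holCoeff := holCoeff.mul_mem (holCoeff.mul_mem
    (fun _ _ _ _ => analyticAt_const) (holCoeff.mul_mem (holCoeff_ofZ hq) (holCoeff_conjEntry 0 1)))
    (holCoeff_inv (holCoeff_conjEntry 0 0) fun A _ B hB => hB.2.1)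
  have hκ0 : ∀ A ∈ invUpperTriangular, ∀ B ∈ invUpperTriangular, κ (0, A, B) = 0 := by
    intro A _ B _
    simp [κ, hq0]
  let ρ : CoeffPoint → ℂ := fun x => x.2.1 0 0 * r x.1 * d (κ x)
  have hρ : ρ ∈ holCoeff := holCoeff.mul_mem
    (holCoeff.mul_mem (holCoeff_entry 0 0) (holCoeff_ofZ hr)) (holCoeff_comp hκ hd hκ0)
  have hρ0 : ∀ A ∈ invUpperTriangular, ∀ B ∈ invUpperTriangular, ρ (0, A, B) = A 0 0 := by
    intro A hA B hB
    change A 0 0 * r 0 * d (κ (0, A, B)) = _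
    rw [hκ0 A hA B hB, hr0, hd0, mul_one, mul_one]
  have hzρ : (fun x : CoeffPoint => x.1 * ρ x) ∈ holCoeff :=
    holCoeff.mul_mem (holCoeff_ofZ analyticAt_id) hρ
  refine ⟨fun x => ρ x * s (x.1 * ρ x), holCoeff.mul_mem hρ
    (holCoeff_comp hzρ hs fun A _ B _ => zero_mul _), ?_, ?_, ?_⟩
  · intro A hA B hB
    change ρ (0, A, B) * s (0 * ρ (0, A, B)) ≠ 0
    rw [hρ0 A hA B hB, zero_mul, hs0, mul_one]
    exact hA.2.1
  · intro A B f hf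
    obtain ⟨-, hA2, -⟩ := hf.mem
    obtain ⟨-, hB2, hB3⟩ := hf.conj_mem
    have ht : Tendsto f (𝓝 0) (𝓝 0) := by
      simpa [hf.map_zero] using hf.analytic.continuousAt.tendsto
    have hσ := analyticAt_slopeZero hf.analytic
    have hfσ : ∀ z, f z = z * slopeZero f z := fun z => by
      have := eq_add_mul_slopeZero f z
      rwa [hf.map_zero, zero_add] at this
    have hu'f : AnalyticAt ℂ (fun z => u' (f z)) 0 :=
      AnalyticAt.comp (f := f) (by rw [hf.map_zero]; exact hu') hf.analytic
    have hr'f : AnalyticAt ℂ (fun z => r' (f z)) 0 :=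
      AnalyticAt.comp (f := f) (by rw [hf.map_zero]; exact hr') hf.analytic
    have hdiv : ∀ᶠ z in 𝓝 0, u z * B 1 1 + B 1 1 ^ m * (B 0 0 + δ * (q z * B 0 1)) ^ β *
        (slopeZero f z ^ α * u' (f z)) = 0 := by
      refine eventually_eq_of_pow_mul_eq_pow_mul (n := α) ((hu.mul analyticAt_const).add
        ((analyticAt_const.mul ((analyticAt_const.add
        (analyticAt_const.mul (hq.mul analyticAt_const))).pow β)).mul
        ((hσ.pow α).mul hu'f))) analyticAt_const ?_
      filter_upwards [hf.eq, ht.eventually he', he] with z h1 h2 h3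
      have h4 : q' (f z) = z ^ α * slopeZero f z ^ α * u' (f z) := by
        rw [h2, ← mul_pow, ← hfσ]
      rw [h4] at h1
      linear_combination h1 - B 1 1 * h3
    have hz0 := hdiv.self_of_nhds
    rw [hq0, hf.slope, hf.map_zero, zero_mul, mul_zero, add_zero] at hz0
    have hρan : AnalyticAt ℂ (fun z => ρ (z, A, B)) 0 :=
      AnalyticAt.comp (f := fun z : ℂ => ((z, A, B) : CoeffPoint)) (hρ A hf.mem B hf.conj_mem)
        (analyticAt_id.prod analyticAt_const)
    have hκan : Tendsto (fun z => κ (z, A, B)) (𝓝 0) (𝓝 0) := by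
      have : AnalyticAt ℂ (fun z => κ (z, A, B)) 0 :=
        AnalyticAt.comp (f := fun z : ℂ => ((z, A, B) : CoeffPoint)) (hκ A hf.mem B hf.conj_mem)
          (analyticAt_id.prod analyticAt_const)
      simpa [hκ0 A hf.mem B hf.conj_mem] using this.continuousAt.tendsto
    have hR : ∀ᶠ z in 𝓝 0, slopeZero f z * r' (f z) = ρ (z, A, B) := by
      refine eventually_eq_of_pow_eq (hσ.mul hr'f).continuousAt hρan.continuousAt hα ?_ ?_ ?_
      · rw [hρ0 A hf.mem B hf.conj_mem, hf.map_zero, hr0', hf.slope, mul_one]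
      · rw [hρ0 A hf.mem B hf.conj_mem]
        exact hA2
      · filter_upwards [hdiv, hrα, ht.eventually hrα', hκan.eventually hdα] with z h1 h2 h3 h4
        change (slopeZero f z * r' (f z)) ^ α = (A 0 0 * r z * d (κ (z, A, B))) ^ α
        have hK : B 0 0 + δ * (q z * B 0 1) = B 0 0 * (1 + κ (z, A, B)) := by
          change _ = B 0 0 * (1 + δ * (q z * B 0 1) * (B 0 0)⁻¹)
          field_simp
        rw [hK] at h1
        have hK0 : (1 + κ (z, A, B)) ^ β ≠ 0 := right_ne_zero_of_mul_eq_one h4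
        have h2' : u z = u 0 * r z ^ α := by rw [h2]; field_simp
        have h3' : u' (f z) = u' 0 * r' (f z) ^ α := by rw [h3]; field_simp
        rw [h2', h3'] at h1
        have hc : B 1 1 ^ m * B 0 0 ^ β * u' 0 * (1 + κ (z, A, B)) ^ β ≠ 0 :=
          mul_ne_zero (mul_ne_zero (mul_ne_zero (pow_ne_zero _ hB3) (pow_ne_zero _ hB2)) hu0') hK0
        refine mul_left_cancel₀ hc ?_
        simp only [mul_pow] at h1 ⊢
        linear_combination h1 - r z ^ α * hz0 -
          B 1 1 ^ m * B 0 0 ^ β * u' 0 * A 0 0 ^ α * r z ^ α * h4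
    filter_upwards [hR, ht.eventually hsr] with z h1 h2
    have h3 : f z * r' (f z) = z * ρ (z, A, B) := by rw [← h1, ← mul_assoc, ← hfσ]
    rw [h3] at h2
    rw [← mul_assoc, h2]
  · obtain ⟨n, rfl⟩ := Nat.exists_eq_succ_of_ne_zero hα
    exact ⟨n, u', hu', hu0', he'⟩

theorem deriv_pow_mul {n : ℕ} {w : ℂ → ℂ} (hw : AnalyticAt ℂ w 0) (hw0 : w 0 ≠ 0)
    (h : ∀ᶠ z in 𝓝 0, q z = z ^ (n + 1) * w z) :
    ∃ v : ℂ → ℂ, AnalyticAt ℂ v 0 ∧ v 0 ≠ 0 ∧ ∀ᶠ z in 𝓝 0, deriv q z = z ^ n * v z := by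
  refine ⟨fun z => (n + 1) * w z + z * deriv w z, (analyticAt_const.mul hw).add
    (analyticAt_id.mul hw.deriv), ?_, ?_⟩
  · have : (n : ℂ) + 1 ≠ 0 := by exact_mod_cast n.succ_ne_zero
    simpa using ⟨this, hw0⟩
  · filter_upwards [h.eventually_nhds, hw.eventually_analyticAt] with z h1 h2
    have h3 : HasDerivAt (fun z => z ^ (n + 1) * w z) _ z :=
      (hasDerivAt_pow (n + 1) z).mul h2.differentiableAt.hasDerivAt
    rw [EventuallyEq.deriv_eq h1, h3.deriv]
    push_cast [Nat.add_sub_cancel]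
    ring

end OneVariable

section JetDetermination

theorem jacobian_apply_zero {H : ℂ × ℂ → ℂ × ℂ} (hH : AnalyticAt ℂ H 0) (c : Fin 2) :
    jacobian H c 0 = ncoef 1 (tcoef 0 (component c H)) := by
  have := coord_partialDeriv_zero hH 1 0 c
  simpa [jacobian] using this

theorem jacobian_apply_one {H : ℂ × ℂ → ℂ × ℂ} (hH : AnalyticAt ℂ H 0) (c : Fin 2) :
    jacobian H c 1 = ncoef 0 (tcoef 1 (component c H)) := by
  have := coord_partialDeriv_zero hH 0 1 c
  simpa [jacobian] using this

variable {ι : Type} {H : ι → ℂ × ℂ → ℂ × ℂ} {m β : ℕ} {T Q : Triple → ℂ} {a a' : ℂ × ℂ → ℂ}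
  {b b' : Triple → ℂ}

theorem tcoef_one_conjFun_snd (hH : ∀ i, AnalyticAt ℂ (H i) 0) (i : ι) :
    tcoef 1 (conjFun (component 1 (H i))) 0 = conj (jacobian (H i) 1 1) := by
  rw [jacobian_apply_one (hH i)]
  exact ncoef_tcoef_conjFun (analyticAt_component (hH i) 1) 0 1

theorem conjFSlope_apply (hH : ∀ i, AnalyticAt ℂ (H i) 0) (hT : ReflectionForm m β T a b) (i : ι)
    (z : ℂ) : (conjFSlope (fun i => component 0 (H i)) hT).1 i z =
      conj (jacobian (H i) 0 0) + 0 ^ (β - 1) * 0 ^ m * (a (z, 0) * conj (jacobian (H i) 0 1)) := by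
  rw [jacobian_apply_one (hH i), jacobian_apply_zero (hH i),
    ← ncoef_tcoef_conjFun (analyticAt_component (hH i) 0),
    ← ncoef_tcoef_conjFun (analyticAt_component (hH i) 0)]
  rfl

theorem isBaseSolution_component (hH : ∀ i, AnalyticAt ℂ (H i) 0) (hJ : TriangularFamily H)
    (hS : ∀ i, SegreMap T Q (component 0 (H i)) (component 1 (H i))) (hTa : AnalyticAt ℂ T 0)
    (hT : ReflectionForm m β T a b) (hβ : β ≠ 0) (hQ : ReflectionForm m β Q a' b') (i : ι) :
    IsBaseSolution m β (0 ^ (β - 1) * 0 ^ m) (fun z => a (z, 0)) (fun z => a' (z, 0))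
      (jacobian (H i)) (fun c d => conj (jacobian (H i) c d)) (fun z => component 0 (H i) (z, 0)) where
  analytic := analyticAt_tcoef (e := (0 : ℂ)) (hS i).analytic_fst 0
  map_zero := (hS i).map_fst
  slope := (jacobian_apply_zero (hH i) 0).symm
  mem := hJ i
  conj_mem := conj_mem_invUpperTriangular (hJ i)
  eq := by
    filter_upwards [leading_coefficient_eq_zero hS hTa (hT.map_zero' hβ) hT hβ hQ i] with z hz
    rw [tcoef_one_conjFun_snd hH, conjFSlope_apply hH] at hz
    exact hz

theorem restrictDeriv_eventually_eq (h : AnalyticAt ℂ a' 0) :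
    ∀ᶠ s in 𝓝 0, restrictDeriv a' s = deriv (fun z => a' (z, 0)) s := by
  have h1 : AnalyticAt ℂ (fun z => a' (z, 0)) 0 := analyticAt_tcoef (e := (0 : ℂ)) h 0
  filter_upwards [h1.eventually_analyticAt] with s hs
  have h2 : AnalyticAt ℂ (fun η => a' (s + η, 0)) 0 :=
    AnalyticAt.comp (g := fun z => a' (z, 0)) (f := fun η => s + η) (by simpa using hs)
      (analyticAt_const.add analyticAt_id)
  have h3 := iteratedDeriv_eq_factorial_mul_ncoef h2 1
  rw [iteratedDeriv_one, Nat.factorial_one, Nat.cast_one, one_mul] at h3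
  rw [restrictDeriv, ← h3]
  have h4 := deriv_comp_const_add (f := fun z => a' (z, 0)) s 0
  rw [add_zero] at h4
  exact h4

theorem tc_fst_mem_jetRing (hH : ∀ i, AnalyticAt ℂ (H i) 0) (h0 : ∀ i, H i 0 = 0)
    (hJ : TriangularFamily H)
    (hS : ∀ i, SegreMap T Q (component 0 (H i)) (component 1 (H i))) (hTa : AnalyticAt ℂ T 0)
    (hT : ReflectionForm m β T a b) (hβ : β ≠ 0) (hQ : ReflectionForm m β Q a' b')
    (hcomp : ∀ k (d : ℂ → ℂ) (hd : AnalyticAt ℂ d 0),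
      AnFam.comp (vanFZero hS) (AnFam.known ι d hd) ∈ jetRing H k)
    {n : ℕ} {E : CoeffPoint → ℂ} (hE : E ∈ holCoeff)
    (hE0 : ∀ A ∈ invUpperTriangular, ∀ B ∈ invUpperTriangular, E (0, A, B) ≠ 0)
    (hlead : ∀ i, ∀ᶠ z in 𝓝 0, tcoef 1 (conjFun (component 1 (H i))) 0 ^ m *
      (conjFSlope (fun i => component 0 (H i)) hT).1 i z ^ β *
        restrictDeriv a' (component 0 (H i) (z, 0)) = z ^ n * E (coeffPoint H i z)) (k : ℕ) :
    AnFam.tc k (vanF hS).toFam ∈ jetRing H k := by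
  induction k using Nat.strong_induction_on with
  | _ k ih =>
  rcases Nat.eq_zero_or_pos k with rfl | hk
  · exact hcomp 0 id analyticAt_id
  have hF : ∀ j < k, AnFam.tc j (vanF hS).toFam ∈ jetRing H k := fun j hj =>
    jetRing_mono hj.le (ih j hj)
  have hconj : ∀ c u j, numFam (fun i => ncoef u (tcoef j (component c (H i)))) ∈ jetRing H k →
      numFam (fun i => ncoef u (tcoef j (conjFun (component c (H i))))) ∈ jetRing H k := by
    intro c u j h
    simp only [ncoef_tcoef_conjFun (analyticAt_component (hH _) c)]
    exact numFam_conj_mem h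
  have hjet : ∀ c u j, u + j ≤ k + 1 →
      numFam (fun i => ncoef u (tcoef j (conjFun (component c (H i))))) ∈ jetRing H k :=
    fun c u j h => hconj c u j (taylorCoeff_mem_jetRing hH h0 c h)
  have hc : ∀ j < k, AnFam.tc j (famc hS hQ) ∈ jetRing H k := fun j hj =>
    tc_famc_mem (jetRing_germClosed k) (hcomp k) hF
      (fun j hj => hjet 0 0 j (by omega)) (fun j hj => hjet 1 0 j (by omega)) hj
  have hC : ContainsLowerOrder (jetRing H k) hS hQ k :=
    { germClosed := jetRing_germClosed k
      known_mem := fun q hq => known_mem_jetRing hq k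
      comp_mem := hcomp k
      fst_mem := hF
      conjFst_mem := fun j hj u => hconj 0 u j (ncoef_mem_jetRing hJ (hF j hj) u)
      conjFst_mem' := fun u j h => hjet 0 u j h
      conjSnd_mem := fun j hj => hjet 1 0 j (by omega)
      slope_mem := fun j hj u => by
        have h1 := numFam_conj_mem (ncoef_mem_jetRing hJ (hc j hj) (u + 1))
        refine jetRing_germClosed k h1 fun i => Eventually.of_forall fun z => ?_
        have h2 := (hS i).analyticAt_transverseCoeff hQ
        exact ((ncoef_tcoef_slopeFst (analyticAt_conjFun h2) u j).trans
          (ncoef_tcoef_conjFun h2 (u + 1) j)).symm }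
  have h1 := leading_mul_coeff_mem hC hk.ne' hT hβ hTa (hT.map_zero' hβ)
  have h2 : holFam hJ ⟨E, hE⟩ * AnFam.tc k (vanF hS).toFam ∈ jetRing H k := by
    refine mem_jetRing_of_mul_pow hJ (n := n) h1 fun i => ?_
    filter_upwards [hlead i] with z hz
    rw [← AnFam.eval_apply, ← AnFam.eval_apply]
    simp only [map_mul, map_pow]
    rw [← mul_assoc]
    exact congrArg (· * AnFam.eval i z (AnFam.tc k (vanF hS).toFam)) hz
  refine jetRing_germClosed k ((jetRing H k).mul_mem
    (holFam_mem hJ ⟨_, holCoeff_inv hE hE0⟩ k) h2) fun i => ?_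
  have hne : E (coeffPoint H i 0) ≠ 0 := hE0 _ (hJ i) _ (conj_mem_invUpperTriangular (hJ i))
  filter_upwards [(analyticAt_coeffPoint hJ ⟨E, hE⟩ i).continuousAt.eventually_ne hne] with z hz
  exact inv_mul_cancel_left₀ hz _

theorem exists_leading_factor (hH : ∀ i, AnalyticAt ℂ (H i) 0)
    (hS : ∀ i, SegreMap T Q (component 0 (H i)) (component 1 (H i)))
    (hT : ReflectionForm m β T a b)
    {Ψ : CoeffPoint → ℂ} (hΨ : Ψ ∈ holCoeff)
    (hΨ0 : ∀ A ∈ invUpperTriangular, ∀ B ∈ invUpperTriangular, Ψ (0, A, B) ≠ 0)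
    (hF : ∀ i, ∀ᶠ z in 𝓝 0, component 0 (H i) (z, 0) = z * Ψ (coeffPoint H i z))
    {n : ℕ} {v : ℂ → ℂ} (hv : AnalyticAt ℂ v 0) (hv0 : v 0 ≠ 0)
    (hd : ∀ᶠ s in 𝓝 0, restrictDeriv a' s = s ^ n * v s) :
    ∃ E ∈ holCoeff, (∀ A ∈ invUpperTriangular, ∀ B ∈ invUpperTriangular, E (0, A, B) ≠ 0) ∧
      ∀ i, ∀ᶠ z in 𝓝 0, tcoef 1 (conjFun (component 1 (H i))) 0 ^ m *
      (conjFSlope (fun i => component 0 (H i)) hT).1 i z ^ β *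
        restrictDeriv a' (component 0 (H i) (z, 0)) = z ^ n * E (coeffPoint H i z) := by
  have ha : a (0, 0) = 0 := hT.map_zero
  have hzΨ : (fun x : CoeffPoint => x.1 * Ψ x) ∈ holCoeff :=
    holCoeff.mul_mem (holCoeff_ofZ analyticAt_id) hΨ
  let K : CoeffPoint → ℂ := fun x =>
    x.2.2 0 0 + 0 ^ (β - 1) * 0 ^ m * (a (x.1, 0) * x.2.2 0 1)
  have hK : K ∈ holCoeff := holCoeff.add_mem (holCoeff_conjEntry 0 0)
    (holCoeff.mul_mem (fun _ _ _ _ => analyticAt_const)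
      (holCoeff.mul_mem (holCoeff_ofZ hT.analyticAt_restrict) (holCoeff_conjEntry 0 1)))
  refine ⟨fun x => x.2.2 1 1 ^ m * K x ^ β * (Ψ x ^ n * v (x.1 * Ψ x)),
    holCoeff.mul_mem (holCoeff.mul_mem (holCoeff.pow_mem (holCoeff_conjEntry 1 1) m)
      (holCoeff.pow_mem hK β)) (holCoeff.mul_mem (holCoeff.pow_mem hΨ n)
      (holCoeff_comp hzΨ hv fun A _ B _ => zero_mul _)), ?_, fun i => ?_⟩
  · intro A hA B hB
    refine mul_ne_zero (mul_ne_zero (pow_ne_zero _ hB.2.2) (pow_ne_zero _ ?_))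
      (mul_ne_zero (pow_ne_zero _ (hΨ0 A hA B hB)) ?_)
    · change B 0 0 + 0 ^ (β - 1) * 0 ^ m * (a (0, 0) * B 0 1) ≠ 0
      rw [ha, zero_mul, mul_zero, add_zero]
      exact hB.2.1
    · change v (0 * _) ≠ 0
      rwa [zero_mul]
  · have ht : Tendsto (fun z => component 0 (H i) (z, 0)) (𝓝 0) (𝓝 0) := by
      have h1 : AnalyticAt ℂ (fun z => component 0 (H i) (z, 0)) 0 :=
        analyticAt_tcoef (e := (0 : ℂ)) (hS i).analytic_fst 0
      have h2 := h1.continuousAt.tendsto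
      rwa [show component 0 (H i) (0, 0) = 0 from (hS i).map_fst] at h2
    filter_upwards [hF i, ht.eventually hd] with z h1 h2
    rw [h2, h1, tcoef_one_conjFun_snd hH, conjFSlope_apply hH, mul_pow]
    change _ = z ^ n * (conj (jacobian (H i) 1 1) ^ m * (conj (jacobian (H i) 0 0) + 0 ^ (β - 1) * 0 ^ m *
      (a (z, 0) * conj (jacobian (H i) 0 1))) ^ β * (Ψ (coeffPoint H i z) ^ n * v (z * Ψ (coeffPoint H i z))))
    ring

/-- All Taylor coefficients along `w = 0` of a family of maps which respect the Segre varieties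
are jet polynomials. -/
theorem tc_mem_jetRing (hH : ∀ i, AnalyticAt ℂ (H i) 0) (h0 : ∀ i, H i 0 = 0)
    (hJ : TriangularFamily H)
    (hS : ∀ i, SegreMap T Q (component 0 (H i)) (component 1 (H i))) (hTa : AnalyticAt ℂ T 0)
    (hT : ReflectionForm m β T a b) (hβ : β ≠ 0) (hQ : ReflectionForm m β Q a' b')
    (hne : ¬((∀ᶠ z in 𝓝 0, a (z, 0) = 0) ∧ ∀ᶠ z in 𝓝 0, a' (z, 0) = 0)) (i₀ : ι) (k : ℕ) :
    AnFam.tc k (vanF hS).toFam ∈ jetRing H k ∧ AnFam.tc k (famG hS) ∈ jetRing H k := by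
  obtain ⟨Ψ, hΨ, hΨ0, hF, n, w, hw, hw0, he⟩ := exists_base_solution_formula
    hT.analyticAt_restrict hT.map_zero hQ.analyticAt_restrict hQ.map_zero hne
    (isBaseSolution_component hH hJ hS hTa hT hβ hQ i₀)
  have hF' : ∀ i, ∀ᶠ z in 𝓝 0, component 0 (H i) (z, 0) = z * Ψ (coeffPoint H i z) := fun i =>
    hF _ _ _ (isBaseSolution_component hH hJ hS hTa hT hβ hQ i)
  obtain ⟨v, hv, hv0, hd⟩ := deriv_pow_mul hw hw0 he
  obtain ⟨E, hE, hE0, hlead⟩ := exists_leading_factor hH hS hT hΨ hΨ0 hF' hv hv0 (by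
    filter_upwards [restrictDeriv_eventually_eq hQ.analytic_fst, hd] with s h1 h2
    rw [h1, h2])
  have hcomp : ∀ k (d : ℂ → ℂ) (hd : AnalyticAt ℂ d 0),
      AnFam.comp (vanFZero hS) (AnFam.known ι d hd) ∈ jetRing H k := by
    intro k d hd
    have hzΨ : (fun x : CoeffPoint => x.1 * Ψ x) ∈ holCoeff :=
      holCoeff.mul_mem (holCoeff_ofZ analyticAt_id) hΨ
    refine jetRing_germClosed k
      (holFam_mem hJ ⟨_, holCoeff_comp hzΨ hd fun A _ B _ => zero_mul _⟩ k) fun i => ?_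
    filter_upwards [hF' i] with z hz
    exact (congrArg d hz).symm
  have hfst := tc_fst_mem_jetRing hH h0 hJ hS hTa hT hβ hQ hcomp hE hE0 hlead
  have hjet : ∀ c, ∀ j ≤ k, numFam (fun i => tcoef j (conjFun (component c (H i))) 0) ∈
      jetRing H k := by
    intro c j hj
    refine jetRing_germClosed k (numFam_conj_mem (taylorCoeff_mem_jetRing hH h0 c
      (u := 0) (v := j) (by omega))) fun i => Eventually.of_forall fun z => ?_
    exact (ncoef_tcoef_conjFun (analyticAt_component (hH i) c) 0 j).symm
  refine ⟨hfst k, tc_famG_mem (hQ := hQ) (jetRing_germClosed k) hT hβ (fun j hj => ?_) (hjet 1)⟩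
  exact tc_famc_mem (jetRing_germClosed k) (hcomp k) (fun j hj => jetRing_mono hj.le (hfst j))
    (hjet 0) (hjet 1) hj

end JetDetermination

section Hypersurfaces

theorem eventually_onGraph_of_sendsInto {M M' : Set (ℂ × ℂ)} {p p' : ℂ × ℂ}
    {Z Z' : OpenPartialHomeomorph (ℂ × ℂ) (ℂ × ℂ)} (hp : p ∈ Z.source) (hp0 : Z p = 0)
    (hp' : p' ∈ Z'.source) (hp0' : Z' p' = 0) {φ φ' : ℂ × ℂ × ℂ → ℂ}
    (hφ : ∀ᶠ q in 𝓝 p, q ∈ M ↔ OnGraph φ (Z q)) (hφ' : ∀ᶠ q in 𝓝 p', q ∈ M' ↔ OnGraph φ' (Z' q))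
    {H : ℂ × ℂ → ℂ × ℂ} (hH : AnalyticAt ℂ H 0) (hH0 : H 0 = 0) (hs : SendsInto M M' Z Z' H) :
    ∀ᶠ x in 𝓝 0, OnGraph φ x → OnGraph φ' (H x) := by
  have key : ∀ {e : OpenPartialHomeomorph (ℂ × ℂ) (ℂ × ℂ)} {q : ℂ × ℂ}, q ∈ e.source → e q = 0 →
      Tendsto e.symm (𝓝 0) (𝓝 q) ∧ ∀ᶠ x in 𝓝 0, e (e.symm x) = x := by
    intro e q hq hq0
    have ht : (0 : ℂ × ℂ) ∈ e.target := hq0 ▸ e.map_source hq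
    refine ⟨?_, e.eventually_right_inverse ht⟩
    have := (e.continuousAt_symm ht).tendsto
    rwa [← hq0, e.left_inv hq, hq0] at this
  obtain ⟨h1, h2⟩ := key hp hp0
  obtain ⟨h1', h2'⟩ := key hp' hp0'
  have hH1 : Tendsto H (𝓝 0) (𝓝 0) := by simpa [hH0] using hH.continuousAt.tendsto
  filter_upwards [hs, h1.eventually hφ, h2, hH1.eventually (h1'.eventually hφ'),
    hH1.eventually h2'] with x e1 e2 e3 e4 e5 hx
  rw [e3] at e2
  rw [e5] at e4
  exact e4.1 (e1 (e2.2 hx))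

theorem eventually_zero_of_reflection_eq_snd {φ Q : Triple → ℂ} (hφ : AnalyticAt ℂ φ 0)
    (h0 : φ 0 = 0) (hQ : IsReflection φ Q) (h : ∀ᶠ x in 𝓝 0, Q x = x.2) :
    ∀ᶠ x in 𝓝 0, φ x = 0 := by
  have h1 : Tendsto (fun x : Triple => (x.1, x.2 + φ x)) (𝓝 0) (𝓝 0) := by
    have : ContinuousAt (fun x : Triple => (x.1, x.2 + φ x)) 0 :=
      continuousAt_fst.prodMk (continuousAt_snd.add hφ.continuousAt)
    have h2 := this.tendsto
    rwa [h0, add_zero] at h2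
  filter_upwards [hQ.param, h1.eventually h] with x e1 e2
  rw [e2] at e1
  change x.2 + φ x = _ at e1
  have : 2 * φ x = 0 := by linear_combination e1
  simpa using this

end Hypersurfaces

section Main

theorem exists_normal_reflection {φ : ℂ × ℂ × ℂ → ℂ} (hφ : IsNormalGraphFunction φ) (c : ℂ) :
    ∃ T, IsReflection (fun x => c * φ (x.1.1, x.1.2, x.2)) T ∧
      (∀ᶠ y : ℂ × ℂ in 𝓝 0, T ((y.1, 0), y.2) = y.2) ∧
      ∀ᶠ y : ℂ × ℂ in 𝓝 0, T ((0, y.1), y.2) = y.2 := by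
  have ha : AnalyticAt ℂ (fun x : Triple => c * φ (x.1.1, x.1.2, x.2)) 0 :=
    analyticAt_const.mul (AnalyticAt.comp (f := fun x : Triple => (x.1.1, x.1.2, x.2)) (x := 0)
      hφ.analytic ((analyticAt_fst.comp analyticAt_fst).prod
        ((analyticAt_snd.comp analyticAt_fst).prod analyticAt_snd)))
  have h1 : Tendsto (fun s : ℂ => ((0, s) : ℂ × ℂ)) (𝓝 0) (𝓝 0) :=
    (show Continuous (fun s : ℂ => ((0, s) : ℂ × ℂ)) by fun_prop).tendsto' 0 0 rfl
  obtain ⟨T, hT⟩ := exists_isReflection ha (by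
    filter_upwards [h1.eventually hφ.normal_left] with s hs
    exact (congrArg (c * ·) hs).trans (mul_zero c))
  refine ⟨T, hT, ?_, ?_⟩
  · refine hT.eq_self_of_zero (j := fun y : ℂ × ℂ => ((y.1, 0), y.2))
      ((show Continuous (fun y : ℂ × ℂ => (((y.1, 0), y.2) : Triple)) by fun_prop).tendsto' 0 0 rfl)
      ?_
    filter_upwards [hφ.normal_left] with y hy
    rw [hy, mul_zero]
  · refine hT.eq_self_of_zero (j := fun y : ℂ × ℂ => ((0, y.1), y.2))
      ((show Continuous (fun y : ℂ × ℂ => (((0, y.1), y.2) : Triple)) by fun_prop).tendsto' 0 0 rfl)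
      ?_
    filter_upwards [hφ.normal_right] with y hy
    rw [hy, mul_zero]

theorem hasHolomorphicCoeffs_zero (m : ℕ) : (0 : JetPolynomial m).HasHolomorphicCoeffs :=
  ⟨Set.univ, isOpen_univ, fun _ _ _ _ => trivial, fun _ => by
    rw [MvPolynomial.coeff_zero]
    exact differentiableOn_const (0 : ℂ)⟩

theorem exists_reflectionForms_of_not_leviFlat {M' : Set (ℂ × ℂ)} {p' : ℂ × ℂ}
    {Z' : OpenPartialHomeomorph (ℂ × ℂ) (ℂ × ℂ)} (hp : p' ∈ Z'.source) (hp0 : Z' p' = 0)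
    (hZ' : IsBiholomorphic Z') {φ φ' : ℂ × ℂ × ℂ → ℂ} (hφ : IsNormalGraphFunction φ)
    (hφ' : IsNormalGraphFunction φ') (hM : ∀ᶠ q in 𝓝 p', q ∈ M' ↔ OnGraph φ' (Z' q))
    (hM' : ¬IsLeviFlatNear M' p') :
    ∃ T Q : Triple → ℂ, IsReflection (fun x => Complex.I * φ (x.1.1, x.1.2, x.2)) T ∧
      IsReflection (fun x => -(Complex.I * φ' (x.1.1, x.1.2, x.2))) Q ∧
      ∃ m β a b a' b', β ≠ 0 ∧ ReflectionForm m β T a b ∧ ReflectionForm m β Q a' b' ∧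
        ¬((∀ᶠ z in 𝓝 0, a (z, 0) = 0) ∧ ∀ᶠ z in 𝓝 0, a' (z, 0) = 0) := by
  obtain ⟨T, hT, hTX, hTZ⟩ := exists_normal_reflection hφ Complex.I
  obtain ⟨Q, hQ, hQX, hQZ⟩ := exists_normal_reflection hφ' (-Complex.I)
  have ha : AnalyticAt ℂ (fun x : Triple => -Complex.I * φ' (x.1.1, x.1.2, x.2)) 0 :=
    analyticAt_const.mul (AnalyticAt.comp (f := fun x : Triple => (x.1.1, x.1.2, x.2)) (x := 0)
      hφ'.analytic ((analyticAt_fst.comp analyticAt_fst).prod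
        ((analyticAt_snd.comp analyticAt_fst).prod analyticAt_snd)))
  have hne : ¬∀ᶠ x in 𝓝 0, Q x = x.2 := by
    intro h
    refine hM' (isLeviFlatNear_of_eventually_zero hp hp0 hZ' hM ?_)
    have h0 : φ' (0, 0, 0) = 0 := hφ'.normal_left.self_of_nhds
    have h1 := eventually_zero_of_reflection_eq_snd ha
      ((congrArg (-Complex.I * ·) h0).trans (mul_zero _)) hQ h
    have hc : Tendsto (fun x : ℂ × ℂ × ℂ => (((x.1, x.2.1), x.2.2) : Triple)) (𝓝 0) (𝓝 0) :=
      (show Continuous (fun x : ℂ × ℂ × ℂ => (((x.1, x.2.1), x.2.2) : Triple)) by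
        fun_prop).tendsto' 0 0 rfl
    filter_upwards [hc.eventually h1] with x hx
    exact (mul_eq_zero.1 hx).resolve_left (neg_ne_zero.2 Complex.I_ne_zero)
  exact ⟨T, Q, hT, by simpa only [neg_mul] using hQ,
    exists_reflectionForms hT.analytic hQ.analytic hTX hTZ hQX hQZ hne⟩

theorem theorem3p1 (M M' : Set (ℂ × ℂ)) (p p' : ℂ × ℂ)
    (Z Z' : OpenPartialHomeomorph (ℂ × ℂ) (ℂ × ℂ))
    (hZ : IsNormalCoordinates M p Z) (hZ' : IsNormalCoordinates M' p' Z')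
    (hM : ¬ IsLeviFlatNear M p) (hM' : ¬ IsLeviFlatNear M' p') (k : ℕ) :
    ∃ Φ : Fin 2 → JetPolynomial (k + 1),
      (∀ i, (Φ i).HasHolomorphicCoeffs) ∧
      ∀ H : ℂ × ℂ → ℂ × ℂ, IsLocalBiholomorphism H → SendsInto M M' Z Z' H →
        ∀ᶠ z : ℂ in 𝓝 0, ∀ i : Fin 2,
          coord i (partialDeriv 0 k H (z, 0)) =
            (Φ i).value (z, jacobian H, fun a b => conj (jacobian H a b))
              (jet (k + 1) H) (fun a => conj (jet (k + 1) H a)) := by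
  obtain ⟨φ, hφ, hMφ⟩ := hZ.graph
  obtain ⟨φ', hφ', hMφ'⟩ := hZ'.graph
  obtain ⟨T, Q, hT, hQ, m, β, a, b, a', b', hβ, hTf, hQf, hne⟩ :=
    exists_reflectionForms_of_not_leviFlat hZ'.mem_source hZ'.map_eq_zero hZ'.biholomorphic hφ hφ'
      hMφ' hM'
  let ι : Type := {H : ℂ × ℂ → ℂ × ℂ // IsLocalBiholomorphism H ∧ SendsInto M M' Z Z' H}
  let H : ι → ℂ × ℂ → ℂ × ℂ := Subtype.val
  rcases isEmpty_or_nonempty ι with hι | ⟨⟨i₀⟩⟩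
  · exact ⟨0, fun i => hasHolomorphicCoeffs_zero _, fun H h1 h2 => (hι.false ⟨H, h1, h2⟩).elim⟩
  have hH : ∀ i, AnalyticAt ℂ (H i) 0 := fun i => i.2.1.analyticAt
  have h0 : ∀ i, H i 0 = 0 := fun i => i.2.1.1
  have hS : ∀ i, SegreMap T Q (component 0 (H i)) (component 1 (H i)) := fun i =>
    { analytic_fst := analyticAt_component (hH i) 0
      analytic_snd := analyticAt_component (hH i) 1
      map_fst := congrArg Prod.fst (h0 i)
      map_snd := congrArg Prod.snd (h0 i)
      eq := segre_identity hφ hφ' hT hQ (hH i) (h0 i)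
        (eventually_onGraph_of_sendsInto hZ.mem_source hZ.map_eq_zero hZ'.mem_source
          hZ'.map_eq_zero hMφ hMφ' (hH i) (h0 i) i.2.2) }
  have hJ : TriangularFamily H := fun i =>
    jacobian_mem_invUpperTriangular i.2.1 ((hS i).eventually_zero hTf hβ hQf)
  obtain ⟨hF, hG⟩ := tc_mem_jetRing hH h0 hJ hS hT.analytic hTf hβ hQf hne i₀ k
  have key : ∀ c, ∃ P : JetPolynomial (k + 1), P.HasHolomorphicCoeffs ∧ ∀ i, ∀ᶠ z in 𝓝 0,
      (k.factorial : ℂ) * tcoef k (component c (H i)) z =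
        P.value (coeffPoint H i z) (jet (k + 1) (H i)) (fun a => conj (jet (k + 1) (H i) a)) := by
    have hk := known_mem_jetRing (H := H) (analyticAt_const (v := (k.factorial : ℂ))) k
    intro c
    fin_cases c
    · exact exists_jetPolynomial ((jetRing H k).mul_mem hk hF)
    · exact exists_jetPolynomial ((jetRing H k).mul_mem hk hG)
  choose Φ hΦ hval using key
  refine ⟨Φ, hΦ, fun H' h1 h2 => ?_⟩
  rw [eventually_all]
  intro c
  filter_upwards [hval c ⟨H', h1, h2⟩, eventually_coord_iteratedDeriv h1.analyticAt k c] with z e1 e2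
  rw [partialDeriv, iteratedDeriv_zero, e2]
  exact e1

end Main
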